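/- **Definitions.** A graph of groups consists of a connected graph (loops and multiple edges allowed) whose edges $E$ have ends $\partial^\pm E$, of vertex groups $G_V$ and edge groups $G_E$, and of monomorphisms $\iota_E^\pm\colon G_E\to G_{\partial^\pm E}$. Its fundamental group at a maximal subtree is generated by the vertex groups and letters $\tau_E$, with the relations of the vertex groups, $\tau_E\,\iota_E^-(\gamma)\,\tau_E^{-1}=\iota_E^+(\gamma)$ for $\gamma\in G_E$, and $\tau_E=1$ for $E$ in the subtree. The graph of groups is *admissible of rank $k$* if the graph is finite with at least one edge and there are normal subgroups $\Lambda_V\lhd G_V$ such that: (i) $\Lambda_V$ is free abelian of rank $k-1$ and $G_V/\Lambda_V$ is non-elementary hyperbolic; (ii) $G_E$ is virtually free abelian of rank $k$; (iii) if $V=\partial^{\pm}E$ and $\gamma\in G_V\setminus\iota_E^\pm(G_E)$, then $\iota_E^\pm(G_E)$ and $\gamma\,\iota_E^\pm(G_E)\,\gamma^{-1}$ are not commensurable, and the images in $G_V$ of two different edges at $V$ (the two ends of a loop counted as different) are not conjugate commensurable; (iv) $(\iota_E^-)^{-1}(\Lambda_{\partial^-E})$ and $(\iota_E^+)^{-1}(\Lambda_{\partial^+E})$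 generate a subgroup of finite index in $G_E$. An action of a group $\Gamma$ on a space $X$ is *admissible of rank $k$* if $X$ is a locally compact Hadamard space (a complete, simply connected length space of non-positive curvature), the action is by isometries, properly discontinuous and cocompact, and $\Gamma$ is isomorphic to the fundamental group of an admissible graph of groups of rank $k$. **The space $Y_\varepsilon$.** Let $\varepsilon\ge 0$. Take nine (thickened) flat 3-tori with coordinates $(r,s,t;u)$, for $i=0,1,2,3$ and both signs $\pm$: $E_x=(\mathbb R/\sqrt2\mathbb Z)^3$; $E_i^\pm=(\mathbb R/\mathbb Z)^2\times\mathbb R/\sqrt2\mathbb Z$ for $i=0,1$; $E_i^\pm=(\mathbb R/\tfrac1{\sqrt2}\mathbb Z)^2\times\mathbb R/\sqrt2\mathbb Z\times[0,\varepsilon]$ for $i=2,3$ (with $u=0$ where there is no interval factor). Take ten flat cylinders $C_i^\pm$, $C_x^\pm$ of the form $\mathbb R/\ell\mathbb Z\times\mathbb R/\sqrt2\mathbb Z\times[0,1]$ with arc length coordinates $(s,t;u)$, where $\ell=\sqrt2,1,\tfrac1{\sqrt2},1$ for $C_0^\pm,C_1^\pm,C_2^\pm,C_3^\pm$ and $\ell=\sqrt2$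 for $C_x^\pm$. For all $s,t\in\mathbb R$ the end points $(s,t;0)$ and $(s,t;1)$ of the cylinders are glued to the following points of the tori: - $C_0^\pm$: $\left(\tfrac{s}{\sqrt2},-\tfrac{s}{\sqrt2},t;0\right)\in E_0^\pm$ and $\left(\tfrac{s}{\sqrt2},-\tfrac{s}{\sqrt2},t;0\right)\in E_1^\pm$; - $C_1^\pm$: $(s,0,t;0)\in E_1^\pm$ and $\left(\tfrac{s}{\sqrt2},\tfrac{s}{\sqrt2},t;0\right)\in E_2^\pm$; - $C_2^\pm$: $(0,s,t;\varepsilon)\in E_2^\pm$ and $(0,s,t;\varepsilon)\in E_3^\pm$; - $C_3^\pm$: $\left(\tfrac{s}{\sqrt2},\tfrac{s}{\sqrt2},t;0\right)\in E_3^\pm$ and $(s,0,t;0)\in E_0^\pm$; - $C_x^-$: $\left(\tfrac{s}{\sqrt2},-\tfrac{s}{\sqrt2},t;0\right)\in E_0^-$ and $(s,0,t;0)\in E_x$; - $C_x^+$: $(s,t,0;0)\in E_x$ and $\left(-\tfrac{s}{\sqrt2},\tfrac{s}{\sqrt2},t;0\right)\in E_0^+$. Let $Y_\varepsilon$ be the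 resulting quotient with the induced length metric, $X_\varepsilon$ its universal cover with the lifted length metric, and $\Gamma=\pi_1(Y_\varepsilon)$, acting on $X_\varepsilon$ by deck transformations. **Proposition 7.** For every $\varepsilon\ge0$ the action of $\Gamma$ on $X_\varepsilon$ is admissible of rank $3$. More precisely, it is a geometric action on a locally compact Hadamard space, and $\Gamma$ is isomorphic to the fundamental group of an admissible graph of groups of rank $3$ over the graph with eight vertices $V_i^\pm$ ($i\in\mathbb Z/4$) and nine edges, $E_i^\pm$ from $V_{i-1}^\pm$ to $V_i^\pm$ and $E_x$ from $V_0^-$ to $V_0^+$, in which the vertex groups of $V_0^\pm$ are isomorphic to $F_3\times\mathbb Z^2$, those of $V_i^\pm$ with $i\neq0$ are isomorphic to $F_2\times\mathbb Z^2$, and all edge groups are isomorphic to $\mathbb Z^3$. -/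

import Mathlib

open scoped NNReal ENNReal

noncomputable section

/-! ### Lengths of paths and the universal cover of a length space -/

/-- The length of a path in an (extended pseudo-)metric space. -/
def pathLength {X : Type*} [PseudoEMetricSpace X] {x y : X} (γ : Path x y) : ℝ≥0∞ :=
  eVariationOn γ Set.univ

theorem pathLength_refl {X : Type*} [PseudoEMetricSpace X] (x : X) :
    pathLength (Path.refl x) = 0 :=
  eVariationOn.constant_on (by
    rintro _ ⟨s, _, rfl⟩ _ ⟨t, _, rfl⟩
    rfl)

theorem pathLength_symm_le {X : Type*} [PseudoEMetricSpace X] {x y : X} (γ : Path x y) :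
    pathLength γ.symm ≤ pathLength γ :=
  eVariationOn.comp_le_of_antitoneOn (γ : unitInterval → X) unitInterval.symm
    (fun _ _ _ _ h => unitInterval.symm_le_symm.2 h) (fun _ _ => Set.mem_univ _)

theorem pathLength_trans_le {X : Type*} [PseudoEMetricSpace X] {x y z : X}
    (γ : Path x y) (δ : Path y z) :
    pathLength (γ.trans δ) ≤ pathLength γ + pathLength δ := by
  have hm : (1 / 2 : ℝ) ∈ unitInterval := ⟨by norm_num, by norm_num⟩
  set m : unitInterval := ⟨1 / 2, hm⟩ with hmdef
  have hU : (Set.univ : Set unitInterval) = Set.Iic m ∪ Set.Ici m := by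
    ext t; simp
  unfold pathLength
  rw [hU, eVariationOn.union (x := m) _ ⟨Set.mem_Iic.2 le_rfl, fun _ h => h⟩
    ⟨Set.mem_Ici.2 le_rfl, fun _ h => h⟩]
  refine add_le_add ?_ ?_
  · rw [← hU]
    have h1 : Set.EqOn (γ.trans δ : unitInterval → X)
        ((γ : unitInterval → X) ∘ fun t : unitInterval => Set.projIcc 0 1 zero_le_one (2 * (t : ℝ))) (Set.Iic m) := by
      intro t ht
      have ht' : (t : ℝ) ≤ 1 / 2 := ht
      simp only [Function.comp]
      rw [Path.trans_apply, dif_pos ht', Set.projIcc_of_mem]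
    rw [eVariationOn.congr h1]
    refine eVariationOn.comp_le_of_monotoneOn _ _ ?_ (fun _ _ => Set.mem_univ _)
    intro s _ t _ hst
    exact Set.monotone_projIcc _ (mul_le_mul_of_nonneg_left hst (by norm_num))
  · rw [← hU]
    have h1 : Set.EqOn (γ.trans δ : unitInterval → X)
        ((δ : unitInterval → X) ∘ fun t : unitInterval => Set.projIcc 0 1 zero_le_one (2 * (t : ℝ) - 1))
        (Set.Ici m) := by
      intro t ht
      have ht' : (1 / 2 : ℝ) ≤ t := ht
      simp only [Function.comp]
      rcases ht'.eq_or_lt with h | h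
      · have : t = m := Subtype.ext h.symm
        subst this
        rw [Path.trans_apply, dif_pos le_rfl]
        have e1 : Set.projIcc (0 : ℝ) 1 zero_le_one (2 * ((m : unitInterval) : ℝ) - 1) = 0 := by
          have : 2 * ((m : unitInterval) : ℝ) - 1 = 0 := by simp [hmdef]
          rw [this]; exact Set.projIcc_left _
        rw [e1, Path.source]
        convert γ.target using 2
        exact Subtype.ext (by simp [hmdef])
      · rw [Path.trans_apply, dif_neg (not_le.2 h), Set.projIcc_of_mem]
    rw [eVariationOn.congr h1]
    refine eVariationOn.comp_le_of_monotoneOn _ _ ?_ (fun _ _ => Set.mem_univ _)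
    intro s _ t _ hst
    exact Set.monotone_projIcc _
      (sub_le_sub_right (mul_le_mul_of_nonneg_left (show (s : ℝ) ≤ t from hst) (by norm_num)) _)

/-- The universal cover of `Y` at the base point `y₀`: its points are the homotopy classes
(relative to the end points) of paths that start in `y₀`. -/
structure UniversalCover (Y : Type*) [TopologicalSpace Y] (y₀ : Y) where
  pt : Y
  cls : Path.Homotopic.Quotient y₀ pt

namespace UniversalCover

/-- The lifted length metric: the distance of `a` and `b` is the infimum of the lengths of the
paths in `Y` whose lift that starts in `a` ends in `b`. -/
def liftDist {Y : Type*} [PseudoEMetricSpace Y] {y₀ : Y} (a b : UniversalCover Y y₀) : ℝ≥0∞ :=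
  ⨅ (γ : Path a.pt b.pt) (_ : a.cls.trans (Path.Homotopic.Quotient.mk γ) = b.cls), pathLength γ

theorem liftDist_symm_le {Y : Type*} [PseudoEMetricSpace Y] {y₀ : Y} (a b : UniversalCover Y y₀) :
    liftDist a b ≤ liftDist b a := by
  refine le_iInf₂ fun γ h => (iInf₂_le γ.symm ?_).trans (pathLength_symm_le γ)
  rw [← h, Path.Homotopic.Quotient.mk_symm, Path.Homotopic.Quotient.trans_assoc,
    Path.Homotopic.Quotient.trans_symm, Path.Homotopic.Quotient.trans_refl]

theorem liftDist_self {Y : Type*} [PseudoEMetricSpace Y] {y₀ : Y} (a : UniversalCover Y y₀) :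
    liftDist a a = 0 := by
  refine le_antisymm ?_ zero_le
  refine (iInf₂_le (Path.refl a.pt) ?_).trans (pathLength_refl _).le
  rw [Path.Homotopic.Quotient.mk_refl, Path.Homotopic.Quotient.trans_refl]

theorem liftDist_triangle {Y : Type*} [PseudoEMetricSpace Y] {y₀ : Y}
    (a b c : UniversalCover Y y₀) : liftDist a c ≤ liftDist a b + liftDist b c := by
  unfold liftDist
  simp only [ENNReal.iInf_add, ENNReal.add_iInf]
  refine le_iInf₂ fun δ hδ => le_iInf₂ fun γ hγ => ?_
  refine (iInf₂_le (γ.trans δ) ?_).trans (pathLength_trans_le γ δ)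
  rw [Path.Homotopic.Quotient.mk_trans, ← Path.Homotopic.Quotient.trans_assoc, hγ, hδ]

/-- The universal cover with the lifted length metric (and its topology). -/
instance (Y : Type*) [PseudoEMetricSpace Y] (y₀ : Y) :
    PseudoEMetricSpace (UniversalCover Y y₀) where
  edist := liftDist
  edist_self := liftDist_self
  edist_comm a b := le_antisymm (liftDist_symm_le a b) (liftDist_symm_le b a)
  edist_triangle := liftDist_triangle

/-- The action of the fundamental group by deck transformations. (The product `p * q` in Mathlib's
fundamental group is the class that runs through `q` first; therefore `p` acts by prepending the
inverse of `p`.) -/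
instance (Y : Type*) [TopologicalSpace Y] (y₀ : Y) :
    MulAction (FundamentalGroup Y y₀) (UniversalCover Y y₀) where
  smul p a := ⟨a.pt, (p.toPath.symm).trans a.cls⟩
  one_smul a := by
    refine congrArg (UniversalCover.mk a.pt) ?_
    change ((1 : FundamentalGroup Y y₀)⁻¹).toPath.trans a.cls = a.cls
    rw [inv_one]
    exact Path.Homotopic.Quotient.refl_trans _
  mul_smul p q a := by
    refine congrArg (UniversalCover.mk a.pt) ?_
    change ((p * q)⁻¹).toPath.trans a.cls = p⁻¹.toPath.trans (q⁻¹.toPath.trans a.cls)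
    rw [mul_inv_rev, ← Path.Homotopic.Quotient.trans_assoc]
    rfl

end UniversalCover

/-! ### Hadamard spaces and geometric actions -/

/-- `α` is a geodesic from `x` to `y`, parametrized proportionally to arc length. -/
def IsGeodesicBetween {X : Type*} [PseudoEMetricSpace X] (α : unitInterval → X) (x y : X) : Prop :=
  α 0 = x ∧ α 1 = y ∧
    ∀ s t : unitInterval, edist (α s) (α t) = ENNReal.ofReal |(s : ℝ) - (t : ℝ)| * edist x y

/-- The subspace `B` is a CAT(0) space: any two points of `B` are joined by a geodesic in `B`, and
for all geodesic triangles in `B` the distance of two points on two sides (which have the vertex `p`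
in common) is at most the distance of the corresponding points of a comparison triangle in the
Euclidean plane. -/
def IsCAT0On {X : Type*} [PseudoEMetricSpace X] (B : Set X) : Prop :=
  (∀ p ∈ B, ∀ q ∈ B, ∃ α : unitInterval → X, IsGeodesicBetween α p q ∧ ∀ s, α s ∈ B) ∧
  ∀ p ∈ B, ∀ q ∈ B, ∀ r ∈ B, ∀ α β : unitInterval → X,
    IsGeodesicBetween α p q → (∀ s, α s ∈ B) → IsGeodesicBetween β p r → (∀ s, β s ∈ B) →
    ∀ p' q' r' : EuclideanSpace ℝ (Fin 2),
      edist p' q' = edist p q → edist p' r' = edist p r → edist q' r' = edist q r →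
      ∀ s t : unitInterval, edist (α s) (β t) ≤
        edist (AffineMap.lineMap p' q' (s : ℝ)) (AffineMap.lineMap p' r' (t : ℝ))

/-- A Hadamard space: a complete, connected and simply connected length space (with a genuine
metric) of non-positive curvature in the sense of Alexandrov. -/
structure IsHadamardSpace (X : Type*) [PseudoEMetricSpace X] : Prop where
  edist_ne_top : ∀ x y : X, edist x y ≠ ⊤
  eq_of_edist_eq_zero : ∀ x y : X, edist x y = 0 → x = y
  complete : CompleteSpace X
  connected : ConnectedSpace X
  simplyConnected : SimplyConnectedSpace X
  length_space : ∀ x y : X, edist x y = ⨅ γ : Path x y, pathLength γ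
  nonpos_curved : ∀ x : X, ∃ r : ℝ≥0∞, 0 < r ∧ IsCAT0On (Metric.eball x r)

/-- A geometric action: by isometries, properly discontinuous and cocompact. -/
structure IsGeometricAction (Γ X : Type*) [Group Γ] [PseudoEMetricSpace X] [MulAction Γ X] :
    Prop where
  isometric : ∀ (g : Γ) (x y : X), edist (g • x) (g • y) = edist x y
  properlyDiscontinuous : ProperlyDiscontinuousSMul Γ X
  cocompact : ∃ K : Set X, IsCompact K ∧ ∀ x : X, ∃ g : Γ, g • x ∈ K

/-! ### Hyperbolic and free abelian groups -/

/-- The word length of `g` with respect to `S`. -/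
def wordLength {G : Type*} [Group G] (S : Set G) (g : G) : ℕ :=
  sInf {n | ∃ l : List G, l.length = n ∧ (∀ x ∈ l, x ∈ S ∨ x⁻¹ ∈ S) ∧ l.prod = g}

/-- The word metric with respect to `S`. -/
def wordDist {G : Type*} [Group G] (S : Set G) (g h : G) : ℕ := wordLength S (g⁻¹ * h)

/-- A (Gromov) hyperbolic group: it has a finite generating set whose word metric satisfies the four
point condition. -/
def IsHyperbolicGroup (G : Type*) [Group G] : Prop :=
  ∃ S : Set G, S.Finite ∧ Subgroup.closure S = ⊤ ∧ ∃ δ : ℕ, ∀ w x y z : G,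
    wordDist S w x + wordDist S y z ≤
      max (wordDist S w y + wordDist S x z) (wordDist S w z + wordDist S x y) + δ

/-- A group is elementary if it is virtually cyclic (in particular if it is finite). -/
def IsElementaryGroup (G : Type*) [Group G] : Prop :=
  ∃ H : Subgroup G, IsCyclic H ∧ H.FiniteIndex

def IsFreeAbelianOfRank (G : Type*) [Group G] (n : ℕ) : Prop :=
  Nonempty (G ≃* Multiplicative (Fin n → ℤ))

def IsVirtuallyFreeAbelianOfRank (G : Type*) [Group G] (n : ℕ) : Prop :=
  ∃ H : Subgroup G, H.FiniteIndex ∧ IsFreeAbelianOfRank H n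

/-! ### Graphs of groups -/

/-- An oriented graph, possibly with loops and multiple edges: `bd false e` and `bd true e` are the
initial vertex `∂⁻e` and the terminal vertex `∂⁺e` of the edge `e`. -/
structure OrientedGraph where
  V : Type
  E : Type
  bd : Bool → E → V

/-- The graph with all vertices of `𝒢` and the edges in `T` is connected. -/
def OrientedGraph.ConnectedBy (𝒢 : OrientedGraph) (T : Set 𝒢.E) : Prop :=
  Nonempty 𝒢.V ∧ ∀ v w : 𝒢.V,
    Relation.EqvGen (fun a b => ∃ e ∈ T, 𝒢.bd false e = a ∧ 𝒢.bd true e = b) v w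

/-- `T` is the set of edges of a maximal subtree, i.e. of a spanning tree: a set of edges that is
minimal among those that connect all the vertices. -/
def OrientedGraph.IsMaximalSubtree (𝒢 : OrientedGraph) (T : Set 𝒢.E) : Prop :=
  Minimal 𝒢.ConnectedBy T

/-- A graph of groups over the connected graph `𝒢`. -/
structure GraphOfGroups (𝒢 : OrientedGraph) where
  connected : 𝒢.ConnectedBy Set.univ
  vertexGroup : 𝒢.V → Type
  edgeGroup : 𝒢.E → Type
  [instVertexGroup : ∀ v, Group (vertexGroup v)]
  [instEdgeGroup : ∀ e, Group (edgeGroup e)]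
  ι : ∀ (s : Bool) (e : 𝒢.E), edgeGroup e →* vertexGroup (𝒢.bd s e)
  ι_injective : ∀ s e, Function.Injective (ι s e)

attribute [instance] GraphOfGroups.instVertexGroup GraphOfGroups.instEdgeGroup

namespace GraphOfGroups

variable {𝒢 : OrientedGraph} (G : GraphOfGroups 𝒢)

/-- The free product of the vertex groups and of the free group on the stable letters `τ_E`. -/
abbrev Generators : Type := Monoid.Coprod (Monoid.CoprodI G.vertexGroup) (FreeGroup 𝒢.E)

def ofVertex (v : 𝒢.V) : G.vertexGroup v →* G.Generators :=
  Monoid.Coprod.inl.comp Monoid.CoprodI.of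

def stableLetter (e : 𝒢.E) : G.Generators := Monoid.Coprod.inr (FreeGroup.of e)

/-- The relations `τ_E ι⁻(γ) τ_E⁻¹ = ι⁺(γ)`, and `τ_E = 1` for the edges of the maximal subtree. -/
def relators (T : Set 𝒢.E) : Set G.Generators :=
  {x | ∃ (e : 𝒢.E) (g : G.edgeGroup e),
    x = G.stableLetter e * G.ofVertex _ (G.ι false e g) * (G.stableLetter e)⁻¹ *
      (G.ofVertex _ (G.ι true e g))⁻¹} ∪ G.stableLetter '' T

/-- The fundamental group of a graph of groups at a maximal subtree. -/
abbrev FundGroup (T : Set 𝒢.E) : Type := G.Generators ⧸ Subgroup.normalClosure (G.relators T)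

/-- `Γ` is isomorphic to the fundamental group of `G`. -/
def HasFundGroup (Γ : Type) [Group Γ] : Prop :=
  ∃ T : Set 𝒢.E, 𝒢.IsMaximalSubtree T ∧ Nonempty (Γ ≃* G.FundGroup T)

/-- The image in the group of `v` of the group of `e` whose end `s` is `v`. -/
def edgeImage {v : 𝒢.V} (s : Bool) (e : 𝒢.E) (h : 𝒢.bd s e = v) : Subgroup (G.vertexGroup v) :=
  h ▸ (G.ι s e).range

/-- The conjugate `γ A γ⁻¹`. -/
def conjSubgroup {A : Type*} [Group A] (γ : A) (H : Subgroup A) : Subgroup A :=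
  H.map (MulAut.conj γ).toMonoidHom

/-- Admissible graphs of groups of rank `k`. The two ends of a loop count as two different edges
at their vertex. -/
structure IsAdmissible (k : ℕ) : Prop where
  one_le_rank : 1 ≤ k
  finite_V : Finite 𝒢.V
  finite_E : Finite 𝒢.E
  nonempty_E : Nonempty 𝒢.E
  /-- The vertex groups are extensions of non-elementary hyperbolic groups by free
  abelian groups `Λ v` of rank `k - 1`, and for any edge the preimages of the two groups `Λ v` at its
  ends generate a subgroup of finite index of the edge group. -/
  vertex : ∃ (Λ : ∀ v, Subgroup (G.vertexGroup v)) (_ : ∀ v, (Λ v).Normal),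
    (∀ v, IsFreeAbelianOfRank (Λ v) (k - 1) ∧ IsHyperbolicGroup (G.vertexGroup v ⧸ Λ v) ∧
      ¬ IsElementaryGroup (G.vertexGroup v ⧸ Λ v)) ∧
    ∀ e, ((Λ (𝒢.bd false e)).comap (G.ι false e) ⊔
      (Λ (𝒢.bd true e)).comap (G.ι true e)).FiniteIndex
  /-- The edge groups are virtually free abelian of rank `k`. -/
  edge : ∀ e, IsVirtuallyFreeAbelianOfRank (G.edgeGroup e) k
  /-- The image of an edge group in a vertex group is incommensurable to its conjugates by elements
  outside of it. -/
  incommensurable_conj : ∀ (s : Bool) (e : 𝒢.E) (γ : G.vertexGroup (𝒢.bd s e)),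
    γ ∉ (G.ι s e).range →
      ¬ Subgroup.Commensurable (G.ι s e).range (conjSubgroup γ (G.ι s e).range)
  /-- The images of the groups of different edges in a vertex group are not conjugate
  commensurable. -/
  not_conj_commensurable : ∀ (v : 𝒢.V) (s s' : Bool) (e e' : 𝒢.E) (h : 𝒢.bd s e = v)
    (h' : 𝒢.bd s' e' = v), (s, e) ≠ (s', e') → ∀ γ : G.vertexGroup v,
      ¬ Subgroup.Commensurable (G.edgeImage s e h) (conjSubgroup γ (G.edgeImage s' e' h'))

end GraphOfGroups

/-- An admissible action of rank `k`: a geometric action of `Γ` on a locally compact Hadamard space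
such that `Γ` is isomorphic to the fundamental group of an admissible graph of groups of rank `k`. -/
structure IsAdmissibleAction (k : ℕ) (Γ X : Type) [Group Γ] [PseudoEMetricSpace X]
    [MulAction Γ X] : Prop where
  hadamard : IsHadamardSpace X
  locallyCompact : LocallyCompactSpace X
  geometric : IsGeometricAction Γ X
  admissible : ∃ (𝒢 : OrientedGraph) (G : GraphOfGroups 𝒢), G.IsAdmissible k ∧ G.HasFundGroup Γ

/-! ### Gluing metric spaces -/

/-- `GlueChain r p q a` : one gets from `p` to `q` by finitely many moves inside the pieces, of total
length `a`, and finitely many jumps between points that are identified by `r`. -/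
inductive GlueChain {ι : Type*} {X : ι → Type*} [∀ i, PseudoEMetricSpace (X i)]
    (r : (Σ i, X i) → (Σ i, X i) → Prop) : (Σ i, X i) → (Σ i, X i) → ℝ≥0∞ → Prop
  | move (i : ι) (x y : X i) : GlueChain r ⟨i, x⟩ ⟨i, y⟩ (edist x y)
  | jump {p q : Σ i, X i} : r p q → GlueChain r p q 0
  | jump_symm {p q : Σ i, X i} : r p q → GlueChain r q p 0
  | trans {p q s : Σ i, X i} {a b : ℝ≥0∞} :
      GlueChain r p q a → GlueChain r q s b → GlueChain r p s (a + b)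

theorem GlueChain.symm {ι : Type*} {X : ι → Type*} [∀ i, PseudoEMetricSpace (X i)]
    {r : (Σ i, X i) → (Σ i, X i) → Prop} {p q : Σ i, X i} {a : ℝ≥0∞}
    (h : GlueChain r p q a) : GlueChain r q p a := by
  induction h with
  | move i x y => rw [edist_comm]; exact .move i y x
  | jump h => exact .jump_symm h
  | jump_symm h => exact .jump h
  | trans _ _ ih₁ ih₂ => rw [add_comm]; exact ih₂.trans ih₁

/-- The quotient of the disjoint union of the `X i` by the equivalence relation generated by `r`. -/
def Glued {ι : Type*} {X : ι → Type*} (r : (Σ i, X i) → (Σ i, X i) → Prop) : Type _ := Quot r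

/-- The length metric that the pieces induce on the glued space: the distance of two points is the
infimum of the lengths of the chains between them. -/
instance {ι : Type*} {X : ι → Type*} [∀ i, PseudoEMetricSpace (X i)]
    (r : (Σ i, X i) → (Σ i, X i) → Prop) : PseudoEMetricSpace (Glued r) where
  edist := Quot.lift₂ (fun p q => ⨅ a : {a : ℝ≥0∞ // GlueChain r p q a}, a.1)
    (by
      intro p q q' h
      refine le_antisymm (le_iInf fun a => iInf_le_of_le ⟨a.1 + 0, a.2.trans (.jump_symm h)⟩ ?_)
        (le_iInf fun a => iInf_le_of_le ⟨a.1 + 0, a.2.trans (.jump h)⟩ ?_)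
      · exact (add_zero _).le
      · exact (add_zero _).le)
    (by
      intro p p' q h
      refine le_antisymm (le_iInf fun a => iInf_le_of_le ⟨0 + a.1, .trans (.jump h) a.2⟩ ?_)
        (le_iInf fun a => iInf_le_of_le ⟨0 + a.1, .trans (.jump_symm h) a.2⟩ ?_)
      · exact (zero_add _).le
      · exact (zero_add _).le)
  edist_self x := by
    induction x using Quot.ind with | mk p =>
    obtain ⟨i, x⟩ := p
    exact le_antisymm (iInf_le_of_le ⟨_, .move i x x⟩ (edist_self x).le) zero_le
  edist_comm x y := by
    induction x using Quot.ind with | mk p =>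
    induction y using Quot.ind with | mk q =>
    exact le_antisymm (le_iInf fun a => iInf_le_of_le ⟨a.1, a.2.symm⟩ le_rfl)
      (le_iInf fun a => iInf_le_of_le ⟨a.1, a.2.symm⟩ le_rfl)
  edist_triangle x y z := by
    induction x using Quot.ind with | mk p =>
    induction y using Quot.ind with | mk q =>
    induction z using Quot.ind with | mk s =>
    exact ENNReal.le_iInf_add_iInf fun a b => iInf_le_of_le ⟨a.1 + b.1, a.2.trans b.2⟩ le_rfl

/-! ### The torus complex `Y_ε`

The sign `-` is `false` and the sign `+` is `true`. -/

/-- The nine tori `E_x`, `E_i^±`. -/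
inductive TorusIndex
  | x
  | e (sgn : Bool) (i : Fin 4)

/-- The ten cylinders `C_x^±`, `C_i^±`. -/
inductive CylinderIndex
  | cx (sgn : Bool)
  | c (sgn : Bool) (i : Fin 4)

/-- The periods of the coordinates `r` and `s` of a torus (that of `t` is always `√2`). -/
def torusPeriod : TorusIndex → ℝ
  | .x => √2
  | .e _ 0 => 1
  | .e _ 1 => 1
  | .e _ 2 => 1 / √2
  | .e _ 3 => 1 / √2

/-- The thickness of a torus. -/
def thickness (ε : ℝ≥0) : TorusIndex → ℝ≥0
  | .x => 0
  | .e _ 0 => 0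
  | .e _ 1 => 0
  | .e _ 2 => ε
  | .e _ 3 => ε

/-- The period of the coordinate `s` of a cylinder (that of `t` is always `√2`). -/
def cylinderPeriod : CylinderIndex → ℝ
  | .cx _ => √2
  | .c _ 0 => √2
  | .c _ 1 => 1
  | .c _ 2 => 1 / √2
  | .c _ 3 => 1

/-- The thickened flat torus `(ℝ / aℤ × ℝ / aℤ × ℝ / √2ℤ) × [0, w]`, with its product metric. -/
abbrev ThickTorus (ε : ℝ≥0) (e : TorusIndex) : Type :=
  WithLp 2 (PiLp 2 (fun j : Fin 3 => AddCircle (![torusPeriod e, torusPeriod e, √2] j)) ×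
    Set.Icc (0 : ℝ) (thickness ε e))

/-- The cylinder `(ℝ / ℓℤ × ℝ / √2ℤ) × [0, 1]`, with its product metric. -/
abbrev FlatCylinder (c : CylinderIndex) : Type :=
  WithLp 2 (PiLp 2 (fun j : Fin 2 => AddCircle (![cylinderPeriod c, √2] j)) × Set.Icc (0 : ℝ) 1)

/-- The point `(r, s, t; u)` of a thickened torus. -/
def torusPoint (ε : ℝ≥0) (e : TorusIndex) (v : Fin 3 → ℝ) (u : Set.Icc (0 : ℝ) (thickness ε e)) :
    ThickTorus ε e :=
  WithLp.toLp 2 (WithLp.toLp 2 fun j => (v j : AddCircle (![torusPeriod e, torusPeriod e, √2] j)), u)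

/-- The point `(s, t; u)` of a cylinder. -/
def cylinderPoint (c : CylinderIndex) (v : Fin 2 → ℝ) (u : Set.Icc (0 : ℝ) 1) : FlatCylinder c :=
  WithLp.toLp 2 (WithLp.toLp 2 fun j => (v j : AddCircle (![cylinderPeriod c, √2] j)), u)

abbrev Piece (ε : ℝ≥0) : TorusIndex ⊕ CylinderIndex → Type
  | .inl e => ThickTorus ε e
  | .inr c => FlatCylinder c

instance (ε : ℝ≥0) : ∀ i, PseudoEMetricSpace (Piece ε i)
  | .inl e => inferInstanceAs (PseudoEMetricSpace (ThickTorus ε e))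
  | .inr c => inferInstanceAs (PseudoEMetricSpace (FlatCylinder c))

/-- The torus to which the end `b` of a cylinder (`u = 0` for `false` and `u = 1` for `true`) is
glued. -/
def endTorus : CylinderIndex → Bool → TorusIndex
  | .c g 0, false => .e g 0
  | .c g 0, true => .e g 1
  | .c g 1, false => .e g 1
  | .c g 1, true => .e g 2
  | .c g 2, false => .e g 2
  | .c g 2, true => .e g 3
  | .c g 3, false => .e g 3
  | .c g 3, true => .e g 0
  | .cx false, false => .e false 0
  | .cx false, true => .x
  | .cx true, false => .x
  | .cx true, true => .e true 0

/-- The coordinates in `endTorus c b` of the point that is glued to `(s, t)`; here `s` and `t` are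
arc length parameters. -/
def endMap : CylinderIndex → Bool → ℝ → ℝ → Fin 3 → ℝ
  | .c _ 0, _, s, t => ![s / √2, -s / √2, t]
  | .c _ 1, false, s, t => ![s, 0, t]
  | .c _ 1, true, s, t => ![s / √2, s / √2, t]
  | .c _ 2, _, s, t => ![0, s, t]
  | .c _ 3, false, s, t => ![s / √2, s / √2, t]
  | .c _ 3, true, s, t => ![s, 0, t]
  | .cx false, false, s, t => ![s / √2, -s / √2, t]
  | .cx false, true, s, t => ![s, 0, t]
  | .cx true, false, s, t => ![s, t, 0]
  | .cx true, true, s, t => ![-s / √2, s / √2, t]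

/-- The face of `endTorus c b` to which the end `b` of the cylinder `c` is glued: the cylinders
`C_2^±` are glued to the far faces `u = ε` and all the others to the near faces `u = 0`. -/
def endFace (ε : ℝ≥0) : (c : CylinderIndex) → (b : Bool) →
    Set.Icc (0 : ℝ) (thickness ε (endTorus c b))
  | .c g 2, b => ⟨thickness ε (endTorus (.c g 2) b), NNReal.coe_nonneg _, le_rfl⟩
  | _, _ => ⟨0, le_rfl, NNReal.coe_nonneg _⟩

/-- The identifications between the ends of the cylinders and the tori. -/
inductive GlueRel (ε : ℝ≥0) : (Σ i, Piece ε i) → (Σ i, Piece ε i) → Prop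
  | mk (c : CylinderIndex) (b : Bool) (s t : ℝ) : GlueRel ε
      ⟨.inr c, cylinderPoint c ![s, t] (if b then 1 else 0)⟩
      ⟨.inl (endTorus c b), torusPoint ε (endTorus c b) (endMap c b s t) (endFace ε c b)⟩

/-- The space `Y_ε`, with its length metric. -/
abbrev YSpace (ε : ℝ≥0) : Type := Glued (GlueRel ε)

/-- The graph with the eight vertices `V_i^±` and the nine edges `E_x` (from `V_0^-` to `V_0^+`) and
`E_i^±` (from `V_{i-1}^±` to `V_i^±`, indices modulo 4). -/
abbrev torusGraph : OrientedGraph where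
  V := Bool × Fin 4
  E := TorusIndex
  bd
    | b, .x => (b, 0)
    | false, .e g i => (g, i - 1)
    | true, .e g i => (g, i)

end

/-! Curvature. Non-positive curvature is handled through the weighted inequality of Bruhat and Tits
(`IsCN`): for any `p`, `q` and any ratio there is a dividing point whose squared distance to every
point of the set is at most the Euclidean value. For convex subsets of Euclidean space this is an
identity; it yields geodesics, their uniqueness and the comparison of triangles (`IsCN.isCAT0On`);
and it survives gluing along a common convex subset (`GluePair.isCN_union`, Reshetnyak's theorem).
The periods in the definition of `Y_ε` are chosen such that the end of every cylinder is an
isometrically embedded flat 2-torus (`sum_circleNorm_sq_endMap`). Hence a small ball around a point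
of a torus lies in a Euclidean ball, possibly cut off by the faces of the torus, to which finitely
many half balls of cylinders are attached along flat discs. Attaching them one at a time gives the
inequality on small balls, with a uniform radius by compactness (`uniformlyCN`). In a compact path
connected space with this property small balls lift isometrically to the universal cover, which is
therefore a locally compact Hadamard space with a geometric action of the deck group
(`UniformlyCN.isHadamardSpace`, `UniformlyCN.isGeometricAction`).

Fundamental group. It is identified by a universal property. A `LocalSystem` with values in a group
`Q` consists of homomorphisms from the lattices of the pieces to `Q` and of transports across the
ends of the cylinders, subject to the evident relations. Lifting the pieces to the universal cover
produces a local system with values in `Γ` (`exists_development`), and it generates `Γ` because the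
cover is connected (`Development.eq_top`). Conversely, a local system with values in `Q` defines a
flat bundle, and its monodromy is a homomorphism `Γ → Q`, because the cover is simply connected
(`Development.exists_monodromy`). On the algebraic side, the tori are the edges, the cylinders carry
the fibre groups `ℤ²` of the vertices, and a local system that is trivial along a tree is the same
as a homomorphism from the fundamental group of `torusGroups` (`LocalSystem.Normalized.fundHom`,
`universalSystem`). So there are homomorphisms in both directions; their composition is an inner
automorphism on one side, and generation gives surjectivity (`Development.fundHom_bijective`).

Admissibility. A vertex group is `F × ℤ²` with one free generator for each edge end at the vertex,
and an edge group maps onto the product of the cyclic group of its generator with `ℤ²`. Everything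
reduces to free groups: their Cayley graphs are trees, the centralizer of a nontrivial power of a
generator is the cyclic group of this generator, and exponent sums tell generators apart. Condition
(iv) holds with index one, since the two fibre groups at the ends of an edge generate `ℤ³`
(`exists_edgeSplit`). -/

noncomputable section

/-! ### The inequality of Bruhat and Tits -/

/-- The distance of two points as a real number. -/
def rdist {X : Type*} [PseudoEMetricSpace X] (x y : X) : ℝ := (edist x y).toReal

/-- `m` divides the side `p q` in the ratio `s : 1 - s`, in the sense that the inequality of Bruhat
and Tits holds for all points of `B`. -/
def CNPoint {X : Type*} [PseudoEMetricSpace X] (B : Set X) (p q m : X) (s : ℝ) : Prop :=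
  ∀ z ∈ B, rdist m z ^ 2 ≤
    (1 - s) * rdist p z ^ 2 + s * rdist q z ^ 2 - s * (1 - s) * rdist p q ^ 2

/-- Any side in `B` can be divided in any ratio. -/
structure IsCN {X : Type*} [PseudoEMetricSpace X] (B : Set X) : Prop where
  edist_ne_top : ∀ x ∈ B, ∀ y ∈ B, edist x y ≠ ⊤
  exists_point : ∀ p ∈ B, ∀ q ∈ B, ∀ s ∈ Set.Icc (0 : ℝ) 1, ∃ m ∈ B, CNPoint B p q m s

section rdist

variable {X : Type*} [PseudoEMetricSpace X]

theorem rdist_nonneg (x y : X) : 0 ≤ rdist x y := ENNReal.toReal_nonneg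

theorem rdist_comm (x y : X) : rdist x y = rdist y x := by rw [rdist, edist_comm, rdist]

theorem rdist_self (x : X) : rdist x x = 0 := by simp [rdist]

theorem rdist_triangle {x y z : X} (h₁ : edist x y ≠ ⊤) (h₂ : edist y z ≠ ⊤) :
    rdist x z ≤ rdist x y + rdist y z := by
  rw [rdist, rdist, rdist, ← ENNReal.toReal_add h₁ h₂]
  exact ENNReal.toReal_mono (ENNReal.add_ne_top.2 ⟨h₁, h₂⟩) (edist_triangle x y z)

theorem edist_eq_ofReal_rdist {x y : X} (h : edist x y ≠ ⊤) :
    edist x y = ENNReal.ofReal (rdist x y) := (ENNReal.ofReal_toReal h).symm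

/-- The choice `z = p` turns the right side into `(s · d(p, q))²`. -/
theorem CNPoint.rdist_left_le {B : Set X} {p q m : X} {s : ℝ} (h : CNPoint B p q m s)
    (hp : p ∈ B) (hs : 0 ≤ s) : rdist m p ≤ s * rdist p q := by
  have := h p hp
  rw [rdist_self, rdist_comm q p] at this
  exact abs_le_of_sq_le_sq' (by nlinarith) (mul_nonneg hs (rdist_nonneg _ _)) |>.2

theorem CNPoint.rdist_right_le {B : Set X} {p q m : X} {s : ℝ} (h : CNPoint B p q m s)
    (hq : q ∈ B) (hs : s ≤ 1) : rdist m q ≤ (1 - s) * rdist p q := by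
  have := h q hq
  rw [rdist_self] at this
  exact abs_le_of_sq_le_sq' (by nlinarith)
    (mul_nonneg (by linarith) (rdist_nonneg _ _)) |>.2

theorem CNPoint.symm {B : Set X} {p q m : X} {s : ℝ} (h : CNPoint B p q m s) :
    CNPoint B q p m (1 - s) := fun z hz => by
  have := h z hz
  rw [rdist_comm q p]; linarith

theorem CNPoint.mono {B B' : Set X} (hB : B' ⊆ B) {p q m : X} {s : ℝ} (h : CNPoint B p q m s) :
    CNPoint B' p q m s := fun z hz => h z (hB hz)

/-- Two points with the property of a dividing point, one of them with the full inequality. -/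
theorem CNPoint.rdist_eq_zero {B : Set X} {p q m m' : X} {s : ℝ} (h : CNPoint B p q m s)
    (hm' : m' ∈ B) (hs : s ∈ Set.Icc (0 : ℝ) 1) (h₁ : rdist p m' ≤ s * rdist p q)
    (h₂ : rdist q m' ≤ (1 - s) * rdist p q) : rdist m m' = 0 := by
  have h0 := h m' hm'
  have e₁ : rdist p m' ^ 2 ≤ (s * rdist p q) ^ 2 := pow_le_pow_left₀ (rdist_nonneg _ _) h₁ 2
  have e₂ : rdist q m' ^ 2 ≤ ((1 - s) * rdist p q) ^ 2 := pow_le_pow_left₀ (rdist_nonneg _ _) h₂ 2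
  have e₃ := mul_le_mul_of_nonneg_left e₁ (sub_nonneg.2 hs.2)
  have e₄ := mul_le_mul_of_nonneg_left e₂ hs.1
  have : rdist m m' ^ 2 ≤ 0 := by nlinarith
  exact pow_eq_zero_iff (two_ne_zero) |>.1 (le_antisymm this (sq_nonneg _))

/-- Dividing points in different ratios. -/
theorem CNPoint.rdist_le {B : Set X} {p q m m' : X} {s t : ℝ} (h : CNPoint B p q m s)
    (h' : CNPoint B p q m' t) (hp : p ∈ B) (hq : q ∈ B) (hm' : m' ∈ B)
    (hs : s ∈ Set.Icc (0 : ℝ) 1) (ht : t ∈ Set.Icc (0 : ℝ) 1) :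
    rdist m m' ≤ |s - t| * rdist p q := by
  have h0 := h m' hm'
  have e₁ := pow_le_pow_left₀ (rdist_nonneg _ _) (h'.rdist_left_le hp ht.1) 2
  have e₂ := pow_le_pow_left₀ (rdist_nonneg _ _) (h'.rdist_right_le hq ht.2) 2
  rw [rdist_comm] at e₁ e₂
  have e₃ := mul_le_mul_of_nonneg_left e₁ (sub_nonneg.2 hs.2)
  have e₄ := mul_le_mul_of_nonneg_left e₂ hs.1
  refine abs_le_of_sq_le_sq' ?_ (mul_nonneg (abs_nonneg _) (rdist_nonneg _ _)) |>.2
  rw [mul_pow, sq_abs]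
  nlinarith

/-- Dividing points of two sides with a common vertex. -/
theorem CNPoint.rdist_sq_le {B : Set X} {p q r m m' : X} {s t : ℝ} (h : CNPoint B p q m s)
    (h' : CNPoint B p r m' t) (hp : p ∈ B) (hq : q ∈ B) (hm' : m' ∈ B)
    (hs : s ∈ Set.Icc (0 : ℝ) 1) (ht : t ∈ Set.Icc (0 : ℝ) 1) :
    rdist m m' ^ 2 ≤ s ^ 2 * rdist p q ^ 2 + t ^ 2 * rdist p r ^ 2 -
      s * t * (rdist p q ^ 2 + rdist p r ^ 2 - rdist q r ^ 2) := by
  -- The inequality at `m` is tested on `m'`. This leaves the distances from `m'` to `p` and to `q`;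
  -- the latter is bounded by the inequality at `m'` tested on `q`. Together they give the law of
  -- cosines of the comparison triangle.
  have h0 := h m' hm'
  have e₁ := pow_le_pow_left₀ (rdist_nonneg _ _) (h'.rdist_left_le hp ht.1) 2
  have e₂ := h' q hq
  rw [rdist_comm] at e₁
  rw [rdist_comm m' q, rdist_comm r q] at e₂
  have e₃ := mul_le_mul_of_nonneg_left e₁ (sub_nonneg.2 hs.2)
  have e₄ := mul_le_mul_of_nonneg_left e₂ hs.1
  nlinarith

end rdist

theorem IsGeodesicBetween.rdist_eq {X : Type*} [PseudoEMetricSpace X] {α : unitInterval → X}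
    {p q : X} (h : IsGeodesicBetween α p q) (s t : unitInterval) :
    rdist (α s) (α t) = |(s : ℝ) - t| * rdist p q := by
  rw [rdist, h.2.2, ENNReal.toReal_mul, ENNReal.toReal_ofReal (abs_nonneg _), rdist]

/-- The dividing point that `IsCN` provides has distance zero from `α s`, since `α s` has the right
distances from `p` and `q`. Thus the inequality holds along every geodesic, not only at selected
points. -/
theorem IsCN.geodesic_cnPoint {X : Type*} [PseudoEMetricSpace X] {B : Set X} (hB : IsCN B)
    {p q : X} (hp : p ∈ B) (hq : q ∈ B) {α : unitInterval → X} (h : IsGeodesicBetween α p q)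
    (hα : ∀ s, α s ∈ B) (s : unitInterval) : CNPoint B p q (α s) s := by
  obtain ⟨m, hm, hmp⟩ := hB.exists_point p hp q hq s s.2
  have h0 : rdist m (α s) = 0 := by
    refine hmp.rdist_eq_zero (hα s) s.2 ?_ ?_
    · rw [← h.1, h.rdist_eq, h.1]; simp [abs_of_nonneg s.2.1]
    · nth_rw 1 [← h.2.1]
      rw [h.rdist_eq, abs_of_nonneg (by simpa using s.2.2)]; simp
  intro z hz
  have e₁ := rdist_triangle (hB.edist_ne_top _ (hα s) _ hm) (hB.edist_ne_top _ hm _ hz)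
  rw [rdist_comm (α s) m, h0, zero_add] at e₁
  exact (pow_le_pow_left₀ (rdist_nonneg _ _) e₁ 2).trans (hmp z hz)

/-- A choice of dividing points is a geodesic: `CNPoint.rdist_le` bounds all distances from above,
and the triangle inequality along `p`, `α s`, `α t`, `q` then forces equality. -/
theorem IsCN.exists_geodesic {X : Type*} [PseudoEMetricSpace X] {B : Set X} (hB : IsCN B)
    {p q : X} (hp : p ∈ B) (hq : q ∈ B) :
    ∃ α : unitInterval → X, IsGeodesicBetween α p q ∧ ∀ s, α s ∈ B := by
  classical
  -- The ends are prescribed because in a pseudometric space a dividing point for `s = 0` need not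
  -- be equal to `p`.
  have H : ∀ s : unitInterval, ∃ m ∈ B, CNPoint B p q m s ∧ (s = 0 → m = p) ∧ (s = 1 → m = q) := by
    intro s
    by_cases h0 : s = 0
    · subst h0
      exact ⟨p, hp, fun z _ => by simp, fun _ => rfl, fun h => absurd h zero_ne_one⟩
    by_cases h1 : s = 1
    · subst h1
      exact ⟨q, hq, fun z _ => by simp, fun h => absurd h one_ne_zero, fun _ => rfl⟩
    obtain ⟨m, hm, h⟩ := hB.exists_point p hp q hq s s.2
    exact ⟨m, hm, h, fun h => absurd h h0, fun h => absurd h h1⟩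
  choose α hα hc h0 h1 using H
  have hle : ∀ s t, rdist (α s) (α t) ≤ |(s : ℝ) - t| * rdist p q := fun s t =>
    (hc s).rdist_le (hc t) hp hq (hα t) s.2 t.2
  have hE : ∀ s t, edist (α s) (α t) ≠ ⊤ := fun s t => hB.edist_ne_top _ (hα s) _ (hα t)
  refine ⟨α, ⟨h0 0 rfl, h1 1 rfl, ?_⟩, hα⟩
  have key : ∀ s t : unitInterval, s ≤ t → rdist (α s) (α t) = |(s : ℝ) - t| * rdist p q := by
    intro s t hst
    refine le_antisymm (hle s t) ?_
    have e₁ := rdist_triangle (hE 0 s) (hE s 1)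
    have e₂ := rdist_triangle (hE s t) (hE t 1)
    have e₃ := hle 0 s
    have e₄ := hle t 1
    rw [h0 0 rfl] at e₁ e₃
    rw [h1 1 rfl] at e₁ e₂ e₄
    have hst' : (s : ℝ) ≤ t := hst
    rw [abs_sub_comm, abs_of_nonneg (by linarith)]
    rw [abs_sub_comm, abs_of_nonneg (by simpa using s.2.1)] at e₃
    rw [abs_sub_comm, abs_of_nonneg (by simpa using t.2.2)] at e₄
    simp only [Set.Icc.coe_zero, Set.Icc.coe_one, sub_zero] at e₃ e₄
    linarith
  intro s t
  rw [edist_eq_ofReal_rdist (hE s t), edist_eq_ofReal_rdist (hB.edist_ne_top p hp q hq),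
    ← ENNReal.ofReal_mul (abs_nonneg _)]
  congr 1
  rcases le_total s t with h | h
  · exact key s t h
  · rw [rdist_comm, key t s h, abs_sub_comm]

/-- The bound of `CNPoint.rdist_sq_le` is exactly the squared distance of the corresponding points
of the comparison triangle, by bilinearity of the inner product. -/
theorem IsCN.isCAT0On {X : Type*} [PseudoEMetricSpace X] {B : Set X} (hB : IsCN B) :
    IsCAT0On B := by
  refine ⟨fun p hp q hq => hB.exists_geodesic hp hq, ?_⟩
  intro p hp q hq r hr α β hα hαB hβ hβB p' q' r' hpq hpr hqr s t
  have h := (hB.geodesic_cnPoint hp hq hα hαB s).rdist_sq_le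
    (hB.geodesic_cnPoint hp hr hβ hβB t) hp hq (hβB t) s.2 t.2
  have conv : ∀ {x y : X} {x' y' : EuclideanSpace ℝ (Fin 2)}, edist x' y' = edist x y →
      rdist x y = ‖x' - y'‖ := by
    intro x y x' y' h
    rw [rdist, ← h, edist_dist, ENNReal.toReal_ofReal dist_nonneg, dist_eq_norm]
  rw [conv hpq, conv hpr, conv hqr] at h
  have e₁ : AffineMap.lineMap p' q' (s : ℝ) - AffineMap.lineMap p' r' (t : ℝ) =
      (t : ℝ) • (p' - r') - (s : ℝ) • (p' - q') := by
    simp only [AffineMap.lineMap_apply_module']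
    module
  have e₂ : q' - r' = (p' - r') - (p' - q') := by abel
  rw [edist_eq_ofReal_rdist (hB.edist_ne_top _ (hαB s) _ (hβB t)), edist_dist, dist_eq_norm]
  refine ENNReal.ofReal_le_ofReal (abs_le_of_sq_le_sq' ?_ (norm_nonneg _)).2
  refine h.trans (le_of_eq ?_)
  rw [e₁, e₂]
  generalize p' - r' = v
  generalize p' - q' = w
  rw [@norm_sub_sq ℝ, @norm_sub_sq ℝ, norm_smul, norm_smul, mul_pow, mul_pow,
    inner_smul_left, inner_smul_right]
  simp only [Real.norm_eq_abs, sq_abs, conj_trivial, RCLike.re_to_real]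
  ring

/-- Balls are convex: tested on the centre, the inequality bounds the squared distance of the
dividing point by a convex combination of those of `p` and `q`. -/
theorem IsCN.eball {X : Type*} [PseudoEMetricSpace X] {B : Set X} (hB : IsCN B) {x : X}
    (hx : x ∈ B) {r : ℝ≥0∞} (hr : Metric.eball x r ⊆ B) : IsCN (Metric.eball x r) := by
  refine ⟨fun p hp q hq => hB.edist_ne_top p (hr hp) q (hr hq), ?_⟩
  intro p hp q hq s hs
  obtain ⟨m, hm, h⟩ := hB.exists_point p (hr hp) q (hr hq) s hs
  refine ⟨m, ?_, h.mono hr⟩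
  have h0 := h x hx
  have e : ∀ {y}, y ∈ B → edist y x = ENNReal.ofReal (rdist y x) := fun hy =>
    edist_eq_ofReal_rdist (hB.edist_ne_top _ hy _ hx)
  have hle : rdist m x ≤ max (rdist p x) (rdist q x) := by
    refine abs_le_of_sq_le_sq' ?_ ((rdist_nonneg p x).trans (le_max_left _ _)) |>.2
    have e₁ := pow_le_pow_left₀ (rdist_nonneg _ _) (le_max_left (rdist p x) (rdist q x)) 2
    have e₂ := pow_le_pow_left₀ (rdist_nonneg _ _) (le_max_right (rdist p x) (rdist q x)) 2
    have e₃ := mul_le_mul_of_nonneg_left e₁ (sub_nonneg.2 hs.2)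
    have e₄ := mul_le_mul_of_nonneg_left e₂ hs.1
    have e₅ := mul_nonneg (mul_nonneg hs.1 (sub_nonneg.2 hs.2)) (sq_nonneg (rdist p q))
    nlinarith
  rw [Metric.mem_eball] at *
  rw [e hm]
  refine (ENNReal.ofReal_le_ofReal hle).trans_lt ?_
  rw [ENNReal.ofReal_max, ← e (hr hp), ← e (hr hq)]
  exact max_lt hp hq
end

noncomputable section

/-! ### Gluing along a convex subset -/

/-- Place `n` at the origin, `a` at `(L, 0)`, and `z`, `p` at distances `H`, `N` from `n` and `U`,
`W` from `a`. The last hypothesis says that the cosines of the angles at `n` have sum at most zero,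
so the angles add up to at least `π`. By Cauchy and Schwarz `U` and `W` are at least the projections
of `z - a` and `p - a` to the directions of `z` and `p`, and these have sum at least `H + N`. -/
theorem add_le_add_of_angle_le {z₁ z₂ p₁ p₂ L H N U W : ℝ} (hH : 0 < H) (hN : 0 < N) (hL : 0 ≤ L)
    (hU : 0 ≤ U) (hW : 0 ≤ W) (eH : H ^ 2 = z₁ ^ 2 + z₂ ^ 2) (eN : N ^ 2 = p₁ ^ 2 + p₂ ^ 2)
    (eU : U ^ 2 = (z₁ - L) ^ 2 + z₂ ^ 2) (eW : W ^ 2 = (p₁ - L) ^ 2 + p₂ ^ 2)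
    (h : z₁ * N + p₁ * H ≤ 0) : H + N ≤ U + W := by
  have key : ∀ {x y H U : ℝ}, 0 < H → 0 ≤ U → H ^ 2 = x ^ 2 + y ^ 2 → U ^ 2 = (x - L) ^ 2 + y ^ 2 →
      H ^ 2 - L * x ≤ U * H := by
    intro x y H U hH hU eH eU
    refine abs_le_of_sq_le_sq' ?_ (mul_nonneg hU hH.le) |>.2
    rw [mul_pow, eU, eH]
    nlinarith [sq_nonneg (L * y)]
  have k₁ := key hH hU eH eU
  have k₂ := key hN hW eN eW
  have : (H + N) * (H * N) ≤ (U + W) * (H * N) := by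
    nlinarith [mul_le_mul_of_nonneg_left k₁ hN.le, mul_le_mul_of_nonneg_left k₂ hH.le,
      mul_nonneg hL (neg_nonneg.2 h)]
  exact le_of_mul_le_mul_right this (mul_pos hH hN)

/-- Let `p' = (p₁, -p₂)` be the mirror image of `p`. When the angles add up to less than `π`, the
line through `p'` in the direction of `z` meets the ray from the origin through `(L, 0)` in a point
`(l L, 0)` at distance `b` from `p'`, and Cauchy and Schwarz is an equality for `z` and `(l L, 0) -
p'`. The error `η` is needed if `z` lies on the ray itself: then the line is parallel to it, and a
far point of the ray serves instead. -/
theorem exists_crossing {z₁ z₂ p₁ p₂ L H N : ℝ} (hH : 0 < H) (hN : 0 < N) (hL : 0 < L)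
    (hz : 0 ≤ z₂) (hp : 0 ≤ p₂) (eH : H ^ 2 = z₁ ^ 2 + z₂ ^ 2) (eN : N ^ 2 = p₁ ^ 2 + p₂ ^ 2)
    (h : 0 < z₁ * N + p₁ * H) {η : ℝ} (hη : 0 < η) :
    ∃ l b : ℝ, 0 ≤ l ∧ 0 ≤ b ∧ b ^ 2 = (l * L - p₁) ^ 2 + p₂ ^ 2 ∧
      H * b ≤ l * L * z₁ - (z₁ * p₁ - z₂ * p₂) + η := by
  rcases hz.eq_or_lt with hz | hz
  · subst hz
    have hz1 : z₁ = H := by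
      rcases sq_eq_sq_iff_eq_or_eq_neg.1 (show z₁ ^ 2 = H ^ 2 by rw [eH]; ring) with h1 | h1
      · exact h1
      · have : p₁ ≤ N := abs_le_of_sq_le_sq' (by nlinarith) hN.le |>.2
        nlinarith
    subst hz1
    -- The horizontal distance to `p'` is taken so large that replacing the hypotenuse by it costs
    -- at most `η / z₁`.
    set x : ℝ := |p₁| + 1 + z₁ * p₂ ^ 2 / (2 * η) with hx
    have hq : 0 ≤ z₁ * p₂ ^ 2 / (2 * η) := by positivity
    have hx0 : 0 < x := by positivity
    refine ⟨(x + p₁) / L, √(x ^ 2 + p₂ ^ 2), ?_, Real.sqrt_nonneg _, ?_, ?_⟩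
    · exact div_nonneg (by linarith [neg_abs_le p₁]) hL.le
    · rw [Real.sq_sqrt (by positivity), div_mul_cancel₀ _ hL.ne']; ring
    · have h1 : √(x ^ 2 + p₂ ^ 2) ≤ x + p₂ ^ 2 / (2 * x) := by
        refine Real.sqrt_le_iff.2 ⟨by positivity, ?_⟩
        have : (x + p₂ ^ 2 / (2 * x)) ^ 2 = x ^ 2 + p₂ ^ 2 + (p₂ ^ 2 / (2 * x)) ^ 2 := by
          field_simp; ring
        rw [this]; linarith [sq_nonneg (p₂ ^ 2 / (2 * x))]
      have h2 : z₁ * (p₂ ^ 2 / (2 * x)) ≤ η := by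
        rw [← mul_div_assoc, div_le_iff₀ (by positivity)]
        have h3 : z₁ * p₂ ^ 2 / (2 * η) ≤ x := by linarith [abs_nonneg p₁]
        rw [div_le_iff₀ (by positivity)] at h3
        linarith
      rw [div_mul_cancel₀ _ hL.ne']
      nlinarith [mul_le_mul_of_nonneg_left h1 hH.le]
  -- Up to a positive factor this is the sine of the sum of the two angles, and it makes `l`
  -- nonnegative.
  · have hD : 0 ≤ z₁ * p₂ + p₁ * z₂ := by
      by_contra hD
      push Not at hD
      have hneg : z₁ < 0 ∨ p₁ < 0 := by
        by_contra hc
        push Not at hc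
        nlinarith [mul_nonneg hc.1 hp, mul_nonneg hc.2 hz.le]
      rcases hneg with h1 | h1
      · have e : (-z₁ * N) ^ 2 < (p₁ * H) ^ 2 :=
          pow_lt_pow_left₀ (by linarith) (by nlinarith) two_ne_zero
        rw [mul_pow, mul_pow, eN, eH] at e
        have : (p₁ * z₂) ^ 2 ≤ (-z₁ * p₂) ^ 2 := by
          have : 0 ≤ p₁ := by nlinarith
          exact pow_le_pow_left₀ (by positivity) (by linarith) 2
        nlinarith
      · have e : (-p₁ * H) ^ 2 < (z₁ * N) ^ 2 :=
          pow_lt_pow_left₀ (by linarith) (by nlinarith) two_ne_zero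
        rw [mul_pow, mul_pow, eN, eH] at e
        have : (z₁ * p₂) ^ 2 ≤ (-p₁ * z₂) ^ 2 := by
          have : 0 ≤ z₁ := by nlinarith
          exact pow_le_pow_left₀ (by positivity) (by linarith) 2
        nlinarith
    refine ⟨(z₁ * p₂ + p₁ * z₂) / (L * z₂), p₂ * H / z₂, by positivity, by positivity, ?_, ?_⟩
    · have : (z₁ * p₂ + p₁ * z₂) / (L * z₂) * L - p₁ = z₁ * p₂ / z₂ := by
        field_simp; ring
      rw [this, div_pow, mul_pow, eH]; field_simp
    · have e₁ : H * (p₂ * H / z₂) = p₂ * (z₁ ^ 2 + z₂ ^ 2) / z₂ := by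
        rw [← eH]; ring
      have e₂ : (z₁ * p₂ + p₁ * z₂) / (L * z₂) * L * z₁ - (z₁ * p₁ - z₂ * p₂) =
          p₂ * (z₁ ^ 2 + z₂ ^ 2) / z₂ := by
        field_simp; ring
      rw [e₁, e₂]; linarith

/-- The comparison triangle with sides `H`, `L`, `U`. The squared height is a product of nonnegative
factors by Heron's formula. -/
theorem exists_plane_coordinates {H L U : ℝ} (hL : 0 < L) (h₁ : H ≤ L + U) (h₂ : L ≤ H + U)
    (h₃ : U ≤ H + L) :
    ∃ x y : ℝ, 0 ≤ y ∧ H ^ 2 = x ^ 2 + y ^ 2 ∧ U ^ 2 = (x - L) ^ 2 + y ^ 2 := by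
  have h0 : 0 ≤ H ^ 2 - ((H ^ 2 + L ^ 2 - U ^ 2) / (2 * L)) ^ 2 := by
    have : H ^ 2 - ((H ^ 2 + L ^ 2 - U ^ 2) / (2 * L)) ^ 2 =
        ((H + L + U) * (H + L - U) * ((U + H - L) * (U + L - H))) / (2 * L) ^ 2 := by
      field_simp; ring
    rw [this]
    refine div_nonneg (mul_nonneg (mul_nonneg ?_ ?_) (mul_nonneg ?_ ?_)) (sq_nonneg _) <;> linarith
  refine ⟨(H ^ 2 + L ^ 2 - U ^ 2) / (2 * L), √(H ^ 2 - ((H ^ 2 + L ^ 2 - U ^ 2) / (2 * L)) ^ 2),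
    Real.sqrt_nonneg _, ?_, ?_⟩
  · rw [Real.sq_sqrt h0]; ring
  · rw [Real.sq_sqrt h0]; field_simp; ring

/-- Two comparison triangles are laid out on different sides of a common side of length `L`. In the
second alternative the right side bounds `-2 ⟨z, p'⟩`, because the distance of `z` and `p'` in the
plane is at most `U + W`. -/
theorem two_triangles {H N L U W : ℝ} (hH : 0 ≤ H) (hN : 0 ≤ N) (hL : 0 ≤ L) (hU : 0 ≤ U)
    (hW : 0 ≤ W) (h₁ : H ≤ L + U) (h₂ : L ≤ H + U) (h₃ : U ≤ H + L)
    (k₁ : N ≤ L + W) (k₂ : L ≤ N + W) (k₃ : W ≤ N + L) :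
    H + N ≤ U + W ∨ ∀ η : ℝ, 0 < η → ∃ l b : ℝ, 0 ≤ l ∧ 0 ≤ b ∧
      b ^ 2 = l ^ 2 * L ^ 2 + N ^ 2 - l * (L ^ 2 + N ^ 2 - W ^ 2) ∧
      l * (U ^ 2 - H ^ 2 - L ^ 2) + 2 * H * b ≤ (U + W) ^ 2 - H ^ 2 - N ^ 2 + η := by
  rcases hH.eq_or_lt with rfl | hH
  · left; linarith
  rcases hN.eq_or_lt with rfl | hN
  · left; linarith
  rcases hL.eq_or_lt with rfl | hL
  · left; linarith
  obtain ⟨z₁, z₂, hz, eH, eU⟩ := exists_plane_coordinates hL h₁ h₂ h₃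
  obtain ⟨p₁, p₂, hp, eN, eW⟩ := exists_plane_coordinates hL k₁ k₂ k₃
  rcases le_or_gt (z₁ * N + p₁ * H) 0 with h | h
  · exact .inl (add_le_add_of_angle_le hH hN hL.le hU hW eH eN eU eW h)
  · right
    intro η hη
    obtain ⟨l, b, hl, hb, eb, hle⟩ := exists_crossing hH hN hL hz hp eH eN h (half_pos hη)
    refine ⟨l, b, hl, hb, by rw [eb, eN, eW]; ring, ?_⟩
    have hUW : (z₁ - L) * (L - p₁) + z₂ * p₂ ≤ U * W := by
      refine abs_le_of_sq_le_sq' ?_ (mul_nonneg hU hW) |>.2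
      rw [mul_pow, eU, eW]
      nlinarith [sq_nonneg ((z₁ - L) * p₂ - z₂ * (L - p₁))]
    nlinarith

theorem nonneg_of_forall_small {a c t₀ : ℝ} (ht₀ : 0 < t₀)
    (h : ∀ t, 0 < t → t ≤ t₀ → 0 ≤ a + c * t) : 0 ≤ a := by
  by_contra ha
  push Not at ha
  have hc : 0 < |c| + 1 := by positivity
  have h1 := h (min t₀ (-a / (2 * (|c| + 1)))) (lt_min ht₀ (div_pos (by linarith) (by linarith)))
    (min_le_left _ _)
  set t := min t₀ (-a / (2 * (|c| + 1)))
  have ht : 0 ≤ t := (lt_min ht₀ (div_pos (by linarith) (by linarith))).le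
  have h2 : t ≤ -a / (2 * (|c| + 1)) := min_le_right _ _
  rw [le_div_iff₀ (by linarith)] at h2
  nlinarith [le_abs_self c, mul_le_mul_of_nonneg_right (le_abs_self c) ht]

/-- An upper bound for the angle at `n` between `v` and `z`: the distance from `z` to the points of
the side `n v` of `S` satisfies the comparison inequality to first order at `n`. -/
def AngleLE {X : Type*} [PseudoEMetricSpace X] (S : Set X) (n v z : X) : Prop :=
  ∀ η : ℝ, 0 < η → ∃ C t₀ : ℝ, 0 < t₀ ∧ ∀ t, 0 < t → t ≤ t₀ → ∀ x ∈ S, CNPoint S n v x t →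
    rdist z x ^ 2 ≤ rdist n z ^ 2 +
      t * (rdist v z ^ 2 - rdist n z ^ 2 - rdist n v ^ 2 + η) + C * t ^ 2

section Glue

variable {X : Type*} [PseudoEMetricSpace X] {S S₁ S₂ A : Set X}

theorem AngleLE.of_mem {n v z : X} (hz : z ∈ S) : AngleLE S n v z := by
  intro η hη
  refine ⟨rdist n v ^ 2, 1, one_pos, fun t ht _ x _ h => ?_⟩
  have := h z hz
  rw [rdist_comm z x]
  nlinarith

/-- The comparison inequality at `n` for the vertex `v` and the side `z p` that contains `n`. -/
theorem AngleLE.first_variation (fin : ∀ x y : X, edist x y ≠ ⊤) (hS : IsCN S) {n v z p : X}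
    (hn : n ∈ S) (hv : v ∈ S) (h₁ : AngleLE S n v z) (h₂ : AngleLE S n v p)
    (hzp : rdist z p = rdist n z + rdist n p) :
    (rdist n z + rdist n p) * rdist n v ^ 2 ≤ rdist n p * rdist v z ^ 2 +
      rdist n z * rdist v p ^ 2 - rdist n z * rdist n p * (rdist n z + rdist n p) := by
  have tr : ∀ x y z : X, rdist x z ≤ rdist x y + rdist y z := fun x y z =>
    rdist_triangle (fin _ _) (fin _ _)
  rcases (rdist_nonneg n z).eq_or_lt with h0 | hh
  · have : rdist n v ≤ rdist v z := by
      have := tr n z v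
      rw [rdist_comm z v] at this
      linarith
    rw [← h0]
    nlinarith [rdist_nonneg n p, pow_le_pow_left₀ (rdist_nonneg n v) this 2]
  rcases (rdist_nonneg n p).eq_or_lt with h0 | hk
  · have : rdist n v ≤ rdist v p := by
      have := tr n p v
      rw [rdist_comm p v] at this
      linarith
    rw [← h0]
    nlinarith [rdist_nonneg n z, pow_le_pow_left₀ (rdist_nonneg n v) this 2]
  set h := rdist n z
  set k := rdist n p
  -- Since `n` lies between `z` and `p`, the sum of the distances from `x` to `z` and `p` is at
  -- least `h + k` for all `x` on the side `n v`. Its first derivative at `n` is therefore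
  -- nonnegative; the two angle bounds estimate this derivative with weights `k` and `h`.
  suffices H : ∀ η : ℝ, 0 < η → 0 ≤ (k * (rdist v z ^ 2 - h ^ 2 - rdist n v ^ 2) +
      h * (rdist v p ^ 2 - k ^ 2 - rdist n v ^ 2)) + (h + k) * η by
    have := nonneg_of_forall_small one_pos fun t ht _ => H t ht
    nlinarith
  intro η hη
  obtain ⟨C₁, t₁, ht₁, H₁⟩ := h₁ η hη
  obtain ⟨C₂, t₂, ht₂, H₂⟩ := h₂ η hη
  have := nonneg_of_forall_small (a := (k * (rdist v z ^ 2 - h ^ 2 - rdist n v ^ 2) +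
      h * (rdist v p ^ 2 - k ^ 2 - rdist n v ^ 2)) + (h + k) * η) (c := k * C₁ + h * C₂)
      (t₀ := min 1 (min t₁ t₂)) (lt_min one_pos (lt_min ht₁ ht₂)) ?_
  · exact this
  intro t ht ht'
  obtain ⟨x, hx, hxp⟩ := hS.exists_point n hn v hv t ⟨ht.le, ht'.trans (min_le_left _ _)⟩
  have b₁ := H₁ t ht (ht'.trans ((min_le_right _ _).trans (min_le_left _ _))) x hx hxp
  have b₂ := H₂ t ht (ht'.trans ((min_le_right _ _).trans (min_le_right _ _))) x hx hxp
  have b₃ := tr z x p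
  rw [hzp, rdist_comm x p] at b₃
  -- The arithmetic-geometric mean inequality passes from the squared distances of the angle bounds
  -- to distances and is sharp to first order at `n`.
  have a₁ : 2 * h * rdist z x ≤ rdist z x ^ 2 + h ^ 2 := by nlinarith [sq_nonneg (rdist z x - h)]
  have a₂ : 2 * k * rdist p x ≤ rdist p x ^ 2 + k ^ 2 := by nlinarith [sq_nonneg (rdist p x - k)]
  have c₁ := mul_le_mul_of_nonneg_left a₁ hk.le
  have c₂ := mul_le_mul_of_nonneg_left a₂ hh.le
  have c₃ := mul_le_mul_of_nonneg_left b₃ (mul_pos hh hk).le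
  have e₁ := mul_le_mul_of_nonneg_left b₁ hk.le
  have e₂ := mul_le_mul_of_nonneg_left b₂ hh.le
  refine nonneg_of_mul_nonneg_right (a := t) ?_ ht
  linarith

/-- `S₁` and `S₂` meet along `A`. -/
structure GluePair (S₁ S₂ A : Set X) : Prop where
  edist_ne_top : ∀ x y : X, edist x y ≠ ⊤
  left : IsCN S₁
  right : IsCN S₂
  subset_left : A ⊆ S₁
  subset_right : A ⊆ S₂
  exists_point : ∀ p ∈ A, ∀ q ∈ A, ∀ s ∈ Set.Icc (0 : ℝ) 1,
    ∃ m ∈ A, CNPoint S₁ p q m s ∧ CNPoint S₂ p q m s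
  bridge : ∀ p ∈ S₁, ∀ q ∈ S₂, ∃ a ∈ A, rdist p q = rdist p a + rdist a q

namespace GluePair

theorem symm (h : GluePair S₁ S₂ A) : GluePair S₂ S₁ A where
  edist_ne_top := h.edist_ne_top
  left := h.right
  right := h.left
  subset_left := h.subset_right
  subset_right := h.subset_left
  exists_point p hp q hq s hs :=
    let ⟨m, hm, h₁, h₂⟩ := h.exists_point p hp q hq s hs
    ⟨m, hm, h₂, h₁⟩
  bridge p hp q hq :=
    let ⟨a, ha, e⟩ := h.bridge q hq p hp
    ⟨a, ha, by rw [rdist_comm p q, e, rdist_comm q a, rdist_comm a p, add_comm]⟩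

theorem triangle (h : GluePair S₁ S₂ A) (x y z : X) : rdist x z ≤ rdist x y + rdist y z :=
  rdist_triangle (h.edist_ne_top _ _) (h.edist_ne_top _ _)

/-- The shortest way from `z` to `v` passes through a point `a` of `A`. The comparison triangles of
`n`, `a`, `z` and `n`, `a`, `v` are put side by side. If their angles at `n` add up to at least `π`,
the triangle inequality at `n` suffices. Otherwise the path from `z` to a point `x` near `n` on `n
v` takes a detour over a point `w` of the side `n a`, where both inequalities are available. -/
theorem angleLE (h : GluePair S₁ S₂ A) {n v z : X} (hn : n ∈ A) (hv : v ∈ S₁) (hz : z ∈ S₂) :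
    AngleLE S₁ n v z := by
  obtain ⟨a, ha, hzv⟩ := h.symm.bridge z hz v hv
  have n₁ := h.subset_left hn
  have t₁ := h.triangle n a z
  have t₂ := h.triangle n z a
  have t₃ := h.triangle z n a
  have s₁ := h.triangle n a v
  have s₂ := h.triangle n v a
  have s₃ := h.triangle v n a
  rw [rdist_comm z n] at t₃
  rw [rdist_comm v n] at s₃
  rw [rdist_comm z v, rdist_comm z a] at hzv
  rw [rdist_comm z a] at t₂ t₃
  rw [rdist_comm v a] at s₂ s₃
  rcases two_triangles (rdist_nonneg n z) (rdist_nonneg n v) (rdist_nonneg n a) (rdist_nonneg a z)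
    (rdist_nonneg a v) t₁ t₂ t₃ s₁ s₂ s₃ with HH | HH
  · intro η hη
    refine ⟨rdist n v ^ 2, 1, one_pos, fun t ht ht1 x hx hxp => ?_⟩
    have d₁ := hxp.rdist_left_le n₁ ht.le
    have d₂ : rdist z x ≤ rdist n z + t * rdist n v := by
      have := h.triangle z n x
      rw [rdist_comm z n, rdist_comm n x] at this
      linarith
    have d₃ := pow_le_pow_left₀ (rdist_nonneg _ _) d₂ 2
    have d₄ : (rdist n z + rdist n v) ^ 2 ≤ rdist v z ^ 2 :=
      pow_le_pow_left₀ (add_nonneg (rdist_nonneg _ _) (rdist_nonneg _ _)) (by linarith) 2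
    nlinarith
  · intro η hη
    obtain ⟨l, b, hl, hb, eb, hle⟩ := HH η hη
    by_cases hH : rdist n z = 0
    · refine ⟨rdist n v ^ 2, 1, one_pos, fun t ht ht1 x hx hxp => ?_⟩
      have d₁ := hxp.rdist_left_le n₁ ht.le
      have d₂ : rdist z x ≤ t * rdist n v := by
        have := h.triangle z n x
        rw [rdist_comm z n, rdist_comm n x] at this
        linarith
      have d₃ := pow_le_pow_left₀ (rdist_nonneg _ _) d₂ 2
      have d₄ : rdist n v ≤ rdist v z := by
        have := h.triangle n z v
        rw [rdist_comm z v] at this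
        linarith
      have := pow_le_pow_left₀ (rdist_nonneg _ _) d₄ 2
      rw [hH]
      nlinarith
    have hH' : 0 < rdist n z := lt_of_le_of_ne (rdist_nonneg _ _) (Ne.symm hH)
    set H := rdist n z
    set L := rdist n a
    set N := rdist n v
    set U := rdist a z
    set W := rdist a v
    -- A crude bound for the growth of `d(w, z)` is enough: it enters only through the mixed term of
    -- `(d(w, z) + t b)²` and thus contributes to order `t²`.
    set c := |l * (U ^ 2 - H ^ 2 - L ^ 2) + l ^ 2 * L ^ 2| / (2 * H) with hc
    refine ⟨l ^ 2 * L ^ 2 + 2 * c * b + b ^ 2, min 1 (1 / (l + 1)), by positivity, ?_⟩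
    intro t ht ht1 x hx hxp
    have ht1' : t ≤ 1 := ht1.trans (min_le_left _ _)
    have hlt : l * t ≤ 1 := by
      have : t ≤ 1 / (l + 1) := ht1.trans (min_le_right _ _)
      rw [le_div_iff₀ (by linarith)] at this
      nlinarith
    have hlt0 : 0 ≤ l * t := by positivity
    -- The crossing point of the plane picture, scaled by `t`. As `l` may exceed `1`, the bound `1 /
    -- (l + 1)` for `t` keeps it on the side `n a`.
    obtain ⟨w, hw, hw₁, hw₂⟩ := h.exists_point n hn a ha (l * t) ⟨hlt0, hlt⟩
    have a₁ : rdist w z ^ 2 ≤ H ^ 2 + l * t * (U ^ 2 - H ^ 2 - L ^ 2) + l ^ 2 * t ^ 2 * L ^ 2 := by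
      have := hw₂ z hz
      nlinarith
    have a₂ : rdist w z ≤ H + t * c := by
      have q₁ : 2 * H * rdist w z ≤ rdist w z ^ 2 + H ^ 2 := by
        nlinarith [sq_nonneg (rdist w z - H)]
      have q₂ : l * t * (U ^ 2 - H ^ 2 - L ^ 2) + l ^ 2 * t ^ 2 * L ^ 2 ≤ t * (2 * H * c) := by
        have q₃ : 2 * H * c = |l * (U ^ 2 - H ^ 2 - L ^ 2) + l ^ 2 * L ^ 2| := by
          rw [hc]; field_simp
        rw [q₃]
        have q₄ := le_abs_self (l * (U ^ 2 - H ^ 2 - L ^ 2) + l ^ 2 * L ^ 2)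
        have q₅ : l ^ 2 * t ^ 2 * L ^ 2 ≤ t * (l ^ 2 * L ^ 2) := by
          have : t ^ 2 ≤ t := by nlinarith
          nlinarith [mul_le_mul_of_nonneg_right this (by positivity : 0 ≤ l ^ 2 * L ^ 2)]
        have q₆ := mul_le_mul_of_nonneg_left q₄ ht.le
        linarith
      refine le_of_mul_le_mul_left ?_ (by positivity : 0 < 2 * H)
      nlinarith
    have a₃ : rdist x w ≤ t * b := by
      refine abs_le_of_sq_le_sq' ?_ (by positivity) |>.2
      have := hxp.rdist_sq_le hw₁ n₁ hv (h.subset_left hw) ⟨ht.le, ht1'⟩ ⟨hlt0, hlt⟩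
      rw [rdist_comm v a] at this
      rw [mul_pow, eb]
      refine this.trans (le_of_eq ?_)
      ring
    have a₄ : rdist z x ≤ rdist w z + t * b := by
      have := h.triangle z w x
      rw [rdist_comm z w, rdist_comm w x] at this
      linarith
    have a₅ := pow_le_pow_left₀ (rdist_nonneg _ _) a₄ 2
    have a₆ : rdist w z * (t * b) ≤ (H + t * c) * (t * b) :=
      mul_le_mul_of_nonneg_right a₂ (by positivity)
    have a₇ := mul_le_mul_of_nonneg_left hle ht.le
    have a₈ : rdist v z ^ 2 = (U + W) ^ 2 := by rw [hzv]
    rw [a₈]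
    linarith

/-- Stewart's theorem as an inequality, for a side `z p` that crosses from one set to the other at
`n`. -/
theorem bridge_le (h : GluePair S₁ S₂ A) {v p n z : X} (hv : v ∈ S₁) (hp : p ∈ S₁) (hn : n ∈ A)
    (hz : z ∈ S₂) (hpz : rdist z p = rdist n z + rdist n p) :
    (rdist n z + rdist n p) * rdist n v ^ 2 ≤ rdist n p * rdist v z ^ 2 +
      rdist n z * rdist v p ^ 2 - rdist n z * rdist n p * (rdist n z + rdist n p) :=
  AngleLE.first_variation h.edist_ne_top h.left (h.subset_left hn) hv (h.angleLE hn hv hz)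
    (.of_mem hp) hpz

/-- Let `n` be the point of `A` on the way from `m` to `z`. If it differs from `m`, then `bridge_le`
for `p` and for `q` combines with the inequality at `m` tested on `n`. If `n` and `m` have distance
zero, the side `p q` itself passes through `n`, and the first variation is applied to `z` as the
opposite vertex. -/
theorem cnPoint_left (h : GluePair S₁ S₂ A) {p q m z : X} (hp : p ∈ S₁) (hq : q ∈ S₁) (hm : m ∈ S₁)
    {s : ℝ} (hs : s ∈ Set.Icc (0 : ℝ) 1) (hmp : CNPoint S₁ p q m s) (hz : z ∈ S₂) :
    rdist m z ^ 2 ≤ (1 - s) * rdist p z ^ 2 + s * rdist q z ^ 2 - s * (1 - s) * rdist p q ^ 2 := by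
  obtain ⟨n, hn, hmz⟩ := h.bridge m hm z hz
  have dp : rdist m p ^ 2 ≤ (s * rdist p q) ^ 2 :=
    pow_le_pow_left₀ (rdist_nonneg _ _) (hmp.rdist_left_le hp hs.1) 2
  have dq : rdist m q ^ 2 ≤ ((1 - s) * rdist p q) ^ 2 :=
    pow_le_pow_left₀ (rdist_nonneg _ _) (hmp.rdist_right_le hq hs.2) 2
  rcases (rdist_nonneg m n).eq_or_lt with h0 | h0
  · have tr : ∀ x, rdist n x = rdist m x := fun x => by
      have := h.triangle n m x
      have := h.triangle m n x
      rw [rdist_comm n m] at *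
      linarith
    have hz2 := h.subset_right hn
    have hsum : rdist p q = rdist n p + rdist n q := by
      refine le_antisymm ?_ ?_
      · have := h.triangle p n q; rwa [rdist_comm p n] at this
      · rw [tr, tr]
        have := hmp.rdist_left_le hp hs.1
        have := hmp.rdist_right_le hq hs.2
        linarith
    have H := AngleLE.first_variation h.edist_ne_top h.right hz2 hz (h.symm.angleLE hn hz hp)
      (h.symm.angleLE hn hz hq) hsum
    have ep : rdist n p = s * rdist p q := by
      have := hmp.rdist_left_le hp hs.1
      have := hmp.rdist_right_le hq hs.2
      rw [tr] at *
      rw [tr] at hsum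
      linarith
    have eq : rdist n q = (1 - s) * rdist p q := by linarith
    rw [← tr]
    rcases (rdist_nonneg p q).eq_or_lt with h1 | h1
    · have e1 : rdist n p = 0 := by rw [ep, ← h1, mul_zero]
      have e2 : rdist n q = 0 := by rw [eq, ← h1, mul_zero]
      have f1 := h.triangle n p z
      have f2 := h.triangle n q z
      rw [e1, zero_add] at f1
      rw [e2, zero_add] at f2
      have g1 := mul_le_mul_of_nonneg_left (pow_le_pow_left₀ (rdist_nonneg _ _) f1 2)
        (sub_nonneg.2 hs.2)
      have g2 := mul_le_mul_of_nonneg_left (pow_le_pow_left₀ (rdist_nonneg _ _) f2 2) hs.1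
      rw [← h1]
      nlinarith
    · rw [← hsum, ep, eq, rdist_comm z p, rdist_comm z q] at H
      refine le_of_mul_le_mul_left ?_ h1
      nlinarith
  · have e₀ : rdist z m = rdist n z + rdist n m := by
      rw [rdist_comm, hmz, rdist_comm n m, add_comm]
    have b₁ := h.bridge_le hp hm hn hz e₀
    have b₂ := h.bridge_le hq hm hn hz e₀
    have b₃ := hmp n (h.subset_left hn)
    rw [rdist_comm n m] at b₁ b₂
    rw [rdist_comm n p, rdist_comm p m] at b₁
    rw [rdist_comm n q, rdist_comm q m] at b₂
    rw [hmz]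
    have hh := rdist_nonneg n z
    have s1 := sub_nonneg.2 hs.2
    refine le_of_mul_le_mul_left ?_ h0
    have c₁ := mul_le_mul_of_nonneg_left b₁ s1
    have c₂ := mul_le_mul_of_nonneg_left b₂ hs.1
    have c₃ := mul_le_mul_of_nonneg_left b₃ (add_nonneg hh h0.le)
    have c₄ := mul_le_mul_of_nonneg_left (mul_le_mul_of_nonneg_left dp s1) hh
    have c₅ := mul_le_mul_of_nonneg_left (mul_le_mul_of_nonneg_left dq hs.1) hh
    nlinarith

/-- The dividing point lies on the part `p a` of the side. Its inequality with respect to `p` and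
`a` is combined with the inequality at `a` with respect to `p` and `q`, which is `bridge_le`. -/
theorem cnPoint_mixed (h : GluePair S₁ S₂ A) {p q a : X} (hp : p ∈ S₁) (hq : q ∈ S₂) (ha : a ∈ A)
    (hpq : rdist p q = rdist p a + rdist a q) {s : ℝ} (hs : s ∈ Set.Icc (0 : ℝ) 1)
    (hsa : s * rdist p q ≤ rdist p a) : ∃ m ∈ S₁, CNPoint (S₁ ∪ S₂) p q m s := by
  rcases (rdist_nonneg p q).eq_or_lt with hD | hD
  · refine ⟨p, hp, fun v _ => ?_⟩
    have e := h.triangle p q v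
    rw [← hD, zero_add] at e
    have := mul_le_mul_of_nonneg_left (pow_le_pow_left₀ (rdist_nonneg _ _) e 2) hs.1
    rw [← hD]
    linarith
  rcases (rdist_nonneg p a).eq_or_lt with h0 | h0
  · rw [← h0] at hsa
    have hs0 : s = 0 := le_antisymm (nonpos_of_mul_nonpos_left hsa hD) hs.1
    subst hs0
    exact ⟨p, hp, fun v _ => by simp⟩
  have hσ : s * rdist p q / rdist p a ∈ Set.Icc (0 : ℝ) 1 :=
    ⟨div_nonneg (mul_nonneg hs.1 hD.le) h0.le, (div_le_one h0).2 hsa⟩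
  have eσ : s * rdist p q / rdist p a * rdist p a = s * rdist p q := div_mul_cancel₀ _ h0.ne'
  obtain ⟨m, hm, hmp⟩ := h.left.exists_point p hp a (h.subset_left ha) _ hσ
  set σ := s * rdist p q / rdist p a
  refine ⟨m, hm, fun v hv => ?_⟩
  have e₁ : rdist m v ^ 2 ≤
      (1 - σ) * rdist p v ^ 2 + σ * rdist a v ^ 2 - σ * (1 - σ) * rdist p a ^ 2 := by
    rcases hv with hv | hv
    · exact hmp v hv
    · exact h.cnPoint_left hp (h.subset_left ha) hm hσ hmp hv
  have e₂ : rdist p q * rdist a v ^ 2 ≤ rdist a q * rdist p v ^ 2 + rdist p a * rdist q v ^ 2 -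
      rdist p a * rdist a q * rdist p q := by
    rw [hpq]
    rcases hv with hv | hv
    · have := h.bridge_le hv hp ha hq (by rw [rdist_comm, hpq, rdist_comm p a, add_comm])
      rw [rdist_comm a p, rdist_comm v q, rdist_comm v p] at this
      linarith
    · have := h.symm.bridge_le hv hq ha hp (by rw [hpq, rdist_comm p a])
      rw [rdist_comm a p, rdist_comm v q, rdist_comm v p] at this
      linarith
  have e₃ := mul_le_mul_of_nonneg_left e₁ hD.le
  have e₄ := mul_le_mul_of_nonneg_left e₂ hσ.1
  refine le_of_mul_le_mul_left (e₃.trans ?_) hD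
  have hk : rdist a q = rdist p q - rdist p a := by linarith
  rw [hk] at e₄
  generalize rdist p q = D at *
  generalize rdist p a = H at *
  generalize rdist a v ^ 2 = x at *
  generalize rdist p v ^ 2 = y at *
  generalize rdist q v ^ 2 = w at *
  have f₁ : σ * H * y = s * D * y := by rw [eσ]
  have f₂ : σ * H * w = s * D * w := by rw [eσ]
  have f₃ : σ * H * (D * (D - H)) = s * D * (D * (D - H)) := by rw [eσ]
  have f₄ : σ * H * (D * H) = s * D * (D * H) := by rw [eσ]
  have f₅ : (σ * H) ^ 2 * D = (s * D) ^ 2 * D := by rw [eσ]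
  linarith

/-- **Reshetnyak's gluing theorem.** -/
theorem isCN_union (h : GluePair S₁ S₂ A) : IsCN (S₁ ∪ S₂) := by
  have mixed : ∀ {S₁ S₂ : Set X}, GluePair S₁ S₂ A → ∀ p ∈ S₁, ∀ q ∈ S₂, ∀ s ∈ Set.Icc (0 : ℝ) 1,
      ∃ m ∈ S₁ ∪ S₂, CNPoint (S₁ ∪ S₂) p q m s := by
    intro S₁ S₂ h p hp q hq s hs
    obtain ⟨a, ha, e⟩ := h.bridge p hp q hq
    rcases le_total (s * rdist p q) (rdist p a) with h' | h'
    · obtain ⟨m, hm, hmp⟩ := h.cnPoint_mixed hp hq ha e hs h'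
      exact ⟨m, .inl hm, hmp⟩
    · obtain ⟨m, hm, hmp⟩ := h.symm.cnPoint_mixed hq hp ha
        (by rw [rdist_comm, e, add_comm, rdist_comm p a, rdist_comm a q]) (s := 1 - s)
        ⟨by linarith [hs.2], by linarith [hs.1]⟩
        (by rw [rdist_comm q p, rdist_comm q a]; linarith)
      refine ⟨m, .inr hm, ?_⟩
      have := hmp.symm
      rw [Set.union_comm, sub_sub_cancel] at this
      exact this
  refine ⟨fun x _ y _ => h.edist_ne_top x y, ?_⟩
  rintro p (hp | hp) q (hq | hq) s hs
  · obtain ⟨m, hm, hmp⟩ := h.left.exists_point p hp q hq s hs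
    refine ⟨m, .inl hm, ?_⟩
    rintro z (hz | hz)
    · exact hmp z hz
    · exact h.cnPoint_left hp hq hm hs hmp hz
  · exact mixed h p hp q hq s hs
  · have := mixed h.symm p hp q hq s hs
    rwa [Set.union_comm] at this
  · obtain ⟨m, hm, hmp⟩ := h.right.exists_point p hp q hq s hs
    refine ⟨m, .inr hm, ?_⟩
    rintro z (hz | hz)
    · exact h.symm.cnPoint_left hp hq hm hs hmp hz
    · exact hmp z hz

end GluePair
end Glue
end

noncomputable section

/-! ### The universal cover of a locally CAT(0) space -/

theorem rdist_eq_zero_iff {X : Type*} [PseudoEMetricSpace X] {x y : X} (h : edist x y ≠ ⊤) :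
    rdist x y = 0 ↔ edist x y = 0 := by
  rw [rdist, ENNReal.toReal_eq_zero_iff]; simp [h]

section Contract

variable {Y : Type*} [PseudoEMetricSpace Y] {B : Set Y}

/-- Contraction along the geodesics from `y`. Joint continuity in the point and the parameter comes
from `CNPoint.rdist_sq_le`: its right side is continuous and vanishes at the point in question. -/
theorem IsCN.contractibleSpace (hB : IsCN B) (hT : ∀ x y : Y, edist x y = 0 → x = y) {y : Y}
    (hy : y ∈ B) : ContractibleSpace B := by
  have H : ∀ (x : B) (t : unitInterval), ∃ m ∈ B, CNPoint B y x m t := fun x t =>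
    hB.exists_point y hy x x.2 t t.2
  choose m hm hc using H
  have hfin : ∀ a b : B, edist (a : Y) b ≠ ⊤ := fun a b => hB.edist_ne_top _ a.2 _ b.2
  have hcont : Continuous fun p : unitInterval × B => (⟨m p.2 p.1, hm p.2 p.1⟩ : B) := by
    rw [continuous_iff_continuousAt]
    rintro ⟨t₀, x₀⟩
    set f : unitInterval × B → ℝ := fun p => (p.1 : ℝ) ^ 2 * rdist y (p.2 : Y) ^ 2 +
      (t₀ : ℝ) ^ 2 * rdist y (x₀ : Y) ^ 2 - p.1 * t₀ * (rdist y (p.2 : Y) ^ 2 +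
      rdist y (x₀ : Y) ^ 2 - rdist (p.2 : Y) (x₀ : Y) ^ 2) with hf
    have hr : ∀ a : B, Continuous fun x : B => rdist (x : Y) a := by
      intro a
      unfold rdist
      refine continuous_iff_continuousAt.2 fun x => ?_
      have h1 : Filter.Tendsto (fun x : B => edist (x : Y) a) (nhds x) (nhds (edist (x : Y) a)) :=
        (continuous_subtype_val.edist continuous_const).continuousAt
      exact (ENNReal.tendsto_toReal (hfin _ _)).comp h1
    have hfc : Continuous f := by
      have h1 : Continuous fun p : unitInterval × B => rdist y (p.2 : Y) := by
        simp_rw [rdist_comm y]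
        exact (hr ⟨y, hy⟩).comp continuous_snd
      have h2 : Continuous fun p : unitInterval × B => rdist (p.2 : Y) (x₀ : Y) :=
        (hr x₀).comp continuous_snd
      have h3 : Continuous fun p : unitInterval × B => (p.1 : ℝ) :=
        continuous_subtype_val.comp continuous_fst
      rw [hf]
      fun_prop
    have hf0 : f (t₀, x₀) = 0 := by simp only [hf, rdist_self]; ring
    rw [ContinuousAt, tendsto_iff_edist_tendsto_0]
    have hle : ∀ p : unitInterval × B, edist (⟨m p.2 p.1, hm p.2 p.1⟩ : B) ⟨m x₀ t₀, hm x₀ t₀⟩ ≤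
        ENNReal.ofReal (√(f p)) := by
      intro p
      rw [Subtype.edist_eq]
      change edist (m p.2 p.1) (m x₀ t₀) ≤ _
      rw [edist_eq_ofReal_rdist (hB.edist_ne_top _ (hm _ _) _ (hm _ _))]
      refine ENNReal.ofReal_le_ofReal (Real.le_sqrt_of_sq_le ?_)
      exact (hc p.2 p.1).rdist_sq_le (hc x₀ t₀) hy p.2.2 (hm _ _) p.1.2 t₀.2
    refine tendsto_of_tendsto_of_tendsto_of_le_of_le tendsto_const_nhds ?_ (fun _ => zero_le) hle
    have : Filter.Tendsto (fun p => ENNReal.ofReal (√(f p))) (nhds (t₀, x₀))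
        (nhds (ENNReal.ofReal (√(f (t₀, x₀))))) :=
      (ENNReal.continuous_ofReal.comp (Real.continuous_sqrt.comp hfc)).continuousAt
    rwa [hf0, Real.sqrt_zero, ENNReal.ofReal_zero] at this
  have eq0 : ∀ a b : Y, a ∈ B → b ∈ B → rdist a b = 0 → a = b := fun a b ha hb h =>
    hT _ _ ((rdist_eq_zero_iff (hB.edist_ne_top _ ha _ hb)).1 h)
  rw [contractible_iff_id_nullhomotopic]
  refine ⟨⟨y, hy⟩, ⟨ContinuousMap.Homotopy.symm ⟨⟨_, hcont⟩, fun x => ?_, fun x => ?_⟩⟩⟩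
  · refine Subtype.ext (eq0 _ _ (hm _ _) hy ?_)
    have := (hc x 0).rdist_left_le hy le_rfl
    simp only [Set.Icc.coe_zero, zero_mul] at this
    exact le_antisymm this (rdist_nonneg _ _)
  · refine Subtype.ext (eq0 _ _ (hm _ _) x.2 ?_)
    have := (hc x 1).rdist_right_le x.2 le_rfl
    simp only [Set.Icc.coe_one, sub_self, zero_mul] at this
    exact le_antisymm this (rdist_nonneg _ _)

theorem IsCN.homotopic (hB : IsCN B) (hT : ∀ x y : Y, edist x y = 0 → x = y) {x y : Y}
    (p q : Path x y) (hp : ∀ t, p t ∈ B) (hq : ∀ t, q t ∈ B) : p.Homotopic q := by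
  have hx : x ∈ B := p.source ▸ hp 0
  have hy : y ∈ B := p.target ▸ hp 1
  have := hB.contractibleSpace hT hx
  let P : ∀ p : Path x y, (∀ t, p t ∈ B) → Path (⟨x, hx⟩ : B) ⟨y, hy⟩ := fun p hp =>
    ⟨⟨fun t => ⟨p t, hp t⟩, p.continuous.subtype_mk _⟩, Subtype.ext p.source, Subtype.ext p.target⟩
  have h := (SimplyConnectedSpace.paths_homotopic (P p hp) (P q hq)).map
    (⟨Subtype.val, continuous_subtype_val⟩ : C(B, Y))
  exact h

theorem IsGeodesicBetween.continuous {x y : Y} {α : unitInterval → Y} (h : IsGeodesicBetween α x y)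
    (hxy : edist x y ≠ ⊤) : Continuous α := by
  rw [continuous_iff_continuousAt]
  intro t
  rw [ContinuousAt, tendsto_iff_edist_tendsto_0]
  simp_rw [h.2.2]
  have h1 : Filter.Tendsto (fun s : unitInterval => ENNReal.ofReal |(s : ℝ) - t|) (nhds t)
      (nhds (ENNReal.ofReal |(t : ℝ) - t|)) :=
    (ENNReal.continuous_ofReal.comp (by fun_prop :
      Continuous fun s : unitInterval => |(s : ℝ) - t|)).continuousAt
  have := ENNReal.Tendsto.mul_const (b := edist x y) h1 (.inr hxy)
  simpa using this

/-- Two points of a ball are joined by a shortest path in the ball. -/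
theorem IsCN.exists_path (hB : IsCN B) {x y : Y} (hx : x ∈ B) (hy : y ∈ B) :
    ∃ p : Path x y, (∀ t, p t ∈ B) ∧ pathLength p ≤ edist x y := by
  obtain ⟨α, h, hα⟩ := hB.exists_geodesic hx hy
  have hfin := hB.edist_ne_top _ hx _ hy
  refine ⟨⟨⟨α, h.continuous hfin⟩, h.1, h.2.1⟩, hα, ?_⟩
  refine iSup_le ?_
  rintro ⟨n, u, hu, -⟩
  change ∑ i ∈ Finset.range n, edist (α (u (i + 1))) (α (u i)) ≤ _
  have e : ∀ i, edist (α (u (i + 1))) (α (u i)) =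
      ENNReal.ofReal ((u (i + 1) : ℝ) - u i) * edist x y := by
    intro i
    have : (u i : ℝ) ≤ u (i + 1) := hu (Nat.le_succ i)
    rw [h.2.2, abs_of_nonneg (sub_nonneg.2 this)]
  simp_rw [e]
  rw [← Finset.sum_mul, ← ENNReal.ofReal_sum_of_nonneg
    (fun i _ => sub_nonneg.2 (show (u i : ℝ) ≤ u (i + 1) from hu (Nat.le_succ i))),
    Finset.sum_range_sub (fun i => (u i : ℝ))]
  refine mul_le_of_le_one_left (zero_le) (ENNReal.ofReal_le_one.2 ?_)
  linarith [(u n).2.2, (u 0).2.1]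

end Contract

theorem edist_le_pathLength {X : Type*} [PseudoEMetricSpace X] {x y : X} (γ : Path x y) (s t) :
    edist (γ s) (γ t) ≤ pathLength γ :=
  eVariationOn.edist_le _ (Set.mem_univ _) (Set.mem_univ _)

theorem edist_le_pathLength' {X : Type*} [PseudoEMetricSpace X] {x y : X} (γ : Path x y) :
    edist x y ≤ pathLength γ := by
  have := edist_le_pathLength γ 0 1
  rwa [γ.source, γ.target] at this

theorem pathLength_subpath_le {X : Type*} [PseudoEMetricSpace X] {x y : X} (γ : Path x y)
    {s t : unitInterval} (h : s ≤ t) :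
    pathLength (γ.subpath s t) ≤ eVariationOn γ (Set.Icc s t) := by
  refine eVariationOn.comp_le_of_monotoneOn (γ : unitInterval → X) (Set.Icc.convexComb s t) ?_ ?_
  · intro a _ b _ hab
    change (1 - (a : ℝ)) * s + a * t ≤ (1 - (b : ℝ)) * s + b * t
    have h1 : (s : ℝ) ≤ t := h
    have h2 : (a : ℝ) ≤ b := hab
    nlinarith
  · intro a _
    have h1 : (s : ℝ) ≤ t := h
    have h2 := a.2.1
    have h3 := a.2.2
    constructor
    · change (s : ℝ) ≤ (1 - (a : ℝ)) * s + a * t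
      nlinarith
    · change (1 - (a : ℝ)) * s + a * t ≤ (t : ℝ)
      nlinarith

/-- A space whose balls of radius at most `ρ` are CAT(0). -/
structure UniformlyCN (Y : Type*) [PseudoEMetricSpace Y] (ρ : ℝ≥0) : Prop where
  eq_of_edist : ∀ x y : Y, edist x y = 0 → x = y
  pos : 0 < ρ
  isCN : ∀ (y : Y) (r : ℝ≥0∞), r ≤ ρ → IsCN (Metric.eball y r)

/-- Any radius below a Lebesgue number of the cover by the given balls works, as smaller balls
inherit the inequality. -/
theorem exists_uniformlyCN {Y : Type*} [PseudoEMetricSpace Y] [CompactSpace Y]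
    (hT : ∀ x y : Y, edist x y = 0 → x = y)
    (h : ∀ y : Y, ∃ r : ℝ≥0∞, 0 < r ∧ IsCN (Metric.eball y r)) : ∃ ρ, UniformlyCN Y ρ := by
  choose r hr hcn using h
  obtain ⟨δ, hδ, H⟩ := lebesgue_number_lemma_of_emetric (isCompact_univ (X := Y))
    (fun y => Metric.isOpen_eball (x := y) (ε := r y))
    (fun y _ => Set.mem_iUnion.2 ⟨y, Metric.mem_eball_self (hr y)⟩)
  obtain ⟨ρ, hρ, hρδ⟩ := ENNReal.lt_iff_exists_nnreal_btwn.1 hδ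
  refine ⟨ρ, hT, by exact_mod_cast hρ, fun y r' hr' => ?_⟩
  obtain ⟨i, hi⟩ := H y (Set.mem_univ y)
  exact (hcn i).eball (hi (Metric.mem_eball_self hδ))
    ((Metric.eball_subset_eball (hr'.trans hρδ.le)).trans hi)

namespace UniversalCover

variable {Y : Type*} [PseudoEMetricSpace Y] {y₀ : Y}

/-- The end point of the lift of `γ` that starts in `a`. -/
def extend (a : UniversalCover Y y₀) {z : Y} (γ : Path a.pt z) : UniversalCover Y y₀ :=
  ⟨z, a.cls.trans (Path.Homotopic.Quotient.mk γ)⟩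

theorem extend_congr (a : UniversalCover Y y₀) {z z' : Y} (γ : Path a.pt z) (γ' : Path a.pt z')
    (h : ∀ t, γ t = γ' t) : a.extend γ = a.extend γ' := by
  have : z = z' := by rw [← γ.target, ← γ'.target, h]
  subst this
  rw [Path.ext (funext h)]

theorem extend_refl (a : UniversalCover Y y₀) : a.extend (Path.refl a.pt) = a := by
  rw [extend, Path.Homotopic.Quotient.mk_refl, Path.Homotopic.Quotient.trans_refl]

theorem extend_eq_of_homotopic (a : UniversalCover Y y₀) {z : Y} {γ γ' : Path a.pt z}
    (h : γ.Homotopic γ') : a.extend γ = a.extend γ' := by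
  rw [extend, extend, Path.Homotopic.Quotient.eq.2 h]

theorem extend_trans (a : UniversalCover Y y₀) {z w : Y} (γ : Path a.pt z) (δ : Path z w) :
    a.extend (γ.trans δ) = (a.extend γ).extend δ := by
  simp only [extend, Path.Homotopic.Quotient.mk_trans, Path.Homotopic.Quotient.trans_assoc]

theorem edist_extend_le (a : UniversalCover Y y₀) {z : Y} (γ : Path a.pt z) :
    edist a (a.extend γ) ≤ pathLength γ :=
  iInf₂_le (f := fun (δ : Path a.pt z) (_ : a.cls.trans (Path.Homotopic.Quotient.mk δ) =
    a.cls.trans (Path.Homotopic.Quotient.mk γ)) => pathLength δ) γ rfl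

theorem exists_extend_eq {a b : UniversalCover Y y₀} {r : ℝ≥0∞} (h : edist a b < r) :
    ∃ (z : Y) (γ : Path a.pt z), pathLength γ < r ∧ a.extend γ = b := by
  obtain ⟨γ, hγ⟩ := iInf_lt_iff.1 h
  obtain ⟨e, he⟩ := iInf_lt_iff.1 hγ
  exact ⟨b.pt, γ, he, by rw [extend, e]⟩

theorem edist_pt_le (a b : UniversalCover Y y₀) : edist a.pt b.pt ≤ edist a b :=
  le_iInf₂ fun γ _ => edist_le_pathLength' γ

theorem continuous_pt : Continuous (pt : UniversalCover Y y₀ → Y) := by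
  have : LipschitzWith 1 (pt : UniversalCover Y y₀ → Y) := fun a b => by
    simpa using edist_pt_le a b
  exact this.continuous

@[simp] theorem smul_pt (g : FundamentalGroup Y y₀) (a : UniversalCover Y y₀) :
    (g • a).pt = a.pt := rfl

theorem smul_extend (g : FundamentalGroup Y y₀) (a : UniversalCover Y y₀) {z : Y}
    (γ : Path a.pt z) : g • a.extend γ = (g • a).extend (z := z) γ := by
  change (⟨_, _⟩ : UniversalCover Y y₀) = ⟨_, _⟩
  congr 1
  exact (Path.Homotopic.Quotient.trans_assoc _ _ _).symm

theorem edist_smul_le (g : FundamentalGroup Y y₀) (a b : UniversalCover Y y₀) :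
    edist (g • a) (g • b) ≤ edist a b := by
  refine le_iInf₂ fun γ h => ?_
  have : a.extend γ = b := by rw [extend, h]
  calc edist (g • a) (g • b) = edist (g • a) ((g • a).extend (z := b.pt) γ) := by
        rw [← smul_extend, this]
    _ ≤ _ := edist_extend_le (g • a) (z := b.pt) γ

theorem edist_smul (g : FundamentalGroup Y y₀) (a b : UniversalCover Y y₀) :
    edist (g • a) (g • b) = edist a b := by
  refine le_antisymm (edist_smul_le g a b) ?_
  simpa using edist_smul_le g⁻¹ (g • a) (g • b)

theorem exists_smul_eq {a b : UniversalCover Y y₀} (h : a.pt = b.pt) :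
    ∃ g : FundamentalGroup Y y₀, g • a = b := by
  obtain ⟨x, c⟩ := a
  obtain ⟨x', c'⟩ := b
  change x = x' at h
  subst h
  -- The inverse is prepended by the action, so this loop replaces `c` by `c'`.
  refine ⟨FundamentalGroup.fromPath (c.trans c'.symm), ?_⟩
  change (⟨_, _⟩ : UniversalCover Y y₀) = ⟨_, _⟩
  congr 1
  change (c.trans c'.symm).symm.trans c = c'
  induction c using Path.Homotopic.Quotient.ind with | mk p =>
  induction c' using Path.Homotopic.Quotient.ind with | mk p' =>
  rw [← Path.Homotopic.Quotient.mk_symm, ← Path.Homotopic.Quotient.mk_trans,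
    ← Path.Homotopic.Quotient.mk_symm, ← Path.Homotopic.Quotient.mk_trans, Path.trans_symm,
    Path.symm_symm, Path.Homotopic.Quotient.mk_trans, Path.Homotopic.Quotient.mk_trans,
    Path.Homotopic.Quotient.trans_assoc, Path.Homotopic.Quotient.mk_symm,
    Path.Homotopic.Quotient.symm_trans, Path.Homotopic.Quotient.trans_refl]

theorem eq_one_of_smul_eq {a : UniversalCover Y y₀} {g : FundamentalGroup Y y₀}
    (h : g • a = a) : g = 1 := by
  obtain ⟨x, c⟩ := a
  have h' : (⟨x, g.toPath.symm.trans c⟩ : UniversalCover Y y₀) = ⟨x, c⟩ := h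
  rw [UniversalCover.mk.injEq] at h'
  have h2 := congrArg (fun d => Path.Homotopic.Quotient.trans d c.symm) (eq_of_heq h'.2)
  simp only [Path.Homotopic.Quotient.trans_assoc, Path.Homotopic.Quotient.trans_symm,
    Path.Homotopic.Quotient.trans_refl] at h2
  have h3 : g⁻¹ = 1 := h2
  exact inv_eq_one.1 h3

end UniversalCover
end

/-! ### Covering theory, the Hadamard property and the geometric action of the deck group -/

noncomputable section

namespace UniformlyCN

open UniversalCover

variable {Y : Type*} [PseudoEMetricSpace Y] {y₀ : Y} {ρ : ℝ≥0} (H : UniformlyCN Y ρ)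

include H

theorem coe_pos : (0 : ℝ≥0∞) < ρ := by exact_mod_cast H.pos

theorem half_pos : (0 : ℝ≥0∞) < (ρ : ℝ≥0∞) / 2 := ENNReal.half_pos H.coe_pos.ne'

omit H in
theorem mem_eball_of_pathLength {r : ℝ≥0∞} {x z : Y} {γ : Path x z} (h : pathLength γ < r) (t) :
    γ t ∈ Metric.eball x r := by
  have := edist_le_pathLength γ t 0
  rw [γ.source] at this
  exact this.trans_lt h

theorem exists_lift_of_mem {a : UniversalCover Y y₀} {z : Y} (hz : edist a.pt z < ρ) :
    ∃ b : UniversalCover Y y₀, b.pt = z ∧ edist a b ≤ edist a.pt z := by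
  obtain ⟨p, -, hp⟩ := (H.isCN a.pt ρ le_rfl).exists_path (Metric.mem_eball_self H.coe_pos)
    (Metric.mem_eball'.2 hz)
  exact ⟨a.extend p, rfl, (edist_extend_le _ _).trans hp⟩

/-- The projection is isometric on balls of radius `ρ`. The path to `b` followed by the shortest
path `p` downstairs is homotopic to the path to `c`, because all of them stay in one contractible
ball; hence the lift of `p` joins `b` to `c`. -/
theorem edist_eq {a b c : UniversalCover Y y₀} (hb : edist a b < ρ) (hc : edist a c < ρ) :
    edist b c = edist b.pt c.pt := by
  refine le_antisymm ?_ (edist_pt_le b c)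
  obtain ⟨z, β, hβ, rfl⟩ := exists_extend_eq hb
  obtain ⟨w, γ, hγ, rfl⟩ := exists_extend_eq hc
  have hB := H.isCN a.pt ρ le_rfl
  have mβ := mem_eball_of_pathLength hβ
  have mγ := mem_eball_of_pathLength hγ
  obtain ⟨p, hpB, hp⟩ := hB.exists_path (β.target ▸ mβ 1) (γ.target ▸ mγ 1)
  have h : (β.trans p).Homotopic γ := by
    refine hB.homotopic H.eq_of_edist _ _ (fun t => ?_) mγ
    have := Set.mem_range_self (f := β.trans p) t
    rw [Path.trans_range] at this
    rcases this with ⟨s, hs⟩ | ⟨s, hs⟩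
    · rw [← hs]; exact mβ s
    · rw [← hs]; exact hpB s
  have e : a.extend γ = (a.extend β).extend p := by
    rw [← extend_trans, extend_eq_of_homotopic _ h]
  rw [e]
  exact (edist_extend_le _ _).trans hp

theorem eq_of_pt_eq {a b : UniversalCover Y y₀} (h : edist a b < ρ) (e : a.pt = b.pt) : a = b := by
  obtain ⟨z, β, hβ, rfl⟩ := exists_extend_eq h
  have hB := H.isCN a.pt ρ le_rfl
  obtain ⟨x, c⟩ := a
  change x = z at e
  subst e
  have := hB.homotopic H.eq_of_edist (Path.refl x) β (fun t => Metric.mem_eball_self H.coe_pos)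
    (mem_eball_of_pathLength hβ)
  rw [← extend_eq_of_homotopic _ this, extend_refl]

theorem exists_smul_disjoint {a b : UniversalCover Y y₀} {g : FundamentalGroup Y y₀}
    (hb : edist a b < (ρ : ℝ≥0∞) / 2) (hg : edist a (g • b) < (ρ : ℝ≥0∞) / 2) : g = 1 := by
  have h : edist (g • b) b < ρ := by
    calc edist (g • b) b ≤ edist (g • b) a + edist a b := edist_triangle _ _ _
      _ < (ρ : ℝ≥0∞) / 2 + (ρ : ℝ≥0∞) / 2 := by
        rw [edist_comm (g • b) a]; exact ENNReal.add_lt_add hg hb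
      _ = ρ := ENNReal.add_halves _
  exact eq_one_of_smul_eq (H.eq_of_pt_eq h (smul_pt g b))

omit H in
theorem continuousConstSMul : ContinuousConstSMul (FundamentalGroup Y y₀) (UniversalCover Y y₀) :=
  ⟨fun g => (LipschitzWith.continuous (K := 1) fun a b => by
    simpa using (edist_smul g a b).le)⟩

theorem isOpenMap_pt : IsOpenMap (pt : UniversalCover Y y₀ → Y) := by
  intro U hU
  rw [EMetric.isOpen_iff] at *
  rintro _ ⟨a, ha, rfl⟩
  obtain ⟨ε, hε, hs⟩ := hU a ha
  refine ⟨min ε ρ, lt_min hε H.coe_pos, fun z hz => ?_⟩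
  rw [Metric.mem_eball'] at hz
  obtain ⟨b, rfl, hb⟩ := H.exists_lift_of_mem (hz.trans_le (min_le_right _ _))
  exact ⟨b, hs (Metric.mem_eball'.2 (hb.trans_lt (hz.trans_le (min_le_left _ _)))), rfl⟩

omit H in
theorem pt_surjective [PathConnectedSpace Y] :
    Function.Surjective (pt : UniversalCover Y y₀ → Y) := fun y =>
  ⟨⟨y, Path.Homotopic.Quotient.mk (PathConnectedSpace.somePath y₀ y)⟩, rfl⟩

theorem isQuotientCoveringMap_pt [PathConnectedSpace Y] :
    IsQuotientCoveringMap (pt : UniversalCover Y y₀ → Y) (FundamentalGroup Y y₀) where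
  toIsQuotientMap := H.isOpenMap_pt.isQuotientMap continuous_pt pt_surjective
  toContinuousConstSMul := continuousConstSMul
  apply_eq_iff_mem_orbit {a b} := by
    constructor
    · intro h
      exact exists_smul_eq h.symm
    · rintro ⟨g, rfl⟩
      rfl
  disjoint a := by
    refine ⟨Metric.eball a ((ρ : ℝ≥0∞) / 2), Metric.eball_mem_nhds a H.half_pos, ?_⟩
    rintro g ⟨_, ⟨b, hb, rfl⟩, hb'⟩
    exact H.exists_smul_disjoint (Metric.mem_eball'.1 hb) (Metric.mem_eball'.1 hb')

omit H in
/-- The lift of `γ` that starts in `a`. -/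
def _root_.UniversalCover.lift (a : UniversalCover Y y₀) {z : Y} (γ : Path a.pt z)
    (t : unitInterval) : UniversalCover Y y₀ :=
  a.extend ((γ.subpath 0 t).cast γ.source.symm rfl)

omit H in
theorem _root_.UniversalCover.lift_zero (a : UniversalCover Y y₀) {z : Y} (γ : Path a.pt z) :
    a.lift γ 0 = a := by
  conv_rhs => rw [← a.extend_refl]
  exact extend_congr _ _ _ fun t => by simp

omit H in
theorem _root_.UniversalCover.lift_one (a : UniversalCover Y y₀) {z : Y} (γ : Path a.pt z) :
    a.lift γ 1 = a.extend γ :=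
  extend_congr _ _ _ fun t => by simp

omit H in
theorem _root_.UniversalCover.lift_extend (a : UniversalCover Y y₀) {z : Y} (γ : Path a.pt z)
    (s t : unitInterval) : (a.lift γ s).extend (z := γ t) (γ.subpath s t) = a.lift γ t := by
  unfold lift
  rw [← extend_trans]
  exact extend_eq_of_homotopic _
    (Path.Homotopic.pathCast ⟨Path.Homotopy.subpathTransSubpath γ 0 s t⟩ γ.source.symm rfl)

/-- Near a parameter `s` the path stays in a contractible ball, so its piece from `s` to `t` may be
replaced by a shortest path. The lifted points are then no further apart than the points below. -/
theorem continuous_lift (a : UniversalCover Y y₀) {z : Y} (γ : Path a.pt z) :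
    Continuous (a.lift γ) := by
  rw [continuous_iff_continuousAt]
  intro s
  have hB := H.isCN (γ s) ρ le_rfl
  have hms := Metric.mem_eball_self (x := γ s) H.coe_pos
  have hle : ∀ t, (∀ u, Set.Icc.convexComb s t u ∈ γ ⁻¹' Metric.eball (γ s) ρ) →
      edist (a.lift γ s) (a.lift γ t) ≤ edist (γ s) (γ t) := by
    intro t ht
    have htm : γ t ∈ Metric.eball (γ s) ρ := by simpa using ht 1
    obtain ⟨p, hpB, hp⟩ := hB.exists_path hms htm
    have := hB.homotopic H.eq_of_edist (γ.subpath s t) p ht hpB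
    rw [← a.lift_extend γ s t, extend_eq_of_homotopic (a.lift γ s) (z := γ t) this]
    exact (edist_extend_le (a.lift γ s) (z := γ t) p).trans hp
  have hopen : IsOpen (γ ⁻¹' Metric.eball (γ s) ρ) := Metric.isOpen_eball.preimage γ.continuous
  obtain ⟨δ, hδ, hball⟩ := Metric.isOpen_iff.1 hopen s (by simpa using H.pos)
  have hnear : ∀ᶠ t in nhds s, edist (a.lift γ t) (a.lift γ s) ≤ edist (γ t) (γ s) := by
    filter_upwards [Metric.ball_mem_nhds s hδ] with t ht
    rw [edist_comm, edist_comm (γ t)]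
    refine hle t fun u => hball ?_
    rw [Metric.mem_ball, Subtype.dist_eq, Real.dist_eq] at *
    have : ((Set.Icc.convexComb s t u : unitInterval) : ℝ) - s = u * (t - s) := by
      change (1 - (u : ℝ)) * s + u * t - s = _
      ring
    rw [this, abs_mul, abs_of_nonneg u.2.1]
    exact (mul_le_of_le_one_left (abs_nonneg _) u.2.2).trans_lt ht
  rw [ContinuousAt, tendsto_iff_edist_tendsto_0]
  refine tendsto_of_tendsto_of_tendsto_of_le_of_le' tendsto_const_nhds ?_
    (Filter.Eventually.of_forall fun _ => zero_le) hnear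
  exact tendsto_iff_edist_tendsto_0.1 γ.continuous.continuousAt

/-- The lift of a path as a path. -/
def liftPath (a : UniversalCover Y y₀) {z : Y} (γ : Path a.pt z) : Path a (a.extend γ) :=
  ⟨⟨a.lift γ, H.continuous_lift a γ⟩, a.lift_zero γ, a.lift_one γ⟩

theorem pathLength_liftPath_le (a : UniversalCover Y y₀) {z : Y} (γ : Path a.pt z) :
    pathLength (H.liftPath a γ) ≤ pathLength γ := by
  refine iSup_le ?_
  rintro ⟨n, u, hu, -⟩
  change ∑ i ∈ Finset.range n, edist (a.lift γ (u (i + 1))) (a.lift γ (u i)) ≤ _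
  refine (Finset.sum_le_sum (g := fun i => eVariationOn γ (Set.Icc (u i) (u (i + 1))))
    fun i _ => ?_).trans ?_
  · rw [edist_comm, ← a.lift_extend γ (u i) (u (i + 1))]
    exact (edist_extend_le (a.lift γ (u i)) (z := γ (u (i + 1))) _).trans
      (pathLength_subpath_le γ (hu (Nat.le_succ i)))
  · rw [eVariationOn.sum' γ hu]
    exact eVariationOn.mono _ (Set.subset_univ _)

theorem pathConnectedSpace : PathConnectedSpace (UniversalCover Y y₀) := by
  let o : UniversalCover Y y₀ := ⟨y₀, Path.Homotopic.Quotient.refl y₀⟩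
  have : ∀ b, Joined o b := by
    rintro ⟨z, c⟩
    induction c using Path.Homotopic.Quotient.ind with | mk γ =>
    refine ⟨(H.liftPath o γ).cast rfl ?_⟩
    rw [extend, Path.Homotopic.Quotient.refl_trans]
  exact ⟨⟨o⟩, fun a b => (this a).symm.trans (this b)⟩

/-- By uniqueness of lifts every path upstairs is the canonical lift of its projection. -/
theorem extend_map {a b : UniversalCover Y y₀} (Γ : Path a b) [PathConnectedSpace Y] :
    a.extend (Γ.map continuous_pt) = b := by
  have h : (Γ : unitInterval → _) = a.lift (Γ.map continuous_pt) := by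
    refine (H.isQuotientCoveringMap_pt (y₀ := y₀)).isCoveringMap.eq_of_comp_eq Γ.continuous
      (H.continuous_lift a _) ?_ 0 ?_
    · ext t; rfl
    · rw [Γ.source, lift_zero]
  rw [← lift_one, ← h, Γ.target]

/-- Points of the cover are homotopy classes, so two paths with the same ends have homotopic
projections by `extend_map`. A covering map is injective on homotopy classes of paths. -/
theorem simplyConnectedSpace [PathConnectedSpace Y] :
    SimplyConnectedSpace (UniversalCover Y y₀) := by
  have cov := (H.isQuotientCoveringMap_pt (y₀ := y₀)).isCoveringMap
  rw [simply_connected_iff_paths_homotopic']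
  refine ⟨H.pathConnectedSpace, fun {a b} p q => ?_⟩
  have h₁ := H.extend_map p
  have h₂ := H.extend_map q
  have h : a.cls.trans (Path.Homotopic.Quotient.mk (p.map continuous_pt)) =
      a.cls.trans (Path.Homotopic.Quotient.mk (q.map continuous_pt)) := by
    have := h₁.trans h₂.symm
    rw [extend, extend, UniversalCover.mk.injEq] at this
    exact eq_of_heq this.2
  have h' := congrArg (fun d => a.cls.symm.trans d) h
  simp only [← Path.Homotopic.Quotient.trans_assoc, Path.Homotopic.Quotient.symm_trans,
    Path.Homotopic.Quotient.refl_trans] at h'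
  exact Path.Homotopic.Quotient.eq.1 (cov.injective_path_homotopic_map a b h')

theorem isCN_eball (a : UniversalCover Y y₀) {r : ℝ≥0∞} (hr : r ≤ ρ) :
    IsCN (Metric.eball a r) := by
  have hB := H.isCN a.pt r hr
  have mem : ∀ {b}, b ∈ Metric.eball a r → b.pt ∈ Metric.eball a.pt r := fun {b} hb =>
    (edist_pt_le b a).trans_lt hb
  have eq : ∀ {b c}, b ∈ Metric.eball a r → c ∈ Metric.eball a r →
      edist b c = edist b.pt c.pt := fun {b c} hb hc =>
    H.edist_eq ((Metric.mem_eball'.1 hb).trans_le hr) ((Metric.mem_eball'.1 hc).trans_le hr)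
  refine ⟨fun b hb c hc => ?_, fun p hp q hq s hs => ?_⟩
  · rw [eq hb hc]
    exact hB.edist_ne_top _ (mem hb) _ (mem hc)
  · obtain ⟨m, hm, hmp⟩ := hB.exists_point _ (mem hp) _ (mem hq) s hs
    obtain ⟨b, rfl, hb⟩ := H.exists_lift_of_mem (a := a) ((Metric.mem_eball'.1 hm).trans_le hr)
    have hb' : b ∈ Metric.eball a r :=
      Metric.mem_eball'.2 (hb.trans_lt (Metric.mem_eball'.1 hm))
    refine ⟨b, hb', fun z hz => ?_⟩
    simp only [rdist, eq hb' hz, eq hp hz, eq hq hz, eq hp hq]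
    exact hmp z.pt (mem hz)

theorem locallyPathConnectedSpace : LocallyPathConnectedSpace (UniversalCover Y y₀) := by
  refine LocallyPathConnectedSpace.of_bases (p := fun _ r => 0 < r ∧ r ≤ (ρ : ℝ≥0∞))
    (s := fun a r => Metric.eball a r) (fun a => ?_) (fun a r hr => ?_)
  · refine Metric.nhds_basis_eball.to_hasBasis (fun r hr => ?_) fun r hr => ⟨r, hr.1, subset_rfl⟩
    exact ⟨min r ρ, ⟨lt_min hr H.coe_pos, min_le_right _ _⟩,
      Metric.eball_subset_eball (min_le_left _ _)⟩
  · have ha := Metric.mem_eball_self (x := a) hr.1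
    refine ⟨a, ha, fun {b} hb => ?_⟩
    obtain ⟨p, hp, -⟩ := (H.isCN_eball a hr.2).exists_path ha hb
    exact ⟨p, hp⟩

/-- The closed ball of radius `ρ / 2` below is compact and lifts isometrically. The last clause is
what cocompactness needs: the compact set meets the fibres over a whole ball. -/
theorem exists_compact_nhd [CompactSpace Y] (a : UniversalCover Y y₀) :
    ∃ K : Set (UniversalCover Y y₀), IsCompact K ∧ Metric.eball a ((ρ : ℝ≥0∞) / 2) ⊆ K ∧
      ∀ z, edist a.pt z < (ρ : ℝ≥0∞) / 2 → ∃ b ∈ K, b.pt = z := by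
  have hlt : (ρ : ℝ≥0∞) / 2 < ρ := ENNReal.half_lt_self H.coe_pos.ne' ENNReal.coe_ne_top
  have h : ∀ z : Metric.closedEBall a.pt ((ρ : ℝ≥0∞) / 2), ∃ b : UniversalCover Y y₀,
      b.pt = z ∧ edist a b ≤ edist a.pt z := fun z =>
    H.exists_lift_of_mem ((edist_comm _ _).trans_lt ((Metric.mem_closedEBall.1 z.2).trans_lt hlt))
  choose f hf hd using h
  have hfa : ∀ z, edist a (f z) < ρ := fun z => (hd z).trans_lt
    ((edist_comm _ _).trans_lt ((Metric.mem_closedEBall.1 z.2).trans_lt hlt))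
  have hcont : Continuous f := by
    refine (LipschitzWith.continuous (K := 1) fun z w => ?_)
    rw [H.edist_eq (hfa z) (hfa w), hf, hf]
    simp [Subtype.edist_eq]
  have : CompactSpace (Metric.closedEBall a.pt ((ρ : ℝ≥0∞) / 2)) :=
    isCompact_iff_compactSpace.1 (Metric.isClosed_closedEBall).isCompact
  refine ⟨Set.range f, isCompact_range hcont, fun b hb => ?_, fun z hz => ?_⟩
  · have hb' := Metric.mem_eball'.1 hb
    have hz : b.pt ∈ Metric.closedEBall a.pt ((ρ : ℝ≥0∞) / 2) :=
      (edist_pt_le b a).trans hb.le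
    refine ⟨⟨b.pt, hz⟩, H.eq_of_pt_eq ?_ (hf _)⟩
    rw [H.edist_eq (hfa _) (hb'.trans hlt), hf, edist_self]
    exact H.coe_pos
  · exact ⟨_, ⟨⟨z, Metric.mem_closedEBall.2 ((edist_comm _ _).trans_le hz.le)⟩, rfl⟩, hf _⟩

theorem locallyCompactSpace [CompactSpace Y] : LocallyCompactSpace (UniversalCover Y y₀) := by
  have : WeaklyLocallyCompactSpace (UniversalCover Y y₀) := ⟨fun a => by
    obtain ⟨K, hK, hs, -⟩ := H.exists_compact_nhd a
    exact ⟨K, hK, Filter.mem_of_superset (Metric.eball_mem_nhds a H.half_pos) hs⟩⟩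
  infer_instance

theorem edist_ne_top (a b : UniversalCover Y y₀) : edist a b ≠ ⊤ := by
  have := H.pathConnectedSpace (y₀ := y₀)
  have h : IsClopen (Metric.eball a ⊤) := ⟨Metric.isClosed_eball_top, Metric.isOpen_eball⟩
  have := h.eq_univ ⟨a, Metric.mem_eball_self (by simp)⟩
  have hb : b ∈ Metric.eball a ⊤ := this ▸ Set.mem_univ b
  exact (Metric.mem_eball'.1 hb).ne

theorem isHadamardSpace [CompactSpace Y] [PathConnectedSpace Y] :
    IsHadamardSpace (UniversalCover Y y₀) where
  edist_ne_top := H.edist_ne_top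
  eq_of_edist_eq_zero a b h := H.eq_of_pt_eq (h ▸ H.coe_pos)
    (H.eq_of_edist _ _ (le_antisymm ((edist_pt_le a b).trans h.le) zero_le))
  complete := by
    refine EMetric.complete_of_cauchySeq_tendsto fun u hu => ?_
    -- A tail of a Cauchy sequence lies in one of the compact neighbourhoods.
    obtain ⟨N, hN⟩ := EMetric.cauchySeq_iff'.1 hu _ H.half_pos
    obtain ⟨K, hK, hs, -⟩ := H.exists_compact_nhd (u N)
    obtain ⟨x, -, hx⟩ := cauchySeq_tendsto_of_isComplete hK.isComplete
      (u := fun n => u (n + N)) (fun n => hs (hN (n + N) (Nat.le_add_left _ _)))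
      (hu.comp_tendsto (Filter.tendsto_add_atTop_nat N))
    exact ⟨x, (Filter.tendsto_add_atTop_iff_nat N).1 hx⟩
  connected := by
    have := H.pathConnectedSpace (y₀ := y₀)
    infer_instance
  simplyConnected := H.simplyConnectedSpace
  length_space a b := by
    refine le_antisymm (le_iInf fun γ => edist_le_pathLength' γ) ?_
    refine le_iInf₂ fun γ h => ?_
    have e : b = a.extend γ := by rw [extend, h]
    refine iInf_le_of_le ((H.liftPath a γ).cast rfl e) ?_
    exact H.pathLength_liftPath_le a γ
  nonpos_curved a := ⟨ρ, H.coe_pos, (H.isCN_eball a le_rfl).isCAT0On⟩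

theorem isGeometricAction [CompactSpace Y] [PathConnectedSpace Y] :
    IsGeometricAction (FundamentalGroup Y y₀) (UniversalCover Y y₀) where
  isometric := edist_smul
  properlyDiscontinuous := by
    have h4 : (0 : ℝ≥0∞) < (ρ : ℝ≥0∞) / 2 / 2 := ENNReal.half_pos H.half_pos.ne'
    refine ⟨fun {K L} hK hL => ?_⟩
    have hcov : ∀ K : Set (UniversalCover Y y₀), IsCompact K → ∃ t : Finset (UniversalCover Y y₀),
        K ⊆ ⋃ x ∈ t, Metric.eball x ((ρ : ℝ≥0∞) / 2 / 2) := fun K hK => by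
      obtain ⟨t, -, ht⟩ := hK.elim_nhds_subcover (fun x => Metric.eball x ((ρ : ℝ≥0∞) / 2 / 2))
        fun x _ => Metric.eball_mem_nhds x h4
      exact ⟨t, ht⟩
    obtain ⟨s, hs⟩ := hcov K hK
    obtain ⟨t, ht⟩ := hcov L hL
    have hsub : {g : FundamentalGroup Y y₀ | ((g • ·) '' K ∩ L).Nonempty} ⊆
        ⋃ p ∈ (s ×ˢ t : Finset _), {g | ∃ x ∈ Metric.eball p.1 ((ρ : ℝ≥0∞) / 2 / 2),
          g • x ∈ Metric.eball p.2 ((ρ : ℝ≥0∞) / 2 / 2)} := by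
      rintro g ⟨_, ⟨x, hx, rfl⟩, hxL⟩
      obtain ⟨a, ha, hxa⟩ := Set.mem_iUnion₂.1 (hs hx)
      obtain ⟨b, hb, hxb⟩ := Set.mem_iUnion₂.1 (ht hxL)
      exact Set.mem_iUnion₂.2 ⟨(a, b), Finset.mem_product.2 ⟨ha, hb⟩, x, hxa, hxb⟩
    refine Set.Finite.subset (Set.Finite.biUnion (Finset.finite_toSet _) fun p _ => ?_) hsub
    -- The compact sets are covered by finitely many balls of radius `ρ / 4`. For each pair of balls
    -- at most one element moves a point of the first into the second: two such elements would move
    -- one point to points of the same fibre at distance less than `ρ`.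
    refine Set.Subsingleton.finite ?_
    rintro g ⟨x, hx, hgx⟩ g' ⟨x', hx', hgx'⟩
    have two : ∀ {a x x' : UniversalCover Y y₀}, x ∈ Metric.eball a ((ρ : ℝ≥0∞) / 2 / 2) →
        x' ∈ Metric.eball a ((ρ : ℝ≥0∞) / 2 / 2) → edist x x' < (ρ : ℝ≥0∞) / 2 := by
      intro a x x' hx hx'
      calc edist x x' ≤ edist x a + edist a x' := edist_triangle _ _ _
        _ < (ρ : ℝ≥0∞) / 2 / 2 + (ρ : ℝ≥0∞) / 2 / 2 :=
          ENNReal.add_lt_add hx (Metric.mem_eball'.1 hx')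
        _ = _ := ENNReal.add_halves _
    have h1 := two hx hx'
    have h2 := two hgx hgx'
    have h3 : edist (g • x') (g' • x') < ρ := by
      calc edist (g • x') (g' • x') ≤ edist (g • x') (g • x) + edist (g • x) (g' • x') :=
            edist_triangle _ _ _
        _ < (ρ : ℝ≥0∞) / 2 + (ρ : ℝ≥0∞) / 2 := by
          rw [edist_smul, edist_comm x' x]
          exact ENNReal.add_lt_add h1 h2
        _ = _ := ENNReal.add_halves _
    have h4 := H.eq_of_pt_eq h3 rfl
    have h5 : (g'⁻¹ * g) • x' = x' := by rw [mul_smul, h4, inv_smul_smul]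
    exact (inv_mul_eq_one.1 (eq_one_of_smul_eq h5)).symm
  cocompact := by
    choose K hK hs hz using fun a : UniversalCover Y y₀ => H.exists_compact_nhd a
    choose f hf using pt_surjective (y₀ := y₀)
    obtain ⟨t, -, ht⟩ := (isCompact_univ (X := Y)).elim_nhds_subcover
      (fun y => Metric.eball y ((ρ : ℝ≥0∞) / 2)) fun y _ => Metric.eball_mem_nhds y H.half_pos
    refine ⟨⋃ y ∈ t, K (f y), t.isCompact_biUnion fun y _ => hK _, fun x => ?_⟩
    obtain ⟨y, hy, hxy⟩ := Set.mem_iUnion₂.1 (ht (Set.mem_univ x.pt))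
    obtain ⟨b, hb, e⟩ := hz (f y) x.pt (by rw [hf]; exact Metric.mem_eball'.1 hxy)
    obtain ⟨g, rfl⟩ := exists_smul_eq e.symm
    exact ⟨g, Set.mem_iUnion₂.2 ⟨y, hy, hb⟩⟩

end UniformlyCN
end

noncomputable section

/-! ### Thickened flat tori and their universal covers -/

/-- The product of circles of lengths `p j` and an interval `[0, w]`. -/
abbrev FlatPiece {n : ℕ} (p : Fin n → ℝ) (w : ℝ) : Type :=
  WithLp 2 (PiLp 2 (fun j : Fin n => AddCircle (p j)) × Set.Icc (0 : ℝ) w)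

/-- The Euclidean space that covers a thickened flat torus; its last coordinate is `u`. -/
abbrev Cov (n : ℕ) : Type := WithLp 2 (EuclideanSpace ℝ (Fin n) × ℝ)

namespace Cov

variable {n : ℕ} {p : Fin n → ℝ} {w : ℝ}

/-- The point with coordinates `v` and `u`. -/
def mk (v : Fin n → ℝ) (u : ℝ) : Cov n := WithLp.toLp 2 (WithLp.toLp 2 v, u)

@[simp] theorem mk_fst (v : Fin n → ℝ) (u : ℝ) (j : Fin n) : (mk v u).fst j = v j := rfl

@[simp] theorem mk_snd (v : Fin n → ℝ) (u : ℝ) : (mk v u).snd = u := rfl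

theorem mk_eta (x : Cov n) : mk (fun j => x.fst j) x.snd = x := rfl

theorem ext' {x y : Cov n} (h : ∀ j, x.fst j = y.fst j) (h' : x.snd = y.snd) : x = y := by
  rw [← mk_eta x, ← mk_eta y, h']; simp only [h]

theorem norm_sq (x : Cov n) : ‖x‖ ^ 2 = ∑ j, x.fst j ^ 2 + x.snd ^ 2 := by
  rw [WithLp.prod_norm_sq_eq_of_L2, EuclideanSpace.norm_sq_eq]
  simp only [Real.norm_eq_abs, sq_abs]

theorem abs_fst_le (x : Cov n) (j : Fin n) : |x.fst j| ≤ ‖x‖ := by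
  refine abs_le_of_sq_le_sq' ?_ (norm_nonneg _) |>.2
  rw [norm_sq, sq_abs]
  have := Finset.single_le_sum (f := fun j => x.fst j ^ 2) (fun i _ => sq_nonneg _)
    (Finset.mem_univ j)
  linarith [sq_nonneg x.snd]

theorem abs_snd_le (x : Cov n) : |x.snd| ≤ ‖x‖ := by
  refine abs_le_of_sq_le_sq' ?_ (norm_nonneg _) |>.2
  rw [norm_sq, sq_abs]
  have := Finset.sum_nonneg (f := fun j => x.fst j ^ 2) (s := Finset.univ) (fun i _ => sq_nonneg _)
  linarith

/-- The covering map; the coordinate `u` is clamped to the interval. -/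
def proj (p : Fin n → ℝ) (hw : 0 ≤ w) (x : Cov n) : FlatPiece p w :=
  WithLp.toLp 2 (WithLp.toLp 2 fun j => ((x.fst j : ℝ) : AddCircle (p j)), Set.projIcc 0 w hw x.snd)

theorem continuous_proj (hw : 0 ≤ w) : Continuous (proj p hw) := by
  unfold proj
  refine (WithLp.prod_continuous_toLp 2 _ _).comp (Continuous.prodMk ?_ ?_)
  · refine (PiLp.continuous_toLp 2 _).comp (continuous_pi fun j => ?_)
    exact (AddCircle.continuous_mk' (p j)).comp
      ((continuous_apply j).comp ((PiLp.continuous_ofLp 2 _).comp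
        (continuous_fst.comp (WithLp.prod_continuous_ofLp 2 _ _))))
  · exact continuous_projIcc.comp (continuous_snd.comp (WithLp.prod_continuous_ofLp 2 _ _))

theorem dist_proj_sq (hw : 0 ≤ w) (x y : Cov n) : dist (proj p hw x) (proj p hw y) ^ 2 =
    ∑ j, ‖((x.fst j - y.fst j : ℝ) : AddCircle (p j))‖ ^ 2 +
      ((Set.projIcc 0 w hw x.snd : ℝ) - Set.projIcc 0 w hw y.snd) ^ 2 := by
  have h2 : (2 : ℝ≥0∞).toReal = 2 := by simp
  rw [WithLp.prod_dist_eq_add (by rw [h2]; norm_num), h2, ← Real.sqrt_eq_rpow,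
    Real.sq_sqrt (by positivity), Real.rpow_two, Real.rpow_two, PiLp.dist_sq_eq_of_L2,
    Subtype.dist_eq, Real.dist_eq, sq_abs]
  simp only [dist_eq_norm, AddCircle.coe_sub]
  rfl

theorem dist_proj_sq_of_mem (hw : 0 ≤ w) {x y : Cov n} (hx : x.snd ∈ Set.Icc 0 w)
    (hy : y.snd ∈ Set.Icc 0 w) : dist (proj p hw x) (proj p hw y) ^ 2 =
    ∑ j, ‖((x.fst j - y.fst j : ℝ) : AddCircle (p j))‖ ^ 2 + (x.snd - y.snd) ^ 2 := by
  rw [dist_proj_sq, Set.projIcc_of_mem hw hx, Set.projIcc_of_mem hw hy]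

theorem dist_proj_eq (hw : 0 ≤ w) {x y : Cov n} (hx : x.snd ∈ Set.Icc 0 w)
    (hy : y.snd ∈ Set.Icc 0 w) (hp : ∀ j, 0 < p j) (h : ∀ j, |x.fst j - y.fst j| ≤ p j / 2) :
    dist (proj p hw x) (proj p hw y) = ‖x - y‖ := by
  rw [← sq_eq_sq₀ dist_nonneg (norm_nonneg _), dist_proj_sq_of_mem hw hx hy, norm_sq]
  congr 1
  refine Finset.sum_congr rfl fun j _ => ?_
  rw [(AddCircle.norm_coe_eq_abs_iff _ (hp j).ne').2 (by rw [abs_of_pos (hp j)]; exact h j)]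
  exact sq_abs _

theorem dist_proj_le (hw : 0 ≤ w) (x y : Cov n) :
    dist (proj p hw x) (proj p hw y) ≤ ‖x - y‖ := by
  rw [← sq_le_sq₀ dist_nonneg (norm_nonneg _), dist_proj_sq, norm_sq]
  refine add_le_add (Finset.sum_le_sum fun j _ => ?_) ?_
  · have h : ‖((x.fst j - y.fst j : ℝ) : AddCircle (p j))‖ ≤ |x.fst j - y.fst j| :=
      QuotientAddGroup.norm_mk_le_norm
    exact (pow_le_pow_left₀ (norm_nonneg _) h 2).trans (sq_abs _).le
  · exact sq_le_sq.2 (Set.abs_projIcc_sub_projIcc hw)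

/-- The translation by a lattice vector. -/
def shift (p : Fin n → ℝ) (m : Fin n → ℤ) (x : Cov n) : Cov n :=
  mk (fun j => x.fst j + m j * p j) x.snd

@[simp] theorem shift_fst (m : Fin n → ℤ) (x : Cov n) (j : Fin n) :
    (shift p m x).fst j = x.fst j + m j * p j := rfl

@[simp] theorem shift_snd (m : Fin n → ℤ) (x : Cov n) : (shift p m x).snd = x.snd := rfl

theorem shift_add (m m' : Fin n → ℤ) (x : Cov n) : shift p (m + m') x = shift p m (shift p m' x) :=
  ext' (fun j => by simp only [shift_fst, Pi.add_apply, Int.cast_add]; ring) rfl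

theorem shift_zero (x : Cov n) : shift p 0 x = x :=
  ext' (fun j => by simp) rfl

theorem continuous_shift (m : Fin n → ℤ) : Continuous (shift p m : Cov n → Cov n) := by
  have : (shift p m : Cov n → Cov n) = fun x => x + mk (fun j => m j * p j) 0 := by
    funext x
    exact ext' (fun j => rfl) (by simp)
  rw [this]
  fun_prop

theorem proj_shift (hw : 0 ≤ w) (m : Fin n → ℤ) (x : Cov n) :
    proj p hw (shift p m x) = proj p hw x := by
  unfold proj
  congr 2
  ext j
  simp only [shift_fst, AddCircle.coe_add]
  have : ((m j * p j : ℝ) : AddCircle (p j)) = 0 :=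
    AddCircle.coe_eq_zero_iff _ |>.2 ⟨m j, by simp⟩
  simp [this]

/-- The projection of the last coordinate to the interval. -/
def clamp (hw : 0 ≤ w) (x : Cov n) : Cov n := mk (fun j => x.fst j) (Set.projIcc 0 w hw x.snd)

theorem clamp_mem (hw : 0 ≤ w) (x : Cov n) : (clamp hw x).snd ∈ Set.Icc 0 w :=
  (Set.projIcc 0 w hw x.snd).2

/-- Any point is covered by a point that is as close as possible to a given point. -/
theorem exists_proj_eq (hw : 0 ≤ w) (hp : ∀ j, 0 < p j) {x : Cov n} (hx : x.snd ∈ Set.Icc 0 w)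
    (z : FlatPiece p w) :
    ∃ y : Cov n, y.snd ∈ Set.Icc 0 w ∧ proj p hw y = z ∧ ‖x - y‖ = dist (proj p hw x) z := by
  have h : ∀ j, ∃ t : ℝ, ((x.fst j - t : ℝ) : AddCircle (p j)) = z.fst j ∧ |t| ≤ p j / 2 := by
    intro j
    obtain ⟨s, hs⟩ := QuotientAddGroup.mk_surjective (z.fst j)
    have hs' : ((s : ℝ) : AddCircle (p j)) = z.fst j := hs
    refine ⟨(x.fst j - s) - round ((p j)⁻¹ * (x.fst j - s)) * p j, ?_, ?_⟩
    · rw [← hs']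
      have : ((round ((p j)⁻¹ * (x.fst j - s)) * p j : ℝ) : AddCircle (p j)) = 0 :=
        AddCircle.coe_eq_zero_iff _ |>.2 ⟨round ((p j)⁻¹ * (x.fst j - s)), by simp⟩
      have e : x.fst j - ((x.fst j - s) - round ((p j)⁻¹ * (x.fst j - s)) * p j) =
        s + round ((p j)⁻¹ * (x.fst j - s)) * p j := by ring
      rw [e, AddCircle.coe_add, this, add_zero]
    · rw [← AddCircle.norm_eq]
      have := AddCircle.norm_le_half_period (p j) (x := ((x.fst j - s : ℝ) : AddCircle (p j)))
        (hp j).ne'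
      rwa [abs_of_pos (hp j)] at this
  choose t ht ht' using h
  have e : proj p hw (mk (fun j => x.fst j - t j) z.snd) = z := by
    have : Set.projIcc 0 w hw (z.snd : ℝ) = z.snd := Set.projIcc_val hw _
    unfold proj
    simp only [mk_fst, mk_snd, ht, this]
    rfl
  refine ⟨mk (fun j => x.fst j - t j) z.snd, z.snd.2, e, ?_⟩
  conv_rhs => rw [← e]
  have hz : (mk (fun j => x.fst j - t j) (z.snd : ℝ)).snd ∈ Set.Icc 0 w := z.snd.2
  exact (dist_proj_eq hw hx hz hp fun j => by simpa using ht' j).symm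

theorem proj_surjective (hw : 0 ≤ w) (hp : ∀ j, 0 < p j) (z : FlatPiece p w) :
    ∃ y : Cov n, y.snd ∈ Set.Icc 0 w ∧ proj p hw y = z := by
  obtain ⟨y, hy, e, -⟩ := exists_proj_eq hw hp (x := mk 0 0) ⟨le_rfl, hw⟩ z
  exact ⟨y, hy, e⟩

theorem proj_eq_iff (hw : 0 ≤ w) {x y : Cov n} (hx : x.snd ∈ Set.Icc 0 w)
    (hy : y.snd ∈ Set.Icc 0 w) :
    proj p hw x = proj p hw y ↔ ∃ m : Fin n → ℤ, y = shift p m x := by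
  constructor
  · intro h
    have h1 : ∀ j, ((x.fst j : ℝ) : AddCircle (p j)) = (y.fst j : ℝ) := fun j =>
      congrArg (fun z : FlatPiece p w => z.fst j) h
    have h2 : x.snd = y.snd := by
      have := congrArg (fun z : FlatPiece p w => (z.snd : ℝ)) h
      change (Set.projIcc 0 w hw x.snd : ℝ) = Set.projIcc 0 w hw y.snd at this
      rwa [Set.projIcc_of_mem hw hx, Set.projIcc_of_mem hw hy] at this
    have h3 : ∀ j, ∃ k : ℤ, k • p j = y.fst j - x.fst j := fun j => by
      rw [← AddCircle.coe_eq_zero_iff, AddCircle.coe_sub, h1 j, sub_self]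
    choose m hm using h3
    refine ⟨m, ext' (fun j => ?_) h2.symm⟩
    have := hm j
    rw [zsmul_eq_mul] at this
    rw [shift_fst, this]; ring
  · rintro ⟨m, rfl⟩
    rw [proj_shift]

end Cov

theorem compactSpace_flatPiece {n : ℕ} {p : Fin n → ℝ} {w : ℝ} (hp : ∀ j, 0 < p j) :
    CompactSpace (FlatPiece p w) := by
  have : ∀ j, Fact (0 < p j) := fun j => ⟨hp j⟩
  let f : (∀ j, AddCircle (p j)) × Set.Icc (0 : ℝ) w → FlatPiece p w := fun x =>
    WithLp.toLp 2 (WithLp.toLp 2 x.1, x.2)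
  have hf : Continuous f := (WithLp.prod_continuous_toLp 2 _ _).comp
    (((PiLp.continuous_toLp 2 _).comp continuous_fst).prodMk continuous_snd)
  have hs : Set.range f = Set.univ := Set.range_eq_univ.2 fun z => ⟨(z.fst.ofLp, z.snd), rfl⟩
  exact ⟨hs ▸ isCompact_range hf⟩

theorem simplyConnectedSpace_of_normed (E : Type*) [NormedAddCommGroup E] [NormedSpace ℝ E] :
    SimplyConnectedSpace E := by
  have := RealTopologicalVectorSpace.contractibleSpace (E := E)
  exact SimplyConnectedSpace.ofContractible E

theorem locallyPathConnectedSpace_of_normed (E : Type*) [NormedAddCommGroup E] [NormedSpace ℝ E] :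
    LocallyPathConnectedSpace E := inferInstance

instance Cov.simplyConnectedSpace (n : ℕ) : SimplyConnectedSpace (Cov n) :=
  simplyConnectedSpace_of_normed (Cov n)

instance Cov.locallyPathConnectedSpace (n : ℕ) : LocallyPathConnectedSpace (Cov n) :=
  locallyPathConnectedSpace_of_normed (Cov n)
end

noncomputable section

/-! ### The metric of the torus complex -/

/-- The source of all lower bounds for the glued metric: a function that is 1-Lipschitz on the
pieces and compatible with the identifications is 1-Lipschitz on the quotient. -/
theorem Glued.le_add_edist {ι : Type*} {X : ι → Type*} [∀ i, PseudoEMetricSpace (X i)]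
    {r : (Σ i, X i) → (Σ i, X i) → Prop} (f : (Σ i, X i) → ℝ≥0∞)
    (hmove : ∀ i x y, f ⟨i, y⟩ ≤ f ⟨i, x⟩ + edist x y) (hglue : ∀ p q, r p q → f p = f q)
    (p q : Σ i, X i) : f q ≤ f p + edist (α := Glued r) (Quot.mk r p) (Quot.mk r q) := by
  have key : ∀ {p q : Σ i, X i} {a : ℝ≥0∞}, GlueChain r p q a → f q ≤ f p + a := by
    intro p q a h
    induction h with
    | move i x y => exact hmove i x y
    | jump h => rw [hglue _ _ h, add_zero]
    | jump_symm h => rw [hglue _ _ h, add_zero]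
    | trans _ _ ih₁ ih₂ => rw [← add_assoc]; exact ih₂.trans (add_le_add_left ih₁ _)
  change f q ≤ f p + ⨅ a : {a : ℝ≥0∞ // GlueChain r p q a}, a.1
  rw [ENNReal.add_iInf]
  exact le_iInf fun a => key a.2

theorem Glued.edist_mk_le {ι : Type*} {X : ι → Type*} [∀ i, PseudoEMetricSpace (X i)]
    {r : (Σ i, X i) → (Σ i, X i) → Prop} (i : ι) (x y : X i) :
    edist (α := Glued r) (Quot.mk r ⟨i, x⟩) (Quot.mk r ⟨i, y⟩) ≤ edist x y :=
  iInf_le_of_le ⟨_, .move i x y⟩ le_rfl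

namespace TorusComplex

/-- The periods of a torus. -/
abbrev torusPer (e : TorusIndex) : Fin 3 → ℝ := ![torusPeriod e, torusPeriod e, √2]

/-- The periods of a cylinder. -/
abbrev cylinderPer (c : CylinderIndex) : Fin 2 → ℝ := ![cylinderPeriod c, √2]

/-- All periods exceed `1 / 2`, so vectors of norm at most `1 / 4` are shortest in their classes
modulo the lattice. The constant `1 / 4` below has this origin. -/
theorem lt_torusPeriod (e : TorusIndex) : 1 / 2 < torusPeriod e := by
  have h : √2 < 2 := by rw [Real.sqrt_lt' (by norm_num)]; norm_num
  have h1 : 1 < √2 := by rw [Real.lt_sqrt (by norm_num)]; norm_num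
  have h3 : (1 : ℝ) / 2 < 1 / √2 := one_div_lt_one_div_of_lt (by positivity) h
  rcases e with _ | ⟨g, i⟩
  · simp only [torusPeriod]; linarith
  · fin_cases i <;> simp only [torusPeriod] <;> linarith

theorem lt_cylinderPeriod (c : CylinderIndex) : 1 / 2 < cylinderPeriod c := by
  have h : √2 < 2 := by rw [Real.sqrt_lt' (by norm_num)]; norm_num
  have h1 : 1 < √2 := by rw [Real.lt_sqrt (by norm_num)]; norm_num
  have h3 : (1 : ℝ) / 2 < 1 / √2 := one_div_lt_one_div_of_lt (by positivity) h
  rcases c with _ | ⟨g, i⟩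
  · simp only [cylinderPeriod]; linarith
  · fin_cases i <;> simp only [cylinderPeriod] <;> linarith

theorem lt_torusPer (e : TorusIndex) (j : Fin 3) : 1 / 2 < torusPer e j := by
  have h1 : 1 < √2 := by rw [Real.lt_sqrt (by norm_num)]; norm_num
  have := lt_torusPeriod e
  fin_cases j <;> simp <;> linarith

theorem lt_cylinderPer (c : CylinderIndex) (j : Fin 2) : 1 / 2 < cylinderPer c j := by
  have h1 : 1 < √2 := by rw [Real.lt_sqrt (by norm_num)]; norm_num
  have := lt_cylinderPeriod c
  fin_cases j <;> simp <;> linarith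

theorem torusPer_pos (e : TorusIndex) (j : Fin 3) : 0 < torusPer e j := by
  linarith [lt_torusPer e j]

theorem cylinderPer_pos (c : CylinderIndex) (j : Fin 2) : 0 < cylinderPer c j := by
  linarith [lt_cylinderPer c j]

variable (ε : ℝ≥0)

/-- The covering of a thickened torus. -/
def tor (e : TorusIndex) (x : Cov 3) : ThickTorus ε e :=
  Cov.proj (torusPer e) (NNReal.coe_nonneg (thickness ε e)) x

/-- The covering of a cylinder. -/
def cyl (c : CylinderIndex) (a : Cov 2) : FlatCylinder c :=
  Cov.proj (cylinderPer c) zero_le_one a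

/-- The map from the covering of a thickened torus to the torus complex. -/
def torusMap (e : TorusIndex) (x : Cov 3) : YSpace ε := Quot.mk _ ⟨.inl e, tor ε e x⟩

/-- The map from the covering of a cylinder to the torus complex. -/
def cylinderMap (c : CylinderIndex) (a : Cov 2) : YSpace ε := Quot.mk _ ⟨.inr c, cyl c a⟩

/-- The coordinate `u` of an end of a cylinder. -/
def endU (b : Bool) : ℝ := if b then 1 else 0

theorem endU_mem (b : Bool) : endU b ∈ Set.Icc (0 : ℝ) 1 := by cases b <;> simp [endU]

/-- The point of the covering of a torus that is glued to the point with coordinates `v` at the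
end `b` of a cylinder. -/
def endCov (c : CylinderIndex) (b : Bool) (v : Fin 2 → ℝ) : Cov 3 :=
  Cov.mk (endMap c b (v 0) (v 1)) (endFace ε c b : ℝ)

theorem endCov_snd_mem (c : CylinderIndex) (b : Bool) (v : Fin 2 → ℝ) :
    (endCov ε c b v).snd ∈ Set.Icc (0 : ℝ) (thickness ε (endTorus c b)) := (endFace ε c b).2

theorem cyl_endU (c : CylinderIndex) (b : Bool) (v : Fin 2 → ℝ) :
    cyl c (Cov.mk v (endU b)) = cylinderPoint c ![v 0, v 1] (if b then 1 else 0) := by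
  unfold cyl Cov.proj cylinderPoint
  congr 2
  · congr 1
    funext j
    fin_cases j <;> rfl
  · cases b
    · exact Set.projIcc_left _
    · exact Set.projIcc_right _

theorem tor_endCov (c : CylinderIndex) (b : Bool) (v : Fin 2 → ℝ) :
    tor ε (endTorus c b) (endCov ε c b v) =
      torusPoint ε (endTorus c b) (endMap c b (v 0) (v 1)) (endFace ε c b) := by
  unfold tor Cov.proj torusPoint
  congr 2
  exact Set.projIcc_val _ _

theorem cylinderMap_end (c : CylinderIndex) (b : Bool) (v : Fin 2 → ℝ) :
    cylinderMap ε c (Cov.mk v (endU b)) = torusMap ε (endTorus c b) (endCov ε c b v) := by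
  unfold cylinderMap torusMap
  rw [cyl_endU, tor_endCov]
  exact Quot.sound (GlueRel.mk c b (v 0) (v 1))

/-- The linear part of the gluing map. -/
theorem endMap_sub (c : CylinderIndex) (b : Bool) (s t s' t' : ℝ) :
    endMap c b s t - endMap c b s' t' = endMap c b (s - s') (t - t') := by
  rcases c with g | ⟨g, i⟩
  · cases g <;> cases b <;> funext j <;> fin_cases j <;> simp [endMap] <;> ring
  · cases b <;> fin_cases i <;> funext j <;> fin_cases j <;> simp [endMap] <;> ring

theorem endMap_smul (c : CylinderIndex) (b : Bool) (k s t : ℝ) :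
    endMap c b (k * s) (k * t) = k • endMap c b s t := by
  rcases c with g | ⟨g, i⟩
  · cases g <;> cases b <;> funext j <;> fin_cases j <;> simp [endMap] <;> ring
  · cases b <;> fin_cases i <;> funext j <;> fin_cases j <;> simp [endMap] <;> ring

/-- The norm of `ℝ / pℤ`, as a function on `ℝ`. -/
def circleNorm (p x : ℝ) : ℝ := ‖(x : AddCircle p)‖

theorem circleNorm_zero (p : ℝ) : circleNorm p 0 = 0 := by simp [circleNorm]

theorem circleNorm_neg_div (p x y : ℝ) : circleNorm p (-x / y) = circleNorm p (x / y) := by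
  rw [circleNorm, neg_div, AddCircle.coe_neg, norm_neg, circleNorm]

theorem circleNorm_div_sqrt_two (x p : ℝ) :
    circleNorm p (x / √2) ^ 2 = circleNorm (√2 * p) x ^ 2 / 2 := by
  have h := AddCircle.norm_coe_mul p (x / √2) √2
  have h2 : √2 * (x / √2) = x := by field_simp
  rw [h2] at h
  unfold circleNorm
  rw [h, mul_pow, sq_abs, Real.sq_sqrt (by norm_num)]
  ring

/-- The ends of the cylinders are embedded isometrically, for the distance in the whole torus and
not only infinitesimally. A diagonal curve has two coordinates `± s / √2`, each of which contributes
half of the square of the norm of `s` modulo `√2` times the period of the torus, and this product is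
the period of the cylinder. -/
theorem sum_circleNorm_sq_endMap (c : CylinderIndex) (b : Bool) (s t : ℝ) :
    ∑ j, circleNorm (torusPer (endTorus c b) j) (endMap c b s t j) ^ 2 =
      ∑ j, circleNorm (cylinderPer c j) (![s, t] j) ^ 2 := by
  rw [Fin.sum_univ_three, Fin.sum_univ_two]
  rcases c with g | ⟨g, i⟩
  · cases g <;> cases b <;>
      simp [endMap, endTorus, torusPeriod, cylinderPeriod, circleNorm_neg_div,
        circleNorm_div_sqrt_two, circleNorm_zero]
  · cases b <;> fin_cases i <;>
      simp [endMap, endTorus, torusPeriod, cylinderPeriod, circleNorm_neg_div,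
        circleNorm_div_sqrt_two, circleNorm_zero]

theorem edist_cyl_end (c : CylinderIndex) (b : Bool) (v v' : Fin 2 → ℝ) :
    edist (cyl c (Cov.mk v (endU b))) (cyl c (Cov.mk v' (endU b))) =
      edist (tor ε (endTorus c b) (endCov ε c b v)) (tor ε (endTorus c b) (endCov ε c b v')) := by
  rw [edist_dist, edist_dist]
  congr 1
  rw [← sq_eq_sq₀ dist_nonneg dist_nonneg]
  unfold cyl tor
  rw [Cov.dist_proj_sq, Cov.dist_proj_sq]
  congr 1
  · have := sum_circleNorm_sq_endMap c b (v 0 - v' 0) (v 1 - v' 1)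
    rw [← endMap_sub] at this
    refine Eq.trans ?_ this.symm
    rw [Fin.sum_univ_two, Fin.sum_univ_two]
    rfl
  · simp [endCov]

theorem endTorus_injective (c : CylinderIndex) : Function.Injective (endTorus c) := by
  intro b b' h
  rcases c with g | ⟨g, i⟩
  · cases g <;> cases b <;> cases b' <;> simp_all [endTorus]
  · cases b <;> cases b' <;> fin_cases i <;> simp_all [endTorus]

theorem one_le_edist_ends {c : CylinderIndex} {b b' : Bool} (h : b ≠ b') (v v' : Fin 2 → ℝ) :
    1 ≤ edist (cyl c (Cov.mk v (endU b))) (cyl c (Cov.mk v' (endU b'))) := by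
  have : 1 ≤ dist (cyl c (Cov.mk v (endU b))) (cyl c (Cov.mk v' (endU b'))) := by
    rw [← one_le_sq_iff₀ dist_nonneg]
    unfold cyl
    rw [Cov.dist_proj_sq_of_mem _ (by exact endU_mem b) (by exact endU_mem b')]
    have h1 : (endU b - endU b') ^ 2 = 1 := by
      cases b <;> cases b' <;> simp_all [endU]
    have h2 : (0 : ℝ) ≤ ∑ j, ‖(((Cov.mk v (endU b)).fst j - (Cov.mk v' (endU b')).fst j : ℝ) :
        AddCircle (cylinderPer c j))‖ ^ 2 := Finset.sum_nonneg fun _ _ => sq_nonneg _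
    simp only [Cov.mk_snd] at *
    linarith
  rw [edist_dist]
  exact ENNReal.one_le_ofReal.2 this

open Classical in
/-- The distance of points in the disjoint union of the tori, capped at `1`. -/
def cappedDist (e : TorusIndex) (x : Cov 3) (e' : TorusIndex) (y : ThickTorus ε e') : ℝ≥0∞ :=
  if e = e' then min 1 (edist (tor ε e' x) y) else 1

theorem cappedDist_le_one (e : TorusIndex) (x : Cov 3) (e' : TorusIndex) (y : ThickTorus ε e') :
    cappedDist ε e x e' y ≤ 1 := by
  unfold cappedDist
  split_ifs
  · exact min_le_left _ _
  · exact le_rfl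

theorem cappedDist_le_add (e : TorusIndex) (x : Cov 3) (e' : TorusIndex) (y z : ThickTorus ε e') :
    cappedDist ε e x e' z ≤ cappedDist ε e x e' y + edist y z := by
  unfold cappedDist
  split_ifs with h
  · rw [← min_add_add_right]
    exact min_le_min le_self_add (edist_triangle _ _ _)
  · exact le_self_add

/-- The length of the shortest way from a point of a torus to a point of a cylinder through an end
of the cylinder. -/
def crossDist (e : TorusIndex) (x : Cov 3) (c : CylinderIndex) (z : FlatCylinder c) : ℝ≥0∞ :=
  ⨅ (b : Bool) (v : Fin 2 → ℝ), (cappedDist ε e x (endTorus c b) (tor ε _ (endCov ε c b v)) +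
    edist (cyl c (Cov.mk v (endU b))) z)

/-- The lower bound for the distance from a point of a torus. -/
def torusBound (e : TorusIndex) (x : Cov 3) : (Σ i, Piece ε i) → ℝ≥0∞
  | ⟨.inl e', y⟩ => cappedDist ε e x e' y
  | ⟨.inr c, z⟩ => min 1 (crossDist ε e x c z)

/-- The function `torusBound` is compatible with the gluing: detours into a cylinder that return
through the same end gain nothing, because the end is embedded isometrically, and crossing a
cylinder costs at least `1`, the cap. -/
theorem torusBound_le (e : TorusIndex) (x : Cov 3) (q : Σ i, Piece ε i) :
    torusBound ε e x q ≤ edist (torusMap ε e x) (Quot.mk _ q) := by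
  have h0 : torusBound ε e x ⟨.inl e, tor ε e x⟩ = 0 := by
    simp [torusBound, cappedDist]
  have := Glued.le_add_edist (r := GlueRel ε) (torusBound ε e x) ?_ ?_ ⟨.inl e, tor ε e x⟩ q
  · rwa [h0, zero_add] at this
  · rintro (e' | c) y z
    · exact cappedDist_le_add ε e x e' y z
    · change min 1 (crossDist ε e x c z) ≤ min 1 (crossDist ε e x c y) +
        edist (α := FlatCylinder c) y z
      rw [← min_add_add_right]
      refine min_le_min le_self_add ?_
      unfold crossDist
      simp only [ENNReal.iInf_add]
      refine iInf_mono fun b => iInf_mono fun v => ?_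
      rw [add_assoc]
      exact add_le_add_right (edist_triangle _ _ _) _
  · rintro _ _ ⟨c, b, s, t⟩
    have e1 : cylinderPoint c ![s, t] (if b then 1 else 0) = cyl c (Cov.mk ![s, t] (endU b)) := by
      rw [cyl_endU]; rfl
    have e2 : torusPoint ε (endTorus c b) (endMap c b s t) (endFace ε c b) =
      tor ε (endTorus c b) (endCov ε c b ![s, t]) := by rw [tor_endCov]; rfl
    rw [e1, e2]
    change min 1 (crossDist ε e x c _) = cappedDist ε e x _ _
    refine le_antisymm ?_ (le_min (cappedDist_le_one _ _ _ _ _) ?_)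
    · refine (min_le_right _ _).trans ((iInf₂_le b ![s, t]).trans ?_)
      rw [edist_self, add_zero]
    · refine le_iInf₂ fun b' v => ?_
      by_cases hb : b' = b
      · subst hb
        rw [edist_cyl_end ε]
        exact cappedDist_le_add _ _ _ _ _ _
      · exact (cappedDist_le_one _ _ _ _ _).trans ((one_le_edist_ends hb _ _).trans le_add_self)

open Classical in
/-- The distance in a cylinder. -/
def cylinderDist (c : CylinderIndex) (a : Cov 2) : (Σ i, Piece ε i) → ℝ≥0∞
  | ⟨.inl _, _⟩ => ⊤
  | ⟨.inr c', z⟩ => if c = c' then edist (cyl c' a) z else ⊤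

/-- The length of the shortest way out of a cylinder through one of its ends and on to `y`. -/
def exitDist (c : CylinderIndex) (a : Cov 2) (y : YSpace ε) : ℝ≥0∞ :=
  ⨅ (b : Bool) (v : Fin 2 → ℝ), (edist (cyl c a) (cyl c (Cov.mk v (endU b))) +
        edist (cylinderMap ε c (Cov.mk v (endU b))) y)

/-- A path from a point of a cylinder stays in the cylinder or passes through an end. -/
theorem min_cylinderDist_exitDist_le (c : CylinderIndex) (a : Cov 2) (q : Σ i, Piece ε i) :
    min (cylinderDist ε c a q) (exitDist ε c a (Quot.mk _ q)) ≤
      edist (cylinderMap ε c a) (Quot.mk _ q) := by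
  have hexit : ∀ y z, exitDist ε c a z ≤ exitDist ε c a y + edist y z := by
    intro y z
    unfold exitDist
    simp only [ENNReal.iInf_add]
    refine iInf_mono fun b => iInf_mono fun v => ?_
    rw [add_assoc]
    exact add_le_add_right (edist_triangle _ _ _) _
  have h0 : cylinderDist ε c a ⟨.inr c, cyl c a⟩ = 0 := by
    simp [cylinderDist]
  have := Glued.le_add_edist (r := GlueRel ε)
    (fun q => min (cylinderDist ε c a q) (exitDist ε c a (Quot.mk _ q))) ?_ ?_
    ⟨.inr c, cyl c a⟩ q
  · simp only [h0, zero_le, inf_of_le_left, zero_add] at this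
    exact this
  · intro i y z
    rw [← min_add_add_right]
    refine min_le_min ?_ ((hexit _ _).trans (add_le_add_right (Glued.edist_mk_le i y z) _))
    rcases i with e | c'
    · simp [cylinderDist]
    · simp only [cylinderDist]
      split_ifs
      · exact edist_triangle _ _ _
      · simp
  · rintro p q h
    have e : (Quot.mk _ p : YSpace ε) = Quot.mk _ q := Quot.sound h
    obtain ⟨c', b, s, t⟩ := h
    have e1 : cylinderPoint c' ![s, t] (if b then 1 else 0) = cyl c' (Cov.mk ![s, t] (endU b)) := by
      rw [cyl_endU]; rfl
    refine Eq.trans ?_ ((congrArg (exitDist ε c a) e).trans (min_eq_right le_top).symm)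
    refine min_eq_right ?_
    by_cases hc : c = c'
    · subst hc
      refine le_trans ?_ (if_pos (c := c = c) rfl).ge
      rw [e1]
      refine (iInf₂_le b ![s, t]).trans ?_
      change _ + edist (cylinderMap ε c _) (cylinderMap ε c _) ≤ _
      rw [edist_self, add_zero]
    · exact le_top.trans (if_neg hc).ge

/-! ### Distances in and between the pieces -/

theorem edist_torusMap_le (e : TorusIndex) (x y : Cov 3) :
    edist (torusMap ε e x) (torusMap ε e y) ≤ edist (tor ε e x) (tor ε e y) :=
  Glued.edist_mk_le (r := GlueRel ε) (.inl e) _ _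

theorem edist_cylinderMap_le (c : CylinderIndex) (a a' : Cov 2) :
    edist (cylinderMap ε c a) (cylinderMap ε c a') ≤ edist (cyl c a) (cyl c a') :=
  Glued.edist_mk_le (r := GlueRel ε) (.inr c) _ _

theorem le_edist_torusMap (e : TorusIndex) (x y : Cov 3) :
    min 1 (edist (tor ε e x) (tor ε e y)) ≤ edist (torusMap ε e x) (torusMap ε e y) := by
  have : _ ≤ edist (torusMap ε e x) (torusMap ε e y) := torusBound_le ε e x ⟨.inl e, tor ε e y⟩
  simpa [torusBound, cappedDist] using this

theorem one_le_edist_torusMap {e e' : TorusIndex} (h : e ≠ e') (x y : Cov 3) :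
    1 ≤ edist (torusMap ε e x) (torusMap ε e' y) := by
  have : _ ≤ edist (torusMap ε e x) (torusMap ε e' y) :=
    torusBound_le ε e x ⟨.inl e', tor ε e' y⟩
  simpa [torusBound, cappedDist, h] using this

theorem le_edist_ends (c : CylinderIndex) (b b' : Bool) (v v' : Fin 2 → ℝ) :
    min 1 (edist (cyl c (Cov.mk v (endU b))) (cyl c (Cov.mk v' (endU b')))) ≤
      edist (cylinderMap ε c (Cov.mk v (endU b))) (cylinderMap ε c (Cov.mk v' (endU b'))) := by
  rw [cylinderMap_end, cylinderMap_end]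
  by_cases hb : b = b'
  · subst hb
    rw [edist_cyl_end ε]
    exact le_edist_torusMap ε _ _ _
  · exact (min_le_left _ _).trans (one_le_edist_torusMap ε (fun h => hb (endTorus_injective c h))
      _ _)

/-- A path that leaves the cylinder meets an end, and from there on the distance to another end
point is already controlled by the tori. The same argument, with this as input, treats two arbitrary
points of the cylinder. -/
theorem le_edist_end_cylinderMap (c : CylinderIndex) (b : Bool) (v : Fin 2 → ℝ) (a : Cov 2) :
    min 1 (edist (cyl c a) (cyl c (Cov.mk v (endU b)))) ≤
      edist (cylinderMap ε c a) (cylinderMap ε c (Cov.mk v (endU b))) := by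
  refine le_trans ?_ (min_cylinderDist_exitDist_le ε c a ⟨.inr c, cyl c (Cov.mk v (endU b))⟩)
  refine le_min ?_ ?_
  · simp [cylinderDist]
  · refine le_iInf₂ fun b' v' => ?_
    refine le_trans ?_ (add_le_add_right (le_edist_ends ε c b' b v' v) _)
    rw [← min_add_add_left]
    exact min_le_min le_add_self (edist_triangle _ _ _)

theorem le_edist_cylinderMap (c : CylinderIndex) (a a' : Cov 2) :
    min 1 (edist (cyl c a) (cyl c a')) ≤ edist (cylinderMap ε c a) (cylinderMap ε c a') := by
  refine le_trans ?_ (min_cylinderDist_exitDist_le ε c a ⟨.inr c, cyl c a'⟩)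
  refine le_min ?_ ?_
  · simp [cylinderDist]
  · refine le_iInf₂ fun b' v' => ?_
    have := le_edist_end_cylinderMap ε c b' v' a'
    rw [edist_comm (cyl c a'), edist_comm (cylinderMap ε c a')] at this
    refine le_trans ?_ (add_le_add_right this _)
    rw [← min_add_add_left]
    exact min_le_min le_add_self (edist_triangle _ _ _)

theorem exitDist_le_of_ne (c c' : CylinderIndex) (h : c ≠ c') (a a' : Cov 2) :
    exitDist ε c a (cylinderMap ε c' a') ≤ edist (cylinderMap ε c a) (cylinderMap ε c' a') := by
  have : min _ (exitDist ε c a (cylinderMap ε c' a')) ≤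
      edist (cylinderMap ε c a) (cylinderMap ε c' a') :=
    min_cylinderDist_exitDist_le ε c a ⟨.inr c', cyl c' a'⟩
  simpa [cylinderDist, h] using this

theorem exitDist_le_torusMap (c : CylinderIndex) (e : TorusIndex) (a : Cov 2) (x : Cov 3) :
    exitDist ε c a (torusMap ε e x) ≤ edist (cylinderMap ε c a) (torusMap ε e x) := by
  have : min _ (exitDist ε c a (torusMap ε e x)) ≤ edist (cylinderMap ε c a) (torusMap ε e x) :=
    min_cylinderDist_exitDist_le ε c a ⟨.inl e, tor ε e x⟩
  simpa [cylinderDist] using this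

end TorusComplex
end

noncomputable section

/-! ### The torus complex is a compact connected length space -/

theorem edist_ne_top_of_connected {X : Type*} [PseudoEMetricSpace X] [PreconnectedSpace X]
    (x y : X) : edist x y ≠ ⊤ := by
  have h : IsClopen (Metric.eball x ⊤) := ⟨Metric.isClosed_eball_top, Metric.isOpen_eball⟩
  have hx : (Metric.eball x ⊤ : Set X).Nonempty := ⟨x, by simp⟩
  have := (h.eq_univ hx).ge (Set.mem_univ y)
  rw [Metric.mem_eball, edist_comm] at this
  exact this.ne

/-- The map of a piece to the glued space. -/
def Glued.of {ι : Type*} {X : ι → Type*} (r : (Σ i, X i) → (Σ i, X i) → Prop) (i : ι) (x : X i) :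
    Glued r := Quot.mk r ⟨i, x⟩

theorem Glued.lipschitzWith_of {ι : Type*} {X : ι → Type*} [∀ i, PseudoEMetricSpace (X i)]
    (r : (Σ i, X i) → (Σ i, X i) → Prop) (i : ι) : LipschitzWith 1 (Glued.of r i) := fun x y => by
  rw [ENNReal.coe_one, one_mul]
  exact Glued.edist_mk_le i x y

namespace TorusComplex

variable (ε : ℝ≥0)

theorem continuous_torusMap (e : TorusIndex) : Continuous (torusMap ε e) := by
  have h : Continuous (fun z : ThickTorus ε e => Glued.of (GlueRel ε) (.inl e) z) :=
    (Glued.lipschitzWith_of (GlueRel ε) (.inl e)).continuous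
  exact h.comp (Cov.continuous_proj _)

theorem continuous_cylinderMap (c : CylinderIndex) : Continuous (cylinderMap ε c) := by
  have h : Continuous (fun z : FlatCylinder c => Glued.of (GlueRel ε) (.inr c) z) :=
    (Glued.lipschitzWith_of (GlueRel ε) (.inr c)).continuous
  exact h.comp (Cov.continuous_proj _)

theorem exists_torusMap_eq_mk (e : TorusIndex) (z : ThickTorus ε e) :
    ∃ x : Cov 3, x.snd ∈ Set.Icc 0 (thickness ε e : ℝ) ∧
      torusMap ε e x = Quot.mk _ ⟨.inl e, z⟩ := by
  obtain ⟨x, hx, rfl⟩ := Cov.proj_surjective (NNReal.coe_nonneg (thickness ε e)) (torusPer_pos e) z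
  exact ⟨x, hx, rfl⟩

theorem exists_cylinderMap_eq_mk (c : CylinderIndex) (z : FlatCylinder c) :
    ∃ a : Cov 2, a.snd ∈ Set.Icc (0 : ℝ) 1 ∧ cylinderMap ε c a = Quot.mk _ ⟨.inr c, z⟩ := by
  obtain ⟨x, hx, rfl⟩ := Cov.proj_surjective zero_le_one (cylinderPer_pos c) z
  exact ⟨x, hx, rfl⟩

/-- Any point lies on a torus or in the interior of a cylinder. -/
theorem exists_eq_map (y : YSpace ε) :
    (∃ e x, x.snd ∈ Set.Icc 0 (thickness ε e : ℝ) ∧ y = torusMap ε e x) ∨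
      ∃ c a, a.snd ∈ Set.Ioo (0 : ℝ) 1 ∧ y = cylinderMap ε c a := by
  induction y using Quot.ind with | mk p =>
  obtain ⟨e | c, z⟩ := p
  · obtain ⟨x, hx, h⟩ := exists_torusMap_eq_mk ε e z
    exact .inl ⟨e, x, hx, h.symm⟩
  · obtain ⟨a, ha, h⟩ := exists_cylinderMap_eq_mk ε c z
    have hend : ∀ b, a.snd = endU b → ∃ e x, x.snd ∈ Set.Icc 0 (thickness ε e : ℝ) ∧
        cylinderMap ε c a = torusMap ε e x := fun b hb =>
      ⟨_, endCov ε c b (fun j => a.fst j), endCov_snd_mem _ _ _ _, by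
        rw [← cylinderMap_end, ← hb, Cov.mk_eta]⟩
    rcases ha.1.eq_or_lt with h0 | h0
    · obtain ⟨e, x, hx, hh⟩ := hend false h0.symm
      exact .inl ⟨e, x, hx, h.symm.trans hh⟩
    rcases ha.2.eq_or_lt with h1 | h1
    · obtain ⟨e, x, hx, hh⟩ := hend true h1
      exact .inl ⟨e, x, hx, h.symm.trans hh⟩
    exact .inr ⟨c, a, ⟨h0, h1⟩, h.symm⟩

/-- A relation that relates points in the same piece relates all points. -/
theorem rel_of_pieces {R : YSpace ε → YSpace ε → Prop} (hR : Equivalence R)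
    (hT : ∀ e x y, R (torusMap ε e x) (torusMap ε e y))
    (hC : ∀ c a a', R (cylinderMap ε c a) (cylinderMap ε c a')) (p q : YSpace ε) : R p q := by
  have hc : ∀ c, R (torusMap ε (endTorus c false) 0) (torusMap ε (endTorus c true) 0) := by
    intro c
    have h := hC c (Cov.mk 0 (endU false)) (Cov.mk 0 (endU true))
    rw [cylinderMap_end, cylinderMap_end] at h
    exact hR.trans (hT _ _ _) (hR.trans h (hT _ _ _))
  have h0 : ∀ g, R (torusMap ε .x 0) (torusMap ε (.e g 0) 0) := by
    intro g
    cases g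
    · exact hR.symm (hc (.cx false))
    · exact hc (.cx true)
  have he : ∀ e, R (torusMap ε .x 0) (torusMap ε e 0) := by
    rintro (_ | ⟨g, i⟩)
    · exact hR.refl _
    · have h1 := hR.trans (h0 g) (hc (.c g 0))
      have h2 := hR.trans h1 (hc (.c g 1))
      have h3 := hR.trans h2 (hc (.c g 2))
      fin_cases i
      exacts [h0 g, h1, h2, h3]
  have hx : ∀ p, R (torusMap ε .x 0) p := by
    intro p
    rcases exists_eq_map ε p with ⟨e, x, -, rfl⟩ | ⟨c, a, -, rfl⟩
    · exact hR.trans (he e) (hT _ _ _)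
    · have h := hC c (Cov.mk 0 (endU false)) a
      rw [cylinderMap_end] at h
      exact hR.trans (he _) (hR.trans (hT _ _ _) h)
  exact hR.trans (hR.symm (hx p)) (hx q)

instance : PathConnectedSpace (YSpace ε) where
  nonempty := ⟨torusMap ε .x 0⟩
  joined := by
    refine rel_of_pieces ε ⟨Joined.refl, Joined.symm, Joined.trans⟩ (fun e x y => ?_)
      (fun c x y => ?_)
    · exact (PathConnectedSpace.joined x y).map (continuous_torusMap ε e)
    · exact (PathConnectedSpace.joined x y).map (continuous_cylinderMap ε c)

instance : Finite TorusIndex :=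
  Finite.of_surjective (fun o : Option (Bool × Fin 4) => o.elim .x fun p => .e p.1 p.2) (by
    rintro (_ | ⟨g, i⟩)
    exacts [⟨none, rfl⟩, ⟨some (g, i), rfl⟩])

instance : Finite CylinderIndex :=
  Finite.of_surjective (fun o : Bool ⊕ (Bool × Fin 4) => o.elim .cx fun p => .c p.1 p.2) (by
    rintro (g | ⟨g, i⟩)
    exacts [⟨.inl g, rfl⟩, ⟨.inr (g, i), rfl⟩])

instance : CompactSpace (YSpace ε) := by
  have hT : ∀ e, IsCompact (Set.range (torusMap ε e)) := by
    intro e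
    have := compactSpace_flatPiece (w := thickness ε e) (torusPer_pos e)
    have h : Continuous (fun z : ThickTorus ε e => Glued.of (GlueRel ε) (.inl e) z) :=
      (Glued.lipschitzWith_of (GlueRel ε) (.inl e)).continuous
    convert isCompact_range h
    refine Set.Subset.antisymm ?_ ?_
    · rintro _ ⟨x, rfl⟩
      exact ⟨tor ε e x, rfl⟩
    · rintro _ ⟨z, rfl⟩
      obtain ⟨x, -, hx⟩ := exists_torusMap_eq_mk ε e z
      exact ⟨x, hx⟩
  have hC : ∀ c, IsCompact (Set.range (cylinderMap ε c)) := by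
    intro c
    have := compactSpace_flatPiece (w := 1) (cylinderPer_pos c)
    have h : Continuous (fun z : FlatCylinder c => Glued.of (GlueRel ε) (.inr c) z) :=
      (Glued.lipschitzWith_of (GlueRel ε) (.inr c)).continuous
    convert isCompact_range h
    refine Set.Subset.antisymm ?_ ?_
    · rintro _ ⟨x, rfl⟩
      exact ⟨cyl c x, rfl⟩
    · rintro _ ⟨z, rfl⟩
      obtain ⟨x, -, hx⟩ := exists_cylinderMap_eq_mk ε c z
      exact ⟨x, hx⟩
  have h := (isCompact_iUnion hT).union (isCompact_iUnion hC)
  refine ⟨h.of_isClosed_subset isClosed_univ fun y _ => ?_⟩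
  rcases exists_eq_map ε y with ⟨e, x, -, rfl⟩ | ⟨c, a, -, rfl⟩
  · exact .inl (Set.mem_iUnion.2 ⟨e, x, rfl⟩)
  · exact .inr (Set.mem_iUnion.2 ⟨c, a, rfl⟩)

variable {ε} in
theorem edist_ne_top (x y : YSpace ε) : edist x y ≠ ⊤ := edist_ne_top_of_connected x y

theorem le_edist_cyl {c : CylinderIndex} {a a' : Cov 2} (ha : a.snd ∈ Set.Icc (0 : ℝ) 1)
    (ha' : a'.snd ∈ Set.Icc (0 : ℝ) 1) :
    ENNReal.ofReal |a.snd - a'.snd| ≤ edist (cyl c a) (cyl c a') := by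
  rw [edist_dist]
  refine ENNReal.ofReal_le_ofReal (abs_le_of_sq_le_sq' ?_ dist_nonneg |>.2)
  unfold cyl
  rw [Cov.dist_proj_sq_of_mem _ ha ha', sq_abs]
  exact le_add_of_nonneg_left (Finset.sum_nonneg fun _ _ => sq_nonneg _)

/-- An interior point of a cylinder is far from the outside. -/
theorem le_exitDist {c : CylinderIndex} {a : Cov 2} (ha : a.snd ∈ Set.Icc (0 : ℝ) 1)
    (y : YSpace ε) : ENNReal.ofReal (min a.snd (1 - a.snd)) ≤ exitDist ε c a y := by
  refine le_iInf₂ fun b v => le_add_of_le_of_nonneg (le_trans ?_ (le_edist_cyl ha (endU_mem b)))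
    zero_le
  refine ENNReal.ofReal_le_ofReal ?_
  cases b
  · simpa [endU] using Or.inl (le_abs_self a.snd)
  · simp only [endU, Cov.mk_snd, if_true]
    rw [abs_sub_comm]
    exact (min_le_right _ _).trans (le_abs_self _)

theorem eq_of_edist_eq_zero (p q : YSpace ε) (h : edist p q = 0) : p = q := by
  have hone : ∀ {α : Type} [MetricSpace α] {x y : α}, min 1 (edist x y) ≤ 0 → x = y := by
    intro α _ x y hh
    rcases min_le_iff.1 hh with h' | h'
    · exact absurd h' (by simp)
    · exact edist_le_zero.1 h'
  have hmix : ∀ {c a} (y : YSpace ε), a.snd ∈ Set.Ioo (0 : ℝ) 1 →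
      ¬ exitDist ε c a y ≤ 0 := by
    intro c a y ha h'
    have h1 := (le_exitDist ε (c := c) ⟨ha.1.le, ha.2.le⟩ y).trans h'
    rw [nonpos_iff_eq_zero, ENNReal.ofReal_eq_zero] at h1
    exact absurd h1 (not_le.2 (lt_min ha.1 (by linarith [ha.2])))
  rcases exists_eq_map ε p with ⟨e, x, -, rfl⟩ | ⟨c, a, ha, rfl⟩ <;>
  rcases exists_eq_map ε q with ⟨e', x', -, rfl⟩ | ⟨c', a', ha', rfl⟩
  · by_cases he : e = e'
    · subst he
      have h1 := hone (h ▸ le_edist_torusMap ε e x x')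
      unfold torusMap
      rw [h1]
    · exact absurd (h ▸ one_le_edist_torusMap ε he x x') (by simp)
  · rw [edist_comm] at h
    exact absurd (h ▸ exitDist_le_torusMap ε c' e a' x) (hmix _ ha')
  · exact absurd (h ▸ exitDist_le_torusMap ε c e' a x') (hmix _ ha)
  · by_cases hc : c = c'
    · subst hc
      have h1 := hone (h ▸ le_edist_cylinderMap ε c a a')
      unfold cylinderMap
      rw [h1]
    · exact absurd (h ▸ exitDist_le_of_ne ε c c' hc a a') (hmix _ ha)

end TorusComplex
end

noncomputable section

/-! ### The radial retraction to a ball -/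

section radial

variable {E : Type*} [NormedAddCommGroup E] [InnerProductSpace ℝ E]

/-- The radial retraction to the ball of radius `R`. -/
def radial (R : ℝ) (d : E) : E := (min 1 (R / ‖d‖)) • d

theorem radial_of_le {R : ℝ} {d : E} (h : ‖d‖ ≤ R) : radial R d = d := by
  rcases eq_or_ne d 0 with rfl | hd
  · simp [radial]
  · rw [radial, min_eq_left ((one_le_div (norm_pos_iff.2 hd)).2 h), one_smul]

theorem norm_radial_le {R : ℝ} (hR : 0 ≤ R) (d : E) : ‖radial R d‖ ≤ R := by
  rcases eq_or_ne d 0 with rfl | hd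
  · simpa [radial] using hR
  have hd' := norm_pos_iff.2 hd
  have h0 : 0 ≤ min 1 (R / ‖d‖) := le_min zero_le_one (by positivity)
  rw [radial, norm_smul, Real.norm_of_nonneg h0]
  calc min 1 (R / ‖d‖) * ‖d‖ ≤ R / ‖d‖ * ‖d‖ := by gcongr; exact min_le_right _ _
    _ = R := by field_simp

/-- The obtuse angle property of the nearest point projection to a ball; applied to two points it
makes the projection 1-Lipschitz. -/
theorem inner_sub_radial_nonpos {R : ℝ} (hR : 0 ≤ R) (d z : E) (hz : ‖z‖ ≤ R) :
    inner ℝ (d - radial R d) (z - radial R d) ≤ 0 := by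
  rcases le_or_gt ‖d‖ R with h | h
  · rw [radial_of_le h, sub_self, inner_zero_left]
  · have hd : 0 < ‖d‖ := hR.trans_lt h
    have hk : min 1 (R / ‖d‖) = R / ‖d‖ := min_eq_right ((div_le_one hd).2 h.le)
    have e : d - radial R d = (1 - R / ‖d‖) • d := by rw [radial, hk, sub_smul, one_smul]
    rw [e, radial, hk, real_inner_smul_left, inner_sub_right, real_inner_smul_right,
      real_inner_self_eq_norm_sq]
    have h1 : R / ‖d‖ * ‖d‖ ^ 2 = R * ‖d‖ := by field_simp
    have h2 : inner ℝ d z ≤ ‖d‖ * R :=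
      (real_inner_le_norm d z).trans (mul_le_mul_of_nonneg_left hz hd.le)
    have h3 : R / ‖d‖ ≤ 1 := (div_le_one hd).2 h.le
    rw [h1]
    exact mul_nonpos_of_nonneg_of_nonpos (by linarith) (by linarith)

theorem norm_radial_sub_radial_le {R : ℝ} (hR : 0 ≤ R) (d d' : E) :
    ‖radial R d - radial R d'‖ ≤ ‖d - d'‖ := by
  have h1 := inner_sub_radial_nonpos hR d (radial R d') (norm_radial_le hR d')
  have h2 := inner_sub_radial_nonpos hR d' (radial R d) (norm_radial_le hR d)
  set x := radial R d
  set y := radial R d'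
  have h3 : ‖x - y‖ ^ 2 ≤ inner ℝ (d - d') (x - y) := by
    rw [← real_inner_self_eq_norm_sq]
    have e1 : inner ℝ (d - x) (y - x) = - inner ℝ (d - x) (x - y) := by
      rw [← inner_neg_right, neg_sub]
    have e2 : inner ℝ (d - d') (x - y) - inner ℝ (x - y) (x - y) =
      inner ℝ (d - x) (x - y) - inner ℝ (d' - y) (x - y) := by
      rw [← inner_sub_left, ← inner_sub_left]
      congr 1
      abel
    linarith
  have h4 := h3.trans (real_inner_le_norm _ _)
  rcases (norm_nonneg (x - y)).eq_or_lt with h0 | h0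
  · rw [← h0]; exact norm_nonneg _
  · rw [sq] at h4
    exact le_of_mul_le_mul_right h4 h0

end radial

/-- Convex sets in an inner product space, and their isometric images, have property CN. -/
theorem isCN_image {E Y : Type*} [NormedAddCommGroup E] [InnerProductSpace ℝ E]
    [PseudoEMetricSpace Y] {K : Set E} (hK : Convex ℝ K) (f : E → Y)
    (htop : ∀ x y : Y, edist x y ≠ ⊤)
    (hf : ∀ x ∈ K, ∀ y ∈ K, rdist (f x) (f y) = ‖x - y‖) : IsCN (f '' K) := by
  refine ⟨fun x _ y _ => htop x y, ?_⟩
  rintro _ ⟨p, hp, rfl⟩ _ ⟨q, hq, rfl⟩ s hs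
  have hm : (1 - s) • p + s • q ∈ K := hK hp hq (by linarith [hs.2]) hs.1 (by ring)
  refine ⟨f ((1 - s) • p + s • q), ⟨_, hm, rfl⟩, ?_⟩
  rintro _ ⟨z, hz, rfl⟩
  rw [hf _ hm _ hz, hf _ hp _ hz, hf _ hq _ hz, hf _ hp _ hq]
  have e1 : (1 - s) • p + s • q - z = (1 - s) • (p - z) + s • (q - z) := by module
  have e2 : p - q = (p - z) - (q - z) := by abel
  rw [e1, e2]
  generalize p - z = P
  generalize q - z = Q
  rw [@norm_add_sq_real, @norm_sub_sq_real, norm_smul, norm_smul, real_inner_smul_left,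
    real_inner_smul_right, mul_pow, mul_pow, Real.norm_eq_abs, Real.norm_eq_abs, sq_abs, sq_abs]
  -- In an inner product space the inequality of Bruhat and Tits is an identity.
  exact le_of_eq (by ring)

namespace TorusComplex

variable (ε : ℝ≥0)

/-! ### Local isometries -/

variable {ε} in
theorem rdist_triangle' (x y z : YSpace ε) : rdist x z ≤ rdist x y + rdist y z :=
  rdist_triangle (edist_ne_top _ _) (edist_ne_top _ _)

variable {ε} in
theorem rdist_le_ofReal {x y : YSpace ε} {r : ℝ} (hr : 0 ≤ r) (h : edist x y ≤ ENNReal.ofReal r) :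
    rdist x y ≤ r := ENNReal.toReal_le_of_le_ofReal hr h

theorem rdist_torusMap_le (e : TorusIndex) (x y : Cov 3) :
    rdist (torusMap ε e x) (torusMap ε e y) ≤ ‖x - y‖ := by
  refine rdist_le_ofReal (norm_nonneg _) ((edist_torusMap_le ε e x y).trans ?_)
  rw [edist_dist]
  exact ENNReal.ofReal_le_ofReal (Cov.dist_proj_le _ x y)

theorem rdist_cylinderMap_le (c : CylinderIndex) (x y : Cov 2) :
    rdist (cylinderMap ε c x) (cylinderMap ε c y) ≤ ‖x - y‖ := by
  refine rdist_le_ofReal (norm_nonneg _) ((edist_cylinderMap_le ε c x y).trans ?_)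
  rw [edist_dist]
  exact ENNReal.ofReal_le_ofReal (Cov.dist_proj_le _ x y)

theorem rdist_torusMap {e : TorusIndex} {x y : Cov 3}
    (hx : x.snd ∈ Set.Icc 0 (thickness ε e : ℝ)) (hy : y.snd ∈ Set.Icc 0 (thickness ε e : ℝ))
    (h : ‖x - y‖ ≤ 1 / 4) : rdist (torusMap ε e x) (torusMap ε e y) = ‖x - y‖ := by
  refine le_antisymm (rdist_torusMap_le ε e x y) ?_
  have h1 : dist (tor ε e x) (tor ε e y) = ‖x - y‖ := Cov.dist_proj_eq _ hx hy (torusPer_pos e)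
    fun j => (Cov.abs_fst_le (x - y) j).trans (by linarith [lt_torusPer e j])
  have h2 := le_edist_torusMap ε e x y
  rw [min_eq_right (by rw [edist_dist, h1]; exact ENNReal.ofReal_le_one.2 (by linarith)),
    edist_dist, h1] at h2
  exact (ENNReal.ofReal_le_iff_le_toReal (edist_ne_top _ _)).1 h2

theorem rdist_cylinderMap {c : CylinderIndex} {x y : Cov 2}
    (hx : x.snd ∈ Set.Icc (0 : ℝ) 1) (hy : y.snd ∈ Set.Icc (0 : ℝ) 1)
    (h : ‖x - y‖ ≤ 1 / 4) : rdist (cylinderMap ε c x) (cylinderMap ε c y) = ‖x - y‖ := by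
  refine le_antisymm (rdist_cylinderMap_le ε c x y) ?_
  have h1 : dist (cyl c x) (cyl c y) = ‖x - y‖ := Cov.dist_proj_eq _ hx hy (cylinderPer_pos c)
    fun j => (Cov.abs_fst_le (x - y) j).trans (by linarith [lt_cylinderPer c j])
  have h2 := le_edist_cylinderMap ε c x y
  rw [min_eq_right (by rw [edist_dist, h1]; exact ENNReal.ofReal_le_one.2 (by linarith)),
    edist_dist, h1] at h2
  exact (ENNReal.ofReal_le_iff_le_toReal (edist_ne_top _ _)).1 h2

theorem exists_torusMap_eq {e : TorusIndex} {x z : Cov 3} {r : ℝ}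
    (hx : x.snd ∈ Set.Icc 0 (thickness ε e : ℝ)) (hr : r ≤ 1)
    (h : rdist (torusMap ε e x) (torusMap ε e z) < r) :
    ∃ y : Cov 3, y.snd ∈ Set.Icc 0 (thickness ε e : ℝ) ∧ tor ε e y = tor ε e z ∧ ‖x - y‖ < r := by
  obtain ⟨y, hy, e1, e2⟩ := Cov.exists_proj_eq (NNReal.coe_nonneg (thickness ε e)) (torusPer_pos e)
    hx (tor ε e z)
  refine ⟨y, hy, e1, ?_⟩
  have h2 := (ENNReal.toReal_mono (edist_ne_top _ _) (le_edist_torusMap ε e x z)).trans_lt h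
  rw [edist_dist, ← ENNReal.ofReal_one, ← ENNReal.ofReal_min,
    ENNReal.toReal_ofReal (le_min zero_le_one dist_nonneg)] at h2
  rw [e2]
  exact (min_lt_iff.1 h2).resolve_left (by linarith)

theorem exists_cylinderMap_eq {c : CylinderIndex} {x z : Cov 2} {r : ℝ}
    (hx : x.snd ∈ Set.Icc (0 : ℝ) 1) (hr : r ≤ 1)
    (h : rdist (cylinderMap ε c x) (cylinderMap ε c z) < r) :
    ∃ y : Cov 2, y.snd ∈ Set.Icc (0 : ℝ) 1 ∧ cyl c y = cyl c z ∧ ‖x - y‖ < r := by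
  obtain ⟨y, hy, e1, e2⟩ := Cov.exists_proj_eq zero_le_one (cylinderPer_pos c) hx (cyl c z)
  refine ⟨y, hy, e1, ?_⟩
  have h2 := (ENNReal.toReal_mono (edist_ne_top _ _) (le_edist_cylinderMap ε c x z)).trans_lt h
  rw [edist_dist, ← ENNReal.ofReal_one, ← ENNReal.ofReal_min,
    ENNReal.toReal_ofReal (le_min zero_le_one dist_nonneg)] at h2
  rw [e2]
  exact (min_lt_iff.1 h2).resolve_left (by linarith)

theorem torusMap_eq_iff {e : TorusIndex} {x y : Cov 3}
    (hx : x.snd ∈ Set.Icc 0 (thickness ε e : ℝ)) (hy : y.snd ∈ Set.Icc 0 (thickness ε e : ℝ)) :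
    torusMap ε e x = torusMap ε e y ↔ ∃ m, y = Cov.shift (torusPer e) m x := by
  rw [← Cov.proj_eq_iff (NNReal.coe_nonneg (thickness ε e)) hx hy]
  refine ⟨fun h => ?_, fun h => congrArg (fun z => (Quot.mk _ ⟨.inl e, z⟩ : YSpace ε)) h⟩
  have h1 := le_edist_torusMap ε e x y
  rw [h, edist_self] at h1
  rcases min_le_iff.1 h1 with h' | h'
  · exact absurd h' (by simp)
  · exact edist_le_zero.1 h'

theorem cylinderMap_eq_iff {c : CylinderIndex} {x y : Cov 2}
    (hx : x.snd ∈ Set.Icc (0 : ℝ) 1) (hy : y.snd ∈ Set.Icc (0 : ℝ) 1) :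
    cylinderMap ε c x = cylinderMap ε c y ↔ ∃ m, y = Cov.shift (cylinderPer c) m x := by
  rw [← Cov.proj_eq_iff zero_le_one hx hy]
  refine ⟨fun h => ?_, fun h => congrArg (fun z => (Quot.mk _ ⟨.inr c, z⟩ : YSpace ε)) h⟩
  have h1 := le_edist_cylinderMap ε c x y
  rw [h, edist_self] at h1
  rcases min_le_iff.1 h1 with h' | h'
  · exact absurd h' (by simp)
  · exact edist_le_zero.1 h'

theorem torusMap_congr {e : TorusIndex} {x y : Cov 3} (h : tor ε e x = tor ε e y) :
    torusMap ε e x = torusMap ε e y := by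
  unfold torusMap; rw [h]

theorem cylinderMap_congr {c : CylinderIndex} {x y : Cov 2} (h : cyl c x = cyl c y) :
    cylinderMap ε c x = cylinderMap ε c y := by
  unfold cylinderMap; rw [h]

theorem torusMap_shift (e : TorusIndex) (m : Fin 3 → ℤ) (x : Cov 3) :
    torusMap ε e (Cov.shift (torusPer e) m x) = torusMap ε e x :=
  torusMap_congr ε (Cov.proj_shift _ m x)

theorem cylinderMap_shift (c : CylinderIndex) (m : Fin 2 → ℤ) (x : Cov 2) :
    cylinderMap ε c (Cov.shift (cylinderPer c) m x) = cylinderMap ε c x :=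
  cylinderMap_congr ε (Cov.proj_shift _ m x)

theorem endU_eq_of_abs_lt {b b' : Bool} (h : |endU b - endU b'| < 1) : b = b' := by
  cases b <;> cases b' <;> simp_all [endU]

/-- Lower bound for the distance from a point of a cylinder to an outside point. -/
theorem le_rdist_of_exit {c : CylinderIndex} {a : Cov 2} (ha : a.snd ∈ Set.Icc (0 : ℝ) 1)
    {p : YSpace ε} (hp : exitDist ε c a p ≤ edist (cylinderMap ε c a) p) {t : ℝ}
    (h : ∀ b (a' : Cov 2), a'.snd = endU b → t ≤ ‖a - a'‖ + rdist (cylinderMap ε c a') p) :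
    t ≤ rdist (cylinderMap ε c a) p := by
  refine (ENNReal.ofReal_le_iff_le_toReal (edist_ne_top _ _)).1 (le_trans ?_ hp)
  refine le_iInf₂ fun b v => ?_
  obtain ⟨a', ha', e1, e2⟩ := Cov.exists_proj_eq zero_le_one (cylinderPer_pos c) ha
    (cyl c (Cov.mk v (endU b)))
  have hs : a'.snd = endU b := by
    obtain ⟨m, hm⟩ := (Cov.proj_eq_iff zero_le_one ha' (by exact endU_mem b)).1 e1
    have := congrArg (fun z : Cov 2 => z.snd) hm
    exact this.symm
  have h1 := h b a' hs
  rw [e2, cylinderMap_congr ε e1] at h1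
  rw [edist_dist, edist_eq_ofReal_rdist (edist_ne_top (ε := ε) _ _),
    ← ENNReal.ofReal_add dist_nonneg (rdist_nonneg _ _)]
  exact ENNReal.ofReal_le_ofReal h1

/-! ### Flaps -/

/-- The linear part of the gluing map of an end of a cylinder. -/
def endLin (c : CylinderIndex) (b : Bool) (d : Cov 2) : Cov 3 :=
  Cov.mk (endMap c b (d.fst 0) (d.fst 1)) 0

theorem endLin_smul (c : CylinderIndex) (b : Bool) (k : ℝ) (d : Cov 2) :
    endLin c b (k • d) = k • endLin c b d := by
  refine Cov.ext' (fun j => ?_) (mul_zero k).symm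
  exact congrFun (endMap_smul c b _ _ _) j

theorem sum_sq_endMap (c : CylinderIndex) (b : Bool) (s t : ℝ) :
    ∑ j, endMap c b s t j ^ 2 = s ^ 2 + t ^ 2 := by
  have h : ∀ x : ℝ, (x / √2) ^ 2 = x ^ 2 / 2 := fun x => by
    rw [div_pow, Real.sq_sqrt (by norm_num)]
  rw [Fin.sum_univ_three]
  rcases c with g | ⟨g, i⟩
  · cases g <;> cases b <;> simp [endMap, h]
  · cases b <;> fin_cases i <;> simp [endMap, h]

theorem norm_endLin (c : CylinderIndex) (b : Bool) {d : Cov 2} (hd : d.snd = 0) :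
    ‖endLin c b d‖ = ‖d‖ := by
  rw [← sq_eq_sq₀ (norm_nonneg _) (norm_nonneg _), Cov.norm_sq, Cov.norm_sq, hd, Fin.sum_univ_two]
  exact congrArg₂ _ (sum_sq_endMap c b _ _) rfl

theorem endLin_radial (c : CylinderIndex) (b : Bool) (R : ℝ) {d : Cov 2} (hd : d.snd = 0) :
    endLin c b (radial R d) = radial R (endLin c b d) := by
  rw [radial, radial, endLin_smul, norm_endLin c b hd]

/-- A cylinder one end of which passes through a point of a torus. -/
structure Flap (e : TorusIndex) (x₀ : Cov 3) where
  c : CylinderIndex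
  b : Bool
  a₀ : Cov 2
  endTorus_eq : endTorus c b = e
  snd_eq : a₀.snd = endU b
  map_eq : cylinderMap ε c a₀ = torusMap ε e x₀

/-- The ball in the covering of a torus, in the torus complex. -/
def torusPart (e : TorusIndex) (x₀ : Cov 3) (R : ℝ) : Set (YSpace ε) :=
  torusMap ε e '' {x | x.snd ∈ Set.Icc 0 (thickness ε e : ℝ) ∧ ‖x - x₀‖ ≤ R}

namespace Flap

variable {ε} {e : TorusIndex} {x₀ : Cov 3} (F : Flap ε e x₀)

/-- The half ball in the covering of the cylinder, in the torus complex. -/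
def part (R : ℝ) : Set (YSpace ε) :=
  cylinderMap ε F.c '' {a | a.snd ∈ Set.Icc (0 : ℝ) 1 ∧ ‖a - F.a₀‖ ≤ R}

/-- The inclusion of the end of the cylinder. -/
def cov (a : Cov 2) : Cov 3 := x₀ + endLin F.c F.b (a - F.a₀)

theorem snd_mem : F.a₀.snd ∈ Set.Icc (0 : ℝ) 1 := F.snd_eq ▸ endU_mem _

theorem cov_snd (a : Cov 2) : (F.cov a).snd = x₀.snd := add_zero _

theorem map_cov (hx₀ : x₀.snd ∈ Set.Icc 0 (thickness ε e : ℝ)) {a : Cov 2}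
    (ha : a.snd = endU F.b) : torusMap ε e (F.cov a) = cylinderMap ε F.c a := by
  obtain ⟨c, b, a₀, rfl, h0, h1⟩ := F
  have h2 : ∀ a : Cov 2, a.snd = endU b → cylinderMap ε c a =
      torusMap ε (endTorus c b) (endCov ε c b fun j => a.fst j) := fun a ha => by
    rw [← cylinderMap_end, ← ha, Cov.mk_eta]
  rw [h2 a₀ h0, eq_comm, torusMap_eq_iff ε hx₀ (endCov_snd_mem _ _ _ _)] at h1
  obtain ⟨m, hm⟩ := h1
  simp only at ha
  rw [h2 a ha, ← torusMap_shift ε _ m]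
  congr 1
  refine Cov.ext' (fun j => ?_) ?_
  · have e1 := congrArg (fun z : Cov 3 => z.fst j) hm
    have e2 := congrFun (endMap_sub c b (a.fst 0) (a.fst 1) (a₀.fst 0) (a₀.fst 1)) j
    simp only [endCov, Cov.mk_fst, Cov.shift_fst, Pi.sub_apply] at e1 e2
    change x₀.fst j + endMap c b (a.fst 0 - a₀.fst 0) (a.fst 1 - a₀.fst 1) j + _ =
      endMap c b (a.fst 0) (a.fst 1) j
    linarith
  · have e1 := congrArg (fun z : Cov 3 => z.snd) hm
    exact (add_zero _).trans e1.symm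

theorem norm_cov_sub_base {a : Cov 2} (h : a.snd = endU F.b) :
    ‖F.cov a - x₀‖ = ‖a - F.a₀‖ := by
  rw [cov, add_sub_cancel_left]
  exact norm_endLin _ _ (sub_eq_zero.2 (h.trans F.snd_eq.symm))

theorem cov_radial (R : ℝ) {a : Cov 2} (ha : a.snd = endU F.b) :
    F.cov (F.a₀ + radial R (a - F.a₀)) = x₀ + radial R (F.cov a - x₀) := by
  rw [cov, cov, add_sub_cancel_left, add_sub_cancel_left, endLin_radial]
  exact sub_eq_zero.2 (ha.trans F.snd_eq.symm)

theorem radial_snd_eq (R : ℝ) {a : Cov 2} (ha : a.snd = endU F.b) :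
    (F.a₀ + radial R (a - F.a₀)).snd = endU F.b := by
  change F.a₀.snd + min 1 (R / ‖a - F.a₀‖) * (a.snd - F.a₀.snd) = _
  rw [ha, F.snd_eq, sub_self, mul_zero, add_zero]

end Flap

/-- The radial retraction of the torus does not increase the distance from `p`. -/
def Inward (e : TorusIndex) (x₀ : Cov 3) (R : ℝ) (p : YSpace ε) : Prop :=
  ∀ x : Cov 3, x.snd ∈ Set.Icc 0 (thickness ε e : ℝ) → ‖x - x₀‖ ≤ 5 / 32 →
    rdist p (torusMap ε e (x₀ + radial R (x - x₀))) ≤ rdist p (torusMap ε e x)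

theorem norm_radial_sub_le {E : Type*} [NormedAddCommGroup E] [InnerProductSpace ℝ E] {R : ℝ}
    (hR : 0 ≤ R) (o x y : E) : ‖(o + radial R (x - o)) - (o + radial R (y - o))‖ ≤ ‖x - y‖ := by
  rw [add_sub_add_left_eq_sub]
  exact (norm_radial_sub_radial_le hR _ _).trans_eq (by rw [sub_sub_sub_cancel_right])

variable {ε}

theorem inward_of_mem_torusPart {e : TorusIndex} {x₀ : Cov 3} {R : ℝ} (hR : 0 ≤ R)
    (hR' : R ≤ 1 / 32) {p : YSpace ε} (hp : p ∈ torusPart ε e x₀ R) : Inward ε e x₀ R p := by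
  obtain ⟨x', ⟨hx', hn⟩, rfl⟩ := hp
  intro x hx hxn
  have e1 : x' = x₀ + radial R (x' - x₀) := by rw [radial_of_le hn]; abel
  have h1 : ‖x' - x‖ ≤ 1 / 4 := by
    have := norm_sub_le (x' - x₀) (x - x₀)
    rw [sub_sub_sub_cancel_right] at this
    linarith
  rw [rdist_torusMap ε hx' hx h1]
  refine (rdist_torusMap_le ε e _ _).trans ?_
  conv_lhs => rw [e1]
  exact norm_radial_sub_le hR x₀ x' x

theorem norm_add_radial_sub_le {E : Type*} [NormedAddCommGroup E] [InnerProductSpace ℝ E] {R : ℝ}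
    (hR : 0 ≤ R) {o x : E} (hx : ‖x - o‖ ≤ R) (y : E) : ‖x - (o + radial R (y - o))‖ ≤ ‖x - y‖ := by
  have e1 : x = o + radial R (x - o) := by rw [radial_of_le hx]; abel
  conv_lhs => rw [e1]
  exact norm_radial_sub_le hR o x y

/-- The way from `p` to `x` leaves the cylinder at some end point `a'`. If `a'` is at distance at
least `1 / 16 ≥ 2 R` from `p`, the way over the centre `x₀` to the retracted point is no longer.
Otherwise `a'` lies on the end of the flap, and retracting `a'` together with `x` shortens both
parts of the way. -/
theorem Flap.inward {e : TorusIndex} {x₀ : Cov 3} (hx₀ : x₀.snd ∈ Set.Icc 0 (thickness ε e : ℝ))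
    (F : Flap ε e x₀) {R : ℝ} (hR : 0 ≤ R)
    (hR' : R ≤ 1 / 32) {p : YSpace ε} (hp : p ∈ F.part R) : Inward ε e x₀ R p := by
  obtain ⟨a, ⟨ha, han⟩, rfl⟩ := hp
  intro x hx hxn
  refine le_rdist_of_exit ε ha (exitDist_le_torusMap ε _ _ _ _) fun b a' ha' => ?_
  have hp0 : rdist (cylinderMap ε F.c a) (torusMap ε e x₀) ≤ R := by
    rw [← F.map_eq]; exact (rdist_cylinderMap_le ε _ _ _).trans han
  have hr0 : rdist (torusMap ε e x₀) (torusMap ε e (x₀ + radial R (x - x₀))) ≤ R := by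
    refine (rdist_torusMap_le ε _ _ _).trans ?_
    rw [sub_add_cancel_left, norm_neg]
    exact norm_radial_le hR _
  rcases le_or_gt (1 / 16) ‖a - a'‖ with hfar | hnear
  · have := rdist_triangle' (cylinderMap ε F.c a) (torusMap ε e x₀)
      (torusMap ε e (x₀ + radial R (x - x₀)))
    linarith [rdist_nonneg (cylinderMap ε F.c a') (torusMap ε e x)]
  · have haa : ‖a' - F.a₀‖ ≤ 1 / 16 + R := by
      have := norm_sub_le (a - F.a₀) (a - a')
      rw [sub_sub_sub_cancel_left] at this
      linarith
    have hb : b = F.b := by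
      refine endU_eq_of_abs_lt ?_
      rw [← ha', ← F.snd_eq]
      exact (Cov.abs_snd_le (a' - F.a₀)).trans_lt (by linarith)
    subst hb
    have e1 := F.map_cov hx₀ ha'
    have e2 := F.map_cov hx₀ (F.radial_snd_eq R ha')
    rw [F.cov_radial R ha'] at e2
    have h1 : ‖F.cov a' - x₀‖ = ‖a' - F.a₀‖ := F.norm_cov_sub_base ha'
    have h2 : ‖F.cov a' - x‖ ≤ 1 / 4 := by
      have := norm_sub_le (F.cov a' - x₀) (x - x₀)
      rw [sub_sub_sub_cancel_right] at this
      linarith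
    rw [← e1, rdist_torusMap ε (by rw [F.cov_snd]; exact hx₀) hx h2]
    refine (rdist_triangle' _ (torusMap ε e (x₀ + radial R (F.cov a' - x₀))) _).trans
      (add_le_add ?_ ((rdist_torusMap_le ε e _ _).trans (norm_radial_sub_le hR x₀ _ _)))
    rw [e2]
    exact (rdist_cylinderMap_le ε _ _ _).trans (norm_add_radial_sub_le hR han _)

theorem continuous_rdist (p : YSpace ε) : Continuous fun y : YSpace ε => rdist p y := by
  refine continuous_iff_continuousAt.2 fun y => ?_
  exact (ENNReal.continuousAt_toReal (edist_ne_top p y)).comp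
    (f := fun y => edist p y) (continuous_const.edist continuous_id).continuousAt

/-- Points on different sides of the end of a cylinder are joined through this end. -/
theorem Flap.exists_bridge {e : TorusIndex} {x₀ : Cov 3}
    (hx₀ : x₀.snd ∈ Set.Icc 0 (thickness ε e : ℝ)) (F : Flap ε e x₀) {R : ℝ} (hR : 0 ≤ R)
    (hR' : R ≤ 1 / 32) {p : YSpace ε} (hexit : ∀ a, exitDist ε F.c a p ≤
      edist (cylinderMap ε F.c a) p)
    (hin : Inward ε e x₀ R p) (hp : rdist p (torusMap ε e x₀) ≤ R) {a : Cov 2}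
    (ha : a.snd ∈ Set.Icc (0 : ℝ) 1) (han : ‖a - F.a₀‖ ≤ R) :
    ∃ a' : Cov 2, a'.snd = endU F.b ∧ ‖a' - F.a₀‖ ≤ R ∧
      rdist p (cylinderMap ε F.c a) =
        rdist p (cylinderMap ε F.c a') + rdist (cylinderMap ε F.c a') (cylinderMap ε F.c a) := by
  have hK : IsCompact {a' : Cov 2 | a'.snd = endU F.b ∧ ‖a' - F.a₀‖ ≤ R} := by
    have : {a' : Cov 2 | a'.snd = endU F.b ∧ ‖a' - F.a₀‖ ≤ R} =
        {a' : Cov 2 | a'.snd = endU F.b} ∩ Metric.closedBall F.a₀ R := by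
      ext a'; simp [dist_eq_norm]
    rw [this]
    have hc : Continuous fun a' : Cov 2 => a'.snd :=
      continuous_snd.comp (WithLp.prod_continuous_ofLp 2 _ _)
    exact (isCompact_closedBall F.a₀ R).inter_left (isClosed_eq hc continuous_const)
  have hcont : Continuous fun a' : Cov 2 => ‖a - a'‖ + rdist p (cylinderMap ε F.c a') :=
    (continuous_const.sub continuous_id).norm.add
      ((continuous_rdist p).comp (continuous_cylinderMap ε F.c))
  -- The bridge point minimizes the length of the way through the disc of radius `R` in the end. It
  -- has to be compared with ways that leave the cylinder outside the disc.
  obtain ⟨a', ⟨ha', hn⟩, hmin⟩ := hK.exists_isMinOn ⟨F.a₀, F.snd_eq, by simpa using hR⟩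
    hcont.continuousOn
  refine ⟨a', ha', hn, ?_⟩
  have hmin' : ∀ a'' : Cov 2, a''.snd = endU F.b → ‖a'' - F.a₀‖ ≤ R →
    ‖a - a'‖ + rdist p (cylinderMap ε F.c a') ≤ ‖a - a''‖ + rdist p (cylinderMap ε F.c a'') :=
    fun a'' h1 h2 => hmin ⟨h1, h2⟩
  have haa : ‖a' - a‖ ≤ 1 / 4 := by
    have := norm_sub_le (a' - F.a₀) (a - F.a₀)
    rw [sub_sub_sub_cancel_right] at this
    linarith
  refine le_antisymm (rdist_triangle' _ _ _) ?_
  rw [rdist_cylinderMap ε (by rw [ha']; exact endU_mem _) ha haa,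
    rdist_comm p (cylinderMap ε F.c a),
    norm_sub_rev, add_comm]
  refine le_rdist_of_exit ε ha (hexit a) fun b a'' ha'' => ?_
  -- A far exit is no better than the centre, through which the way has length at most `2 R`. A near
  -- exit is retracted radially into the disc, which lengthens neither part by the contraction of
  -- the retraction and by `Inward`; the radius `5 / 32` there is `1 / 8 + 1 / 32`.
  rcases le_or_gt (1 / 8) ‖a - a''‖ with hfar | hnear
  · have := hmin' F.a₀ F.snd_eq (by simpa using hR)
    rw [F.map_eq] at this
    linarith [rdist_nonneg (cylinderMap ε F.c a'') p]
  · have haa : ‖a'' - F.a₀‖ ≤ 5 / 32 := by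
      have := norm_sub_le (a - F.a₀) (a - a'')
      rw [sub_sub_sub_cancel_left] at this
      linarith
    have hb : b = F.b := by
      refine endU_eq_of_abs_lt ?_
      rw [← ha'', ← F.snd_eq]
      exact (Cov.abs_snd_le (a'' - F.a₀)).trans_lt (by linarith)
    subst hb
    refine (hmin' (F.a₀ + radial R (a'' - F.a₀)) (F.radial_snd_eq R ha'')
      (by rw [add_sub_cancel_left]; exact norm_radial_le hR _)).trans
      (add_le_add (norm_add_radial_sub_le hR han _) ?_)
    have h1 : ‖F.cov a'' - x₀‖ = ‖a'' - F.a₀‖ := F.norm_cov_sub_base ha''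
    have h2 := hin (F.cov a'') (by rw [F.cov_snd]; exact hx₀) (h1.trans_le haa)
    rw [← F.cov_radial R ha'', F.map_cov hx₀ (F.radial_snd_eq R ha''), F.map_cov hx₀ ha''] at h2
    rwa [rdist_comm _ p]

end TorusComplex
end

noncomputable section

namespace TorusComplex

variable {ε : ℝ≥0}

/-! ### Non-positive curvature of the torus complex -/

theorem convex_snd_ball {n : ℕ} (u v R : ℝ) (o : Cov n) :
    Convex ℝ {x : Cov n | x.snd ∈ Set.Icc u v ∧ ‖x - o‖ ≤ R} := by
  intro x hx y hy s t hs ht hst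
  refine ⟨?_, ?_⟩
  · exact convex_Icc u v hx.1 hy.1 hs ht hst
  · have := convex_closedBall o R (x := x) (by simpa [dist_eq_norm] using hx.2)
      (y := y) (by simpa [dist_eq_norm] using hy.2) hs ht hst
    simpa [dist_eq_norm] using this

theorem isCN_torusPart (e : TorusIndex) (x₀ : Cov 3) {R : ℝ} (hR : R ≤ 1 / 8) :
    IsCN (torusPart ε e x₀ R) := by
  refine isCN_image (convex_snd_ball _ _ _ _) _ edist_ne_top fun x hx y hy => ?_
  refine rdist_torusMap ε hx.1 hy.1 ?_
  have := norm_sub_le (x - x₀) (y - x₀)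
  rw [sub_sub_sub_cancel_right] at this
  linarith [hx.2, hy.2]

theorem isCN_cylinderPart (c : CylinderIndex) (a₀ : Cov 2) {R : ℝ} (hR : R ≤ 1 / 8) :
    IsCN (cylinderMap ε c '' {a | a.snd ∈ Set.Icc (0 : ℝ) 1 ∧ ‖a - a₀‖ ≤ R}) := by
  refine isCN_image (convex_snd_ball _ _ _ _) _ edist_ne_top fun x hx y hy => ?_
  refine rdist_cylinderMap ε hx.1 hy.1 ?_
  have := norm_sub_le (x - a₀) (y - a₀)
  rw [sub_sub_sub_cancel_right] at this
  linarith [hx.2, hy.2]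

theorem cnPoint_of_rdist_le {B : Set (YSpace ε)} (hB : IsCN B) {p q m : YSpace ε} (hp : p ∈ B)
    (hq : q ∈ B) (hm : m ∈ B) {s : ℝ} (hs : s ∈ Set.Icc (0 : ℝ) 1)
    (h₁ : rdist p m ≤ s * rdist p q) (h₂ : rdist q m ≤ (1 - s) * rdist p q) :
    CNPoint B p q m s := by
  obtain ⟨m', hm', h⟩ := hB.exists_point p hp q hq s hs
  have h0 := h.rdist_eq_zero hm hs h₁ h₂
  have : edist m' m = 0 := by
    rw [edist_eq_ofReal_rdist (edist_ne_top _ _), h0, ENNReal.ofReal_zero]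
  rwa [← eq_of_edist_eq_zero ε _ _ this]

/-- The union of a ball in a torus with half balls in cylinders that end there. -/
theorem isCN_torusPart_union {e : TorusIndex} {x₀ : Cov 3}
    (hx₀ : x₀.snd ∈ Set.Icc 0 (thickness ε e : ℝ)) {R : ℝ} (hR : 0 ≤ R) (hR' : R ≤ 1 / 32)
    {ι : Type} (F : ι → Flap ε e x₀) (hF : ∀ i j, (F i).c = (F j).c → i = j) (s : Finset ι) :
    IsCN (torusPart ε e x₀ R ∪ ⋃ i ∈ s, (F i).part R) := by
  classical
  induction s using Finset.induction_on with
  | empty => simpa using isCN_torusPart e x₀ (by linarith)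
  | insert i s his ih =>
    rw [Finset.set_biUnion_insert, Set.union_comm ((F i).part R), ← Set.union_assoc]
    have hpart : IsCN ((F i).part R) := isCN_cylinderPart _ _ (by linarith)
    refine GluePair.isCN_union (A := cylinderMap ε (F i).c ''
      {a | a.snd = endU (F i).b ∧ ‖a - (F i).a₀‖ ≤ R}) ?_
    have hl : cylinderMap ε (F i).c '' {a | a.snd = endU (F i).b ∧ ‖a - (F i).a₀‖ ≤ R} ⊆
        torusPart ε e x₀ R ∪ ⋃ i ∈ s, (F i).part R := by
      rintro _ ⟨a, ⟨ha, hn⟩, rfl⟩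
      refine .inl ⟨(F i).cov a, ⟨by rw [Flap.cov_snd]; exact hx₀, ?_⟩, (F i).map_cov hx₀ ha⟩
      rwa [(F i).norm_cov_sub_base ha]
    have hr : cylinderMap ε (F i).c '' {a | a.snd = endU (F i).b ∧ ‖a - (F i).a₀‖ ≤ R} ⊆
        (F i).part R := by
      rintro _ ⟨a, ⟨ha, hn⟩, rfl⟩
      exact ⟨a, ⟨by rw [ha]; exact endU_mem _, hn⟩, rfl⟩
    refine ⟨edist_ne_top, ih, hpart, hl, hr, ?_, ?_⟩
    · rintro _ ⟨a, ⟨ha, hn⟩, rfl⟩ _ ⟨a', ⟨ha', hn'⟩, rfl⟩ t ht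
      have hmem : ((1 - t) • a + t • a').snd = endU (F i).b := by
        change (1 - t) * a.snd + t * a'.snd = _
        rw [ha, ha']; ring
      have hball : ‖(1 - t) • a + t • a' - (F i).a₀‖ ≤ R := by
        have e1 : (1 - t) • a + t • a' - (F i).a₀ =
          (1 - t) • (a - (F i).a₀) + t • (a' - (F i).a₀) := by module
        rw [e1]
        refine (norm_add_le _ _).trans ?_
        rw [norm_smul, norm_smul, Real.norm_of_nonneg ht.1,
          Real.norm_of_nonneg (sub_nonneg.2 ht.2)]
        nlinarith [ht.1, ht.2]
      have hA : cylinderMap ε (F i).c ((1 - t) • a + t • a') ∈ cylinderMap ε (F i).c ''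
        {a | a.snd = endU (F i).b ∧ ‖a - (F i).a₀‖ ≤ R} := ⟨_, ⟨hmem, hball⟩, rfl⟩
      have haa : ‖a - a'‖ ≤ 1 / 4 := by
        have := norm_sub_le (a - (F i).a₀) (a' - (F i).a₀)
        rw [sub_sub_sub_cancel_right] at this
        linarith
      have h0 : rdist (cylinderMap ε (F i).c a) (cylinderMap ε (F i).c a') = ‖a - a'‖ :=
        rdist_cylinderMap ε (by rw [ha]; exact endU_mem _) (by rw [ha']; exact endU_mem _) haa
      have h1 : rdist (cylinderMap ε (F i).c a) (cylinderMap ε (F i).c ((1 - t) • a + t • a')) ≤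
          t * rdist (cylinderMap ε (F i).c a) (cylinderMap ε (F i).c a') := by
        refine (rdist_cylinderMap_le ε _ _ _).trans ?_
        have e1 : a - ((1 - t) • a + t • a') = t • (a - a') := by module
        rw [e1, norm_smul, Real.norm_of_nonneg ht.1, h0]
      have h2 : rdist (cylinderMap ε (F i).c a') (cylinderMap ε (F i).c ((1 - t) • a + t • a')) ≤
          (1 - t) * rdist (cylinderMap ε (F i).c a) (cylinderMap ε (F i).c a') := by
        refine (rdist_cylinderMap_le ε _ _ _).trans ?_
        have e1 : a' - ((1 - t) • a + t • a') = (1 - t) • (a' - a) := by module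
        rw [e1, norm_smul, Real.norm_of_nonneg (sub_nonneg.2 ht.2), h0, norm_sub_rev]
      have hp : cylinderMap ε (F i).c a ∈ cylinderMap ε (F i).c ''
        {a | a.snd = endU (F i).b ∧ ‖a - (F i).a₀‖ ≤ R} := ⟨_, ⟨ha, hn⟩, rfl⟩
      have hq : cylinderMap ε (F i).c a' ∈ cylinderMap ε (F i).c ''
        {a | a.snd = endU (F i).b ∧ ‖a - (F i).a₀‖ ≤ R} := ⟨_, ⟨ha', hn'⟩, rfl⟩
      exact ⟨_, hA, cnPoint_of_rdist_le ih (hl hp) (hl hq) (hl hA) ht h1 h2,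
        cnPoint_of_rdist_le hpart (hr hp) (hr hq) (hr hA) ht h1 h2⟩
    · rintro p hp _ ⟨a, ⟨ha, hn⟩, rfl⟩
      -- For the induction step, `p` lies in the torus or in another cylinder. Either way the
      -- cylinder of `F i` can be left only through its ends, and the radial retraction brings the
      -- torus closer to `p`.
      have key : (∀ a, exitDist ε (F i).c a p ≤ edist (cylinderMap ε (F i).c a) p) ∧
          Inward ε e x₀ R p ∧ rdist p (torusMap ε e x₀) ≤ R := by
        rcases hp with hp | hp
        · refine ⟨fun a => ?_, inward_of_mem_torusPart hR hR' hp, ?_⟩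
          · obtain ⟨x, -, rfl⟩ := hp
            exact exitDist_le_torusMap ε _ _ _ _
          · obtain ⟨x, ⟨-, hx⟩, rfl⟩ := hp
            exact (rdist_torusMap_le ε _ _ _).trans hx
        · simp only [Set.mem_iUnion] at hp
          obtain ⟨j, hj, hp⟩ := hp
          refine ⟨fun a => ?_, (F j).inward hx₀ hR hR' hp, ?_⟩
          · obtain ⟨x, -, rfl⟩ := hp
            refine exitDist_le_of_ne ε _ _ (fun h => his ?_) _ _
            rwa [hF i j h]
          · obtain ⟨x, ⟨-, hx⟩, rfl⟩ := hp
            rw [← (F j).map_eq]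
            exact (rdist_cylinderMap_le ε _ _ _).trans hx
      obtain ⟨a', h1, h2, h3⟩ :=
        (F i).exists_bridge hx₀ hR hR' key.1 key.2.1 key.2.2 ha hn
      exact ⟨_, ⟨a', ⟨h1, h2⟩, rfl⟩, h3⟩

/-- The end of a cylinder is compact: either it passes through the point or it has a positive
distance from it. -/
theorem exists_flap (e : TorusIndex) (x₀ : Cov 3) (c : CylinderIndex)
    (b : Bool) : ∃ R : ℝ, 0 < R ∧ ((∃ a : Cov 2, a.snd = endU b ∧
      rdist (cylinderMap ε c a) (torusMap ε e x₀) < R) →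
      ∃ F : Flap ε e x₀, F.c = c ∧ F.b = b) := by
  have hcomp := compactSpace_flatPiece (w := 1) (cylinderPer_pos c)
  have hK : IsCompact {z : FlatCylinder c | (z.snd : ℝ) = endU b} := by
    refine IsClosed.isCompact (isClosed_eq ?_ continuous_const)
    exact continuous_subtype_val.comp
      (continuous_snd.comp (WithLp.prod_continuous_ofLp 2 _ _))
  have hc : Continuous fun z : FlatCylinder c => rdist (torusMap ε e x₀)
      (Glued.of (GlueRel ε) (.inr c) z) :=
    (continuous_rdist _).comp (Glued.lipschitzWith_of (GlueRel ε) (.inr c)).continuous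
  have hval : ∀ a : Cov 2, a.snd = endU b → ((cyl c a).snd : ℝ) = endU b := fun a ha => by
    change (Set.projIcc (0 : ℝ) 1 zero_le_one a.snd : ℝ) = _
    rw [ha, Set.projIcc_of_mem _ (endU_mem b)]
  obtain ⟨z, hz, hmin⟩ := hK.exists_isMinOn ⟨cyl c (Cov.mk 0 (endU b)), hval _ rfl⟩ hc.continuousOn
  obtain ⟨a₀, ha₀, rfl⟩ := Cov.proj_surjective zero_le_one (cylinderPer_pos c) z
  have ha₀' : a₀.snd = endU b := by
    have : (Set.projIcc (0 : ℝ) 1 zero_le_one a₀.snd : ℝ) = endU b := hz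
    rwa [Set.projIcc_of_mem _ ha₀] at this
  have hmin' : ∀ a : Cov 2, a.snd = endU b → rdist (torusMap ε e x₀) (cylinderMap ε c a₀) ≤
      rdist (cylinderMap ε c a) (torusMap ε e x₀) := fun a ha => by
    rw [rdist_comm (cylinderMap ε c a)]
    exact hmin (hval a ha)
  rcases (rdist_nonneg (torusMap ε e x₀) (cylinderMap ε c a₀)).eq_or_lt with h | h
  · refine ⟨1, one_pos, fun _ => ?_⟩
    have h1 : torusMap ε e x₀ = cylinderMap ε c a₀ := by
      refine eq_of_edist_eq_zero ε _ _ ?_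
      rw [edist_eq_ofReal_rdist (edist_ne_top _ _), ← h, ENNReal.ofReal_zero]
    have h2 : endTorus c b = e := by
      by_contra hne
      have h3 := one_le_edist_torusMap ε hne (endCov ε c b fun j => a₀.fst j) x₀
      rw [← cylinderMap_end, ← ha₀', Cov.mk_eta, h1, edist_self] at h3
      simp at h3
    exact ⟨⟨c, b, a₀, h2, ha₀', h1.symm⟩, rfl, rfl⟩
  · refine ⟨_, h, ?_⟩
    rintro ⟨a, ha, hlt⟩
    exact absurd (hmin' a ha) (not_le.2 hlt)

/-- The radius is so small that only those ends of cylinders that pass through the centre come into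
play. The ball is then contained in the union of a ball of the torus with the flaps. -/
theorem exists_isCN_eball_torusMap {e : TorusIndex} {x₀ : Cov 3}
    (hx₀ : x₀.snd ∈ Set.Icc 0 (thickness ε e : ℝ)) :
    ∃ r : ℝ≥0∞, 0 < r ∧ IsCN (Metric.eball (torusMap ε e x₀) r) := by
  have : ∃ R : ℝ, (0 < R ∧ R ≤ 1 / 32) ∧ ∀ c b, (∃ a : Cov 2, a.snd = endU b ∧
      rdist (cylinderMap ε c a) (torusMap ε e x₀) < R) →
      ∃ F : Flap ε e x₀, F.c = c ∧ F.b = b := by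
    have h1 : ∀ᶠ R in nhdsWithin (0 : ℝ) (Set.Ioi 0), ∀ cb : CylinderIndex × Bool,
        (∃ a : Cov 2, a.snd = endU cb.2 ∧
        rdist (cylinderMap ε cb.1 a) (torusMap ε e x₀) < R) →
        ∃ F : Flap ε e x₀, F.c = cb.1 ∧ F.b = cb.2 := by
      refine Filter.eventually_all.2 fun cb => ?_
      obtain ⟨R, hR, h⟩ := exists_flap (ε := ε) e x₀ cb.1 cb.2
      filter_upwards [Ioc_mem_nhdsGT hR] with R' hR' hex
      obtain ⟨a, ha, hlt⟩ := hex
      exact h ⟨a, ha, hlt.trans_le hR'.2⟩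
    have h2 : ∀ᶠ R in nhdsWithin (0 : ℝ) (Set.Ioi 0), 0 < R ∧ R ≤ 1 / 32 :=
      Ioc_mem_nhdsGT (by norm_num)
    obtain ⟨R, h3, h4⟩ := (h2.and h1).exists
    exact ⟨R, h3, fun c b => h4 (c, b)⟩
  obtain ⟨R, ⟨hR, hR'⟩, h⟩ := this
  let ι := {cb : CylinderIndex × Bool // ∃ F : Flap ε e x₀, F.c = cb.1 ∧ F.b = cb.2}
  have hex : ∀ i : ι, ∃ F : Flap ε e x₀, F.c = i.1.1 ∧ F.b = i.1.2 := fun i => i.2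
  choose F hFc hFb using hex
  have := Fintype.ofFinite ι
  -- Different flaps lie in different cylinders, since the two ends of a cylinder lie on different
  -- tori.
  have hCN := isCN_torusPart_union hx₀ hR.le hR' F (fun i j hij => by
    have hc : i.1.1 = j.1.1 := by rw [← hFc i, hij, hFc j]
    have hb : endTorus (F i).c (F i).b = endTorus (F i).c (F j).b := by
      rw [(F i).endTorus_eq, hij, (F j).endTorus_eq]
    have hb' := endTorus_injective _ hb
    rw [hFb, hFb] at hb'
    exact Subtype.ext (Prod.ext hc hb')) Finset.univ
  refine ⟨ENNReal.ofReal R, ENNReal.ofReal_pos.2 hR, hCN.eball (.inl ⟨x₀, ⟨hx₀,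
      by simpa using hR.le⟩,
    rfl⟩) ?_⟩
  intro z hz
  rw [Metric.mem_eball, edist_eq_ofReal_rdist (edist_ne_top _ _),
    ENNReal.ofReal_lt_ofReal_iff hR] at hz
  rcases exists_eq_map ε z with ⟨e', x, hx, rfl⟩ | ⟨c, a, ha, rfl⟩
  · have he : e' = e := by
      by_contra hne
      have h1 := ENNReal.toReal_mono (edist_ne_top _ _) (one_le_edist_torusMap ε hne x x₀)
      rw [ENNReal.toReal_one] at h1
      exact absurd (h1.trans_lt hz) (by linarith)
    subst he
    rw [rdist_comm] at hz
    obtain ⟨y, hy, h1, h2⟩ := exists_torusMap_eq ε hx₀ (by linarith) hz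
    exact .inl ⟨y, ⟨hy, by rw [norm_sub_rev]; exact h2.le⟩, torusMap_congr ε h1⟩
  -- A short way from the interior of a cylinder to the centre passes through an end at distance
  -- less than `R` from the centre, so this end belongs to a flap.
  · have h1 : ∃ b, ∃ a' : Cov 2, a'.snd = endU b ∧
        ‖a - a'‖ + rdist (cylinderMap ε c a') (torusMap ε e x₀) < R := by
      by_contra hcon
      push Not at hcon
      exact absurd (le_rdist_of_exit ε ⟨ha.1.le, ha.2.le⟩ (exitDist_le_torusMap ε c e a x₀) hcon)
        (not_le.2 hz)
    obtain ⟨b, a', ha', hlt⟩ := h1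
    have hi := h c b ⟨a', ha', by linarith [norm_nonneg (a - a')]⟩
    refine .inr (Set.mem_iUnion₂.2 ⟨⟨(c, b), hi⟩, Finset.mem_univ _, ?_⟩)
    have hc : (F ⟨(c, b), hi⟩).c = c := hFc _
    generalize F ⟨(c, b), hi⟩ = F' at hc
    subst hc
    rw [rdist_comm, ← F'.map_eq] at hz
    obtain ⟨y, hy, h1, h2⟩ := exists_cylinderMap_eq ε F'.snd_mem (by linarith) hz
    exact ⟨y, ⟨hy, by rw [norm_sub_rev]; exact h2.le⟩, cylinderMap_congr ε h1⟩

theorem exists_isCN_eball_cylinderMap {c : CylinderIndex} {a₀ : Cov 2}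
    (ha₀ : a₀.snd ∈ Set.Ioo (0 : ℝ) 1) :
    ∃ r : ℝ≥0∞, 0 < r ∧ IsCN (Metric.eball (cylinderMap ε c a₀) r) := by
  have ha : a₀.snd ∈ Set.Icc (0 : ℝ) 1 := ⟨ha₀.1.le, ha₀.2.le⟩
  have hm : 0 < min a₀.snd (1 - a₀.snd) := lt_min ha₀.1 (by linarith [ha₀.2])
  have hR : 0 < min (min a₀.snd (1 - a₀.snd)) (1 / 8) := lt_min hm (by norm_num)
  refine ⟨ENNReal.ofReal (min (min a₀.snd (1 - a₀.snd)) (1 / 8)), ENNReal.ofReal_pos.2 hR,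
    (isCN_cylinderPart c a₀ (le_refl (1 / 8))).eball ⟨a₀, ⟨ha, by simp⟩, rfl⟩ ?_⟩
  intro z hz
  rw [Metric.mem_eball, edist_comm] at hz
  have hfar : ¬ exitDist ε c a₀ z ≤ edist (cylinderMap ε c a₀) z := fun h => by
    have := ((le_exitDist ε ha z).trans h).trans_lt hz
    rw [ENNReal.ofReal_lt_ofReal_iff hR] at this
    exact absurd (min_le_left _ _) (not_le.2 this)
  rcases exists_eq_map ε z with ⟨e', x, hx, rfl⟩ | ⟨c', a, -, rfl⟩
  · exact absurd (exitDist_le_torusMap ε _ _ _ _) hfar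
  · have hc : c = c' := by
      by_contra hne
      exact hfar (exitDist_le_of_ne ε _ _ hne _ _)
    subst hc
    rw [edist_eq_ofReal_rdist (edist_ne_top _ _), ENNReal.ofReal_lt_ofReal_iff hR] at hz
    obtain ⟨y, hy, h1, h2⟩ := exists_cylinderMap_eq ε ha
      ((min_le_right _ _).trans (by norm_num)) hz
    exact ⟨y, ⟨hy, by rw [norm_sub_rev]; exact h2.le.trans (min_le_right _ _)⟩,
      cylinderMap_congr ε h1⟩

theorem exists_isCN_eball (y : YSpace ε) : ∃ r : ℝ≥0∞, 0 < r ∧ IsCN (Metric.eball y r) := by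
  rcases exists_eq_map ε y with ⟨e, x, hx, rfl⟩ | ⟨c, a, ha, rfl⟩
  · exact exists_isCN_eball_torusMap hx
  · exact exists_isCN_eball_cylinderMap ha

variable (ε) in
theorem uniformlyCN : ∃ ρ : ℝ≥0, UniformlyCN (YSpace ε) ρ :=
  exists_uniformlyCN (eq_of_edist_eq_zero ε) exists_isCN_eball

end TorusComplex
end

noncomputable section

namespace TorusComplex

/-! ### Local systems on the torus complex -/

/-- The map that the gluing map of an end of a cylinder induces on the lattices. -/
def endLat : CylinderIndex → Bool → (Fin 2 → ℤ) → Fin 3 → ℤ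
  | .c _ 0, _, m => ![m 0, -m 0, m 1]
  | .c _ 1, false, m => ![m 0, 0, m 1]
  | .c _ 1, true, m => ![m 0, m 0, m 1]
  | .c _ 2, _, m => ![0, m 0, m 1]
  | .c _ 3, false, m => ![m 0, m 0, m 1]
  | .c _ 3, true, m => ![m 0, 0, m 1]
  | .cx false, false, m => ![m 0, -m 0, m 1]
  | .cx false, true, m => ![m 0, 0, m 1]
  | .cx true, false, m => ![m 0, m 1, 0]
  | .cx true, true, m => ![-m 0, m 0, m 1]

theorem endMap_add_period (c : CylinderIndex) (b : Bool) (m : Fin 2 → ℤ) (s t : ℝ) (j : Fin 3) :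
    endMap c b (s + m 0 * cylinderPer c 0) (t + m 1 * cylinderPer c 1) j =
      endMap c b s t j + endLat c b m j * torusPer (endTorus c b) j := by
  have h2 : √2 * √2 = 2 := Real.mul_self_sqrt (by norm_num)
  have h0 : √2 ≠ 0 := by positivity
  rcases c with g | ⟨g, i⟩
  · cases g <;> cases b <;> fin_cases j <;>
      simp [endMap, endLat, cylinderPeriod, torusPeriod, endTorus] <;> field_simp <;> ring
  · cases b <;> fin_cases i <;> fin_cases j <;>
      simp [endMap, endLat, cylinderPeriod, torusPeriod, endTorus] <;> field_simp <;> ring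

/-- The lift of the gluing map of an end of a cylinder to the coverings. -/
def endPt (ε : ℝ≥0) (c : CylinderIndex) (b : Bool) (a : Cov 2) : Cov 3 :=
  endCov ε c b fun j => a.fst j

theorem endPt_shift (ε : ℝ≥0) (c : CylinderIndex) (b : Bool) (m : Fin 2 → ℤ) (a : Cov 2) :
    endPt ε c b (Cov.shift (cylinderPer c) m a) =
      Cov.shift (torusPer (endTorus c b)) (endLat c b m) (endPt ε c b a) :=
  Cov.ext' (fun j => endMap_add_period c b m _ _ j) rfl

/-- A system of groups on the torus complex: homomorphisms of the fundamental groups of the pieces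
to a group `Q`, and elements that relate them at the ends of the cylinders. -/
structure LocalSystem (Q : Type*) [Group Q] where
  torusHom : TorusIndex → Multiplicative (Fin 3 → ℤ) →* Q
  cylinderHom : CylinderIndex → Multiplicative (Fin 2 → ℤ) →* Q
  tr : CylinderIndex → Bool → Q
  rel : ∀ c b m, cylinderHom c (.ofAdd m) =
    tr c b * torusHom (endTorus c b) (.ofAdd (endLat c b m)) * (tr c b)⁻¹

/-- The lattice vector that brings `y` closest to `x`. -/
def nearLat {n : ℕ} (p : Fin n → ℝ) (x y : Cov n) : Fin n → ℤ :=
  fun j => round ((x.fst j - y.fst j) / p j)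

/-- Relative to a period greater than `1 / 2`, an error below `1 / 4` is less than one half, so
rounding recovers `m`. -/
theorem nearLat_eq {n : ℕ} {p : Fin n → ℝ} (hp : ∀ j, 1 / 2 < p j) {x y : Cov n} {m : Fin n → ℤ}
    (h : ‖x - Cov.shift p m y‖ < 1 / 4) : nearLat p x y = m := by
  funext j
  have h1 := (Cov.abs_fst_le (x - Cov.shift p m y) j).trans_lt h
  have h2 : |x.fst j - (y.fst j + m j * p j)| < 1 / 4 := h1
  have hpj := hp j
  have h0 : 0 < p j := by linarith
  rw [nearLat, round_eq, Int.floor_eq_iff]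
  have e : (x.fst j - y.fst j) / p j = m j + (x.fst j - (y.fst j + m j * p j)) / p j := by
    field_simp; ring
  have h3 : |(x.fst j - (y.fst j + m j * p j)) / p j| < 1 / 2 := by
    rw [abs_div, abs_of_pos h0, div_lt_iff₀ h0]
    linarith
  rw [e]
  constructor <;> linarith [abs_lt.1 h3]

theorem norm_shift_sub_shift {n : ℕ} (p : Fin n → ℝ) (m : Fin n → ℤ) (x y : Cov n) :
    ‖Cov.shift p m x - Cov.shift p m y‖ = ‖x - y‖ := by
  congr 1
  exact Cov.ext' (fun j => by
    change x.fst j + m j * p j - (y.fst j + m j * p j) = x.fst j - y.fst j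
    ring) rfl

theorem norm_sub_shift_add {n : ℕ} (p : Fin n → ℝ) (m m' : Fin n → ℤ) (x y z : Cov n) :
    ‖x - Cov.shift p (m + m') z‖ ≤ ‖x - Cov.shift p m y‖ + ‖y - Cov.shift p m' z‖ := by
  rw [Cov.shift_add, ← norm_shift_sub_shift p m y]
  exact norm_sub_le_norm_sub_add_norm_sub _ _ _

/-- Points in the coverings of the pieces. -/
abbrev LiftPt : Type := (TorusIndex × Cov 3) ⊕ (CylinderIndex × Cov 2)

namespace LiftPt

/-- The coordinate `u` lies in the interval. -/
def Valid (ε : ℝ≥0) : LiftPt → Prop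
  | .inl ex => ex.2.snd ∈ Set.Icc 0 (thickness ε ex.1 : ℝ)
  | .inr ca => ca.2.snd ∈ Set.Icc (0 : ℝ) 1

/-- The image in the torus complex. -/
def toY (ε : ℝ≥0) : LiftPt → YSpace ε
  | .inl ex => torusMap ε ex.1 ex.2
  | .inr ca => cylinderMap ε ca.1 ca.2

open Classical in
/-- The closest end of the cylinder. -/
def closeEnd (a : Cov 2) : Bool := decide (1 / 2 ≤ a.snd)

/-- The closest torus. -/
def anchorTorus : LiftPt → TorusIndex
  | .inl ex => ex.1
  | .inr ca => endTorus ca.1 (closeEnd ca.2)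

/-- The projection to the closest torus. -/
def anchorCov (ε : ℝ≥0) : LiftPt → Cov 3
  | .inl ex => ex.2
  | .inr ca => endPt ε ca.1 (closeEnd ca.2) ca.2

/-- Both points lie in the same cylinder. -/
def SameCylinder : LiftPt → LiftPt → Prop
  | .inr ca, .inr ca' => ca.1 = ca'.1
  | _, _ => False

end LiftPt

open LiftPt

/-- The transport to the closest torus. -/
def LocalSystem.anchorTr {Q : Type*} [Group Q] (D : LocalSystem Q) : LiftPt → Q
  | .inl _ => 1
  | .inr ca => D.tr ca.1 (closeEnd ca.2)

/-- The transport through the closest torus. -/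
def LocalSystem.anchorTransport {Q : Type*} [Group Q] (D : LocalSystem Q) (ε : ℝ≥0)
    (l l' : LiftPt) : Q :=
  D.anchorTr l * D.torusHom (anchorTorus l)
    (.ofAdd (nearLat (torusPer (anchorTorus l)) (anchorCov ε l) (anchorCov ε l'))) *
    (D.anchorTr l')⁻¹

open Classical in
/-- The transport between points that lie close to each other. -/
def LocalSystem.transport {Q : Type*} [Group Q] (D : LocalSystem Q) (ε : ℝ≥0) (l l' : LiftPt) : Q :=
  if SameCylinder l l' then
    match l, l' with
    | .inr ca, .inr ca' => D.cylinderHom ca.1 (.ofAdd (nearLat (cylinderPer ca.1) ca.2 ca'.2))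
    | _, _ => 1
  else D.anchorTransport ε l l'

/-- The closest torus is the same, and so are the projections up to a small distance. -/
def Anchored (ε : ℝ≥0) (l l' : LiftPt) : Prop :=
  anchorTorus l = anchorTorus l' ∧ ∃ m, ‖anchorCov ε l -
    Cov.shift (torusPer (anchorTorus l)) m (anchorCov ε l')‖ < 1 / 8

variable {ε : ℝ≥0}

theorem closeEnd_eq {a : Cov 2} {b : Bool} (h : |a.snd - endU b| < 1 / 2) : closeEnd a = b := by
  cases b
  · simp only [endU, Bool.false_eq_true, if_false, sub_zero] at h
    simp only [closeEnd, decide_eq_false_iff_not, not_le]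
    exact (le_abs_self _).trans_lt h
  · simp only [endU, if_true] at h
    simp only [closeEnd, decide_eq_true_eq]
    linarith [(abs_lt.1 h).1]

theorem anchorCov_valid {l : LiftPt} (hl : l.Valid ε) :
    (anchorCov ε l).snd ∈ Set.Icc 0 (thickness ε (anchorTorus l) : ℝ) := by
  rcases l with ex | ca
  · exact hl
  · exact endCov_snd_mem _ _ _ _

theorem cylinderMap_eq_torusMap {c : CylinderIndex} {b : Bool} {a : Cov 2} (ha : a.snd = endU b) :
    cylinderMap ε c a = torusMap ε (endTorus c b) (endPt ε c b a) := by
  rw [endPt, ← cylinderMap_end, ← ha, Cov.mk_eta]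

/-- A point of a cylinder that is close to the outside is close to an end. -/
theorem rdist_anchor_lt_of_exit {c : CylinderIndex} {a : Cov 2} (ha : a.snd ∈ Set.Icc (0 : ℝ) 1)
    {p : YSpace ε} (hp : exitDist ε c a p ≤ edist (cylinderMap ε c a) p) {δ : ℝ} (hδ : δ ≤ 1 / 2)
    (h : rdist (cylinderMap ε c a) p < δ) : |a.snd - endU (closeEnd a)| < δ ∧
      rdist (cylinderMap ε c a) (torusMap ε (anchorTorus (.inr (c, a)))
      (anchorCov ε (.inr (c, a)))) < δ := by
  have h1 : ∃ b, ∃ a' : Cov 2, a'.snd = endU b ∧ ‖a - a'‖ + rdist (cylinderMap ε c a') p < δ := by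
    by_contra hcon
    push Not at hcon
    exact absurd (le_rdist_of_exit ε ha hp hcon) (not_le.2 h)
  obtain ⟨b, a', ha', hlt⟩ := h1
  have h2 : |a.snd - endU b| < δ := by
    rw [← ha']
    exact (Cov.abs_snd_le (a - a')).trans_lt (by linarith [rdist_nonneg (cylinderMap ε c a') p])
  have hb := closeEnd_eq (h2.trans_le hδ)
  refine ⟨by rwa [hb], ?_⟩
  simp only [anchorTorus, anchorCov, hb]
  have e : endPt ε c b a = endPt ε c b (Cov.mk (fun j => a.fst j) (endU b)) := rfl
  rw [e, ← cylinderMap_eq_torusMap rfl]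
  refine (rdist_cylinderMap_le ε _ _ _).trans_lt (lt_of_le_of_lt (le_of_eq ?_) h2)
  have : ∑ j, (a - Cov.mk (fun j => a.fst j) (endU b)).fst j ^ 2 = 0 :=
    Finset.sum_eq_zero fun j _ => by
      change (a.fst j - a.fst j) ^ 2 = 0
      rw [sub_self, zero_pow two_ne_zero]
  rw [← sq_eq_sq₀ (norm_nonneg _) (abs_nonneg _), Cov.norm_sq, sq_abs, this, zero_add]
  rfl

theorem rdist_anchor_lt {l l' : LiftPt} (hl : l.Valid ε) (h : ¬ SameCylinder l l') {δ : ℝ}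
    (hδ : δ ≤ 1 / 2) (hd : rdist (l.toY ε) (l'.toY ε) < δ) :
    rdist (l.toY ε) (torusMap ε (anchorTorus l) (anchorCov ε l)) < δ := by
  rcases l with ⟨e, x⟩ | ⟨c, a⟩
  · change rdist (torusMap ε e x) (torusMap ε e x) < δ
    rw [rdist_self]
    exact (rdist_nonneg _ _).trans_lt hd
  · refine (rdist_anchor_lt_of_exit hl ?_ hδ hd).2
    rcases l' with ⟨e, x⟩ | ⟨c', a'⟩
    · exact exitDist_le_torusMap ε _ _ _ _
    · exact exitDist_le_of_ne ε _ _ h _ _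

theorem LiftPt.SameCylinder.symm {l l' : LiftPt} (h : SameCylinder l l') : SameCylinder l' l := by
  rcases l with _ | _ <;> rcases l' with _ | _ <;> simp_all [SameCylinder]

theorem LiftPt.SameCylinder.trans {l l' l'' : LiftPt} (h : SameCylinder l l')
    (h' : SameCylinder l' l'') :
    SameCylinder l l'' := by
  rcases l with _ | _ <;> rcases l' with _ | _ <;> rcases l'' with _ | _ <;>
    simp_all [SameCylinder]

/-- Both points are within `δ` of their projections to the closest tori, so these projections are
within `3 δ < 1` of each other. Different tori have distance at least `1`. -/
theorem exists_shift_anchorCov {l l' : LiftPt} (hl : l.Valid ε) (hl' : l'.Valid ε)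
    (h : ¬ SameCylinder l l') {δ : ℝ} (hδ : δ ≤ 1 / 24) (hd : rdist (l.toY ε) (l'.toY ε) < δ) :
    anchorTorus l = anchorTorus l' ∧ ∃ m, ‖anchorCov ε l -
      Cov.shift (torusPer (anchorTorus l)) m (anchorCov ε l')‖ < 3 * δ := by
  have h1 := rdist_anchor_lt hl h (by linarith) hd
  have h2 := rdist_anchor_lt (δ := δ) hl' (fun h' => h h'.symm) (by linarith)
    (by rwa [rdist_comm])
  have h3 : rdist (torusMap ε (anchorTorus l) (anchorCov ε l))
      (torusMap ε (anchorTorus l') (anchorCov ε l')) < 3 * δ := by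
    have e1 := rdist_triangle' (torusMap ε (anchorTorus l) (anchorCov ε l)) (l.toY ε)
      (torusMap ε (anchorTorus l') (anchorCov ε l'))
    have e2 := rdist_triangle' (l.toY ε) (l'.toY ε)
      (torusMap ε (anchorTorus l') (anchorCov ε l'))
    rw [rdist_comm _ (l.toY ε)] at e1
    linarith
  have he : anchorTorus l = anchorTorus l' := by
    by_contra hne
    have h1 := ENNReal.toReal_mono (edist_ne_top _ _)
      (one_le_edist_torusMap ε hne (anchorCov ε l) (anchorCov ε l'))
    rw [ENNReal.toReal_one] at h1
    exact absurd (h1.trans_lt h3) (by linarith)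
  refine ⟨he, ?_⟩
  rw [← he] at h3
  obtain ⟨y, hy, h4, h5⟩ := exists_torusMap_eq ε (anchorCov_valid hl) (by linarith) h3
  have hv : (anchorCov ε l').snd ∈ Set.Icc 0 (thickness ε (anchorTorus l) : ℝ) := by
    rw [he]; exact anchorCov_valid hl'
  obtain ⟨m, rfl⟩ := (torusMap_eq_iff ε hv hy).1 (torusMap_congr ε h4).symm
  exact ⟨m, h5⟩

theorem anchored_of_not_sameCylinder {l l' : LiftPt} (hl : l.Valid ε) (hl' : l'.Valid ε)
    (h : ¬ SameCylinder l l') (hd : rdist (l.toY ε) (l'.toY ε) < 1 / 24) : Anchored ε l l' := by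
  obtain ⟨he, m, hm⟩ := exists_shift_anchorCov hl hl' h le_rfl hd
  exact ⟨he, m, hm.trans_eq (by norm_num)⟩

theorem exists_shift_of_sameCylinder {c : CylinderIndex} {a a' : Cov 2}
    (ha : a.snd ∈ Set.Icc (0 : ℝ) 1) (ha' : a'.snd ∈ Set.Icc (0 : ℝ) 1) {δ : ℝ} (hδ : δ ≤ 1)
    (hd : rdist (cylinderMap ε c a) (cylinderMap ε c a') < δ) :
    ∃ m, ‖a - Cov.shift (cylinderPer c) m a'‖ < δ := by
  obtain ⟨y, hy, h4, h5⟩ := exists_cylinderMap_eq ε ha hδ hd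
  obtain ⟨m, rfl⟩ := (cylinderMap_eq_iff ε ha' hy).1 (cylinderMap_congr ε h4).symm
  exact ⟨m, h5⟩

theorem norm_endPt_sub_le (c : CylinderIndex) (b : Bool) (a a' : Cov 2) :
    ‖endPt ε c b a - endPt ε c b a'‖ ≤ ‖a - a'‖ := by
  have h : endPt ε c b a - endPt ε c b a' =
      endLin c b (Cov.mk (fun j => a.fst j - a'.fst j) 0) := by
    refine Cov.ext' (fun j => ?_) (sub_self _)
    exact congrFun (endMap_sub c b _ _ _ _) j
  rw [h, norm_endLin c b rfl, ← sq_le_sq₀ (norm_nonneg _) (norm_nonneg _), Cov.norm_sq, Cov.norm_sq]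
  refine add_le_add le_rfl ?_
  simpa using sq_nonneg _

namespace LocalSystem

variable {Q : Type*} [Group Q] (D : LocalSystem Q)

theorem transport_eq_anchorTransport {l l' : LiftPt} (h : ¬ SameCylinder l l') :
    D.transport ε l l' = D.anchorTransport ε l l' := if_neg h

theorem transport_cylinder {c : CylinderIndex} {a a' : Cov 2} {m : Fin 2 → ℤ}
    (h : ‖a - Cov.shift (cylinderPer c) m a'‖ < 1 / 4) :
    D.transport ε (.inr (c, a)) (.inr (c, a')) = D.cylinderHom c (.ofAdd m) := by
  rw [transport, if_pos (by exact rfl)]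
  simp only [nearLat_eq (lt_cylinderPer c) h]

theorem transport_torus {e : TorusIndex} {x x' : Cov 3} {m : Fin 3 → ℤ}
    (h : ‖x - Cov.shift (torusPer e) m x'‖ < 1 / 4) :
    D.transport ε (.inl (e, x)) (.inl (e, x')) = D.torusHom e (.ofAdd m) := by
  rw [transport_eq_anchorTransport D (by exact id)]
  simp only [anchorTransport, anchorTr, anchorTorus, anchorCov, nearLat_eq (lt_torusPer e) h,
    one_mul, inv_one, mul_one]

theorem transport_end {c : CylinderIndex} {b : Bool} {a : Cov 2} (ha : a.snd = endU b) :
    D.transport ε (.inr (c, a)) (.inl (endTorus c b, endPt ε c b a)) = D.tr c b := by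
  rw [transport_eq_anchorTransport D (by exact id)]
  have hb : closeEnd a = b := closeEnd_eq (by rw [ha, sub_self, abs_zero]; norm_num)
  have h : nearLat (torusPer (endTorus c b)) (endPt ε c b a) (endPt ε c b a) = 0 :=
    nearLat_eq (lt_torusPer _) (by rw [Cov.shift_zero, sub_self, norm_zero]; norm_num)
  simp only [anchorTransport, anchorTr, anchorTorus, anchorCov, hb, h]
  simp

theorem transport_self (l : LiftPt) : D.transport ε l l = 1 := by
  rcases l with ⟨e, x⟩ | ⟨c, a⟩
  · rw [D.transport_torus (m := 0) (by rw [Cov.shift_zero, sub_self, norm_zero]; norm_num)]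
    exact map_one _
  · rw [D.transport_cylinder (m := 0) (by rw [Cov.shift_zero, sub_self, norm_zero]; norm_num)]
    exact map_one _

/-- Close to an end of a cylinder the two kinds of transport agree. -/
theorem anchored_of_sameCylinder {c : CylinderIndex} {a a' : Cov 2}
    (hc : closeEnd a = closeEnd a') {m : Fin 2 → ℤ}
    (h : ‖a - Cov.shift (cylinderPer c) m a'‖ < 1 / 8) :
    Anchored ε (.inr (c, a)) (.inr (c, a')) ∧
      D.transport ε (.inr (c, a)) (.inr (c, a')) =
        D.anchorTransport ε (.inr (c, a)) (.inr (c, a')) := by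
  have h1 : ‖endPt ε c (closeEnd a) a - Cov.shift (torusPer (endTorus c (closeEnd a)))
      (endLat c (closeEnd a) m) (endPt ε c (closeEnd a) a')‖ < 1 / 8 := by
    rw [← endPt_shift]
    exact (norm_endPt_sub_le c _ _ _).trans_lt h
  refine ⟨⟨by simp only [anchorTorus, hc], endLat c (closeEnd a) m, ?_⟩, ?_⟩
  · simpa only [anchorTorus, anchorCov, ← hc] using h1
  · rw [D.transport_cylinder (h.trans (by norm_num)), D.rel c (closeEnd a)]
    simp only [anchorTransport, anchorTr, anchorTorus, anchorCov, ← hc,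
      nearLat_eq (lt_torusPer _) (h1.trans (by norm_num : (1 : ℝ) / 8 < 1 / 4))]

/-- The lattice vectors add up because `1 / 8 + 1 / 8` stays within the range in which the nearest
lattice vector is unique. -/
theorem anchorTransport_mul {l l' l'' : LiftPt} (h : Anchored ε l l') (h' : Anchored ε l' l'')
    (h'' : Anchored ε l l'') :
    D.anchorTransport ε l l' * D.anchorTransport ε l' l'' = D.anchorTransport ε l l'' := by
  obtain ⟨e, m, hm⟩ := h
  obtain ⟨e', m', hm'⟩ := h'
  obtain ⟨-, m'', hm''⟩ := h''
  simp only [anchorTransport]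
  rw [← e] at hm' ⊢
  have hp := lt_torusPer (anchorTorus l)
  have h1 : nearLat (torusPer (anchorTorus l)) (anchorCov ε l) (anchorCov ε l'') = m + m' := by
    refine nearLat_eq hp ((norm_sub_shift_add _ _ _ _ _ _).trans_lt (add_lt_add hm hm')
        |>.trans_le ?_)
    norm_num
  rw [h1, nearLat_eq hp (hm.trans (by norm_num)), nearLat_eq hp (hm'.trans (by norm_num)),
    ofAdd_add, map_mul]
  group

/-- A close third point outside the cylinder forces two points of the same cylinder to be near an
end, and near the same one; there both kinds of transport agree. -/
theorem transport_eq_of_third {l l' l'' : LiftPt} (hl : l.Valid ε) (hl' : l'.Valid ε)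
    (h : ¬ SameCylinder l l'' ∨ ¬ SameCylinder l' l'')
    (h1 : rdist (l.toY ε) (l'.toY ε) < 1 / 24) (h2 : rdist (l'.toY ε) (l''.toY ε) < 1 / 24)
    (h3 : rdist (l.toY ε) (l''.toY ε) < 1 / 24) :
    Anchored ε l l' ∧ D.transport ε l l' = D.anchorTransport ε l l' := by
  by_cases hs : SameCylinder l l'
  · have hn : ¬ SameCylinder l l'' := by
      rcases h with h | h
      · exact h
      · exact fun h' => h (hs.symm.trans h')
    have hn' : ¬ SameCylinder l' l'' := fun h' => hn (hs.trans h')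
    rcases l with ⟨e, x⟩ | ⟨c, a⟩
    · exact hs.elim
    rcases l' with ⟨e, x⟩ | ⟨c', a'⟩
    · exact hs.elim
    have hc : c = c' := hs
    subst hc
    have hexit : ∀ a, ¬ SameCylinder (.inr (c, a)) l'' →
        exitDist ε c a (l''.toY ε) ≤ edist (cylinderMap ε c a) (l''.toY ε) := fun a hn => by
      rcases l'' with ⟨e, x⟩ | ⟨c', a'⟩
      · exact exitDist_le_torusMap ε _ _ _ _
      · exact exitDist_le_of_ne ε _ _ hn _ _
    have e1 := (rdist_anchor_lt_of_exit hl (hexit a hn) (by norm_num) h3).1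
    have e2 := (rdist_anchor_lt_of_exit hl' (hexit a' hn') (by norm_num) h2).1
    obtain ⟨m, hm⟩ := exists_shift_of_sameCylinder hl hl' (by norm_num) h1
    refine D.anchored_of_sameCylinder ?_ (hm.trans (by norm_num))
    have e3 : |a.snd - a'.snd| < 1 / 24 := (Cov.abs_snd_le _).trans_lt hm
    refine closeEnd_eq ?_
    have := abs_add_le (a.snd - a'.snd) (a'.snd - endU (closeEnd a'))
    rw [sub_add_sub_cancel] at this
    linarith
  · exact ⟨anchored_of_not_sameCylinder hl hl' hs h1, D.transport_eq_anchorTransport hs⟩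

/-- The cocycle condition. If the three points share a cylinder, lattice vectors of this cylinder
add up. Otherwise `transport_eq_of_third` reduces all three transports to those through one torus.
-/
theorem transport_mul {l l' l'' : LiftPt} (hl : l.Valid ε) (hl' : l'.Valid ε) (hl'' : l''.Valid ε)
    (h1 : rdist (l.toY ε) (l'.toY ε) < 1 / 24) (h2 : rdist (l'.toY ε) (l''.toY ε) < 1 / 24)
    (h3 : rdist (l.toY ε) (l''.toY ε) < 1 / 24) :
    D.transport ε l l' * D.transport ε l' l'' = D.transport ε l l'' := by
  by_cases h : SameCylinder l l' ∧ SameCylinder l' l''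
  · rcases l with ⟨e, x⟩ | ⟨c, a⟩
    · exact h.1.elim
    rcases l' with ⟨e, x⟩ | ⟨c', a'⟩
    · exact h.1.elim
    rcases l'' with ⟨e, x⟩ | ⟨c'', a''⟩
    · exact h.2.elim
    have hc : c = c' := h.1
    subst hc
    have hc : c = c'' := h.2
    subst hc
    obtain ⟨m, hm⟩ := exists_shift_of_sameCylinder hl hl' (by norm_num) h1
    obtain ⟨m', hm'⟩ := exists_shift_of_sameCylinder hl' hl'' (by norm_num) h2
    rw [D.transport_cylinder (hm.trans (by norm_num)),
      D.transport_cylinder (hm'.trans (by norm_num)),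
      D.transport_cylinder (m := m + m')
        (((norm_sub_shift_add _ _ _ _ _ _).trans_lt (add_lt_add hm hm')).trans (by norm_num)),
      ofAdd_add, map_mul]
  · have r1 := h1
    have r2 := h2
    have r3 := h3
    rw [rdist_comm] at r1 r2 r3
    have t1 : ¬ SameCylinder l l'' ∨ ¬ SameCylinder l' l'' := by
      by_contra hcon
      push Not at hcon
      exact h ⟨hcon.1.trans hcon.2.symm, hcon.2⟩
    have t2 : ¬ SameCylinder l' l ∨ ¬ SameCylinder l'' l := by
      by_contra hcon
      push Not at hcon
      exact h ⟨hcon.1.symm, hcon.1.trans hcon.2.symm⟩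
    have t3 : ¬ SameCylinder l l' ∨ ¬ SameCylinder l'' l' := by
      by_contra hcon
      push Not at hcon
      exact h ⟨hcon.1, hcon.2.symm⟩
    obtain ⟨a1, k1⟩ := D.transport_eq_of_third hl hl' t1 h1 h2 h3
    obtain ⟨a2, k2⟩ := D.transport_eq_of_third hl' hl'' t2 h2 r3 r1
    obtain ⟨a3, k3⟩ := D.transport_eq_of_third hl hl'' t3 h3 r2 h1
    rw [k1, k2, k3, D.anchorTransport_mul a1 a2 a3]

end LocalSystem

end TorusComplex
end

/-! ### Parallel sections, lifts of the pieces and monodromy -/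

noncomputable section

/-- A cocycle of transports between close points, with values in a group, has a parallel section
over a simply connected space. -/
theorem exists_parallel_section {X Y ι Q : Type*} [TopologicalSpace X] [SimplyConnectedSpace X]
    [LocallyPathConnectedSpace X] [PseudoEMetricSpace Y] [Group Q] (p : X → Y) (hp : Continuous p)
    (q : ι → Y) (hq : Function.Surjective q) (K : ι → ι → Q) (δ : ℝ≥0∞) (hδ : 0 < δ)
    (hK1 : ∀ i, K i i = 1) (hK : ∀ i j k, edist (q i) (q j) < δ → edist (q j) (q k) < δ →
      edist (q i) (q k) < δ → K i j * K j k = K i k) :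
    ∃ σ : ι → X → Q, (∀ i j x, edist (q i) (p x) < δ / 2 → edist (q j) (p x) < δ / 2 →
      σ i x = K i j * σ j x) ∧
      ∀ i x, edist (q i) (p x) < δ / 2 → ∀ᶠ x' in nhds x, σ i x' = σ i x := by
  let _ : TopologicalSpace Q := ⊥
  have _ : DiscreteTopology Q := ⟨rfl⟩
  have hclose : ∀ {i j y}, y ∈ Metric.eball (q i) (δ / 2) → y ∈ Metric.eball (q j) (δ / 2) →
      edist (q i) (q j) < δ := fun {i j y} hi hj =>
    (edist_triangle _ y _).trans_lt ((ENNReal.add_lt_add (Metric.mem_eball'.1 hi)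
      (Metric.mem_eball.1 hj)).trans_eq (ENNReal.add_halves δ))
  choose s hs using hq
  -- The cocycle glues copies of the discrete space `Q` over small balls to a covering of `Y`. The
  -- map `p` lifts to it because `X` is simply connected, and `σ i` is the lift read in the chart of
  -- `i`.
  let core : FiberBundleCore ι Y Q :=
    { baseSet := fun i => Metric.eball (q i) (δ / 2)
      isOpen_baseSet := fun i => Metric.isOpen_eball
      indexAt := s
      mem_baseSet_at := fun y => by
        rw [hs]; exact Metric.mem_eball_self (ENNReal.half_pos hδ.ne')
      coordChange := fun i j _ v => K j i * v
      coordChange_self := fun i _ _ v => by rw [hK1, one_mul]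
      continuousOn_coordChange := fun i j => by
        have : Continuous fun v : Q => K j i * v := continuous_of_discreteTopology
        exact (this.comp continuous_snd).continuousOn
      coordChange_comp := fun i j k y hy v => by
        rw [← mul_assoc, hK k j i (hclose hy.2 hy.1.2) (hclose hy.1.2 hy.1.1)
          (hclose hy.2 hy.1.1)] }
  have cov : IsCoveringMap core.proj :=
    IsFiberBundle.isCoveringMap fun y => ⟨core.localTriv (s y), core.mem_baseSet_at y⟩
  obtain ⟨x₀⟩ : Nonempty X := inferInstance
  obtain ⟨S, ⟨-, hS⟩, -⟩ := cov.existsUnique_continuousMap_lifts ⟨p, hp⟩ x₀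
    (⟨p x₀, (1 : Q)⟩ : core.TotalSpace) rfl
  have hS' : ∀ x, (S x).1 = p x := fun x => congrFun hS x
  refine ⟨fun i x => (core.localTriv i (S x)).2, ?_, ?_⟩
  · intro i j x hi hj
    let v : Q := (S x).2
    change K i (s (S x).1) * v = K i j * (K j (s (S x).1) * v)
    have hx : (S x).1 ∈ Metric.eball (q (s (S x).1)) (δ / 2) := core.mem_baseSet_at _
    have hi' : (S x).1 ∈ Metric.eball (q i) (δ / 2) := by rw [hS']; exact Metric.mem_eball'.2 hi
    have hj' : (S x).1 ∈ Metric.eball (q j) (δ / 2) := by rw [hS']; exact Metric.mem_eball'.2 hj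
    rw [← mul_assoc, hK i j _ (hclose hi' hj') (hclose hj' hx) (hclose hi' hx)]
  · intro i x hi
    have hmem : S x ∈ (core.localTriv i).source := by
      rw [core.mem_localTriv_source, hS']
      exact Metric.mem_eball'.2 hi
    have h1 : ContinuousAt (fun x => (core.localTriv i (S x)).2) x :=
      continuous_snd.continuousAt.comp
        (((core.localTriv i).continuousAt hmem).comp S.continuous.continuousAt)
    have h2 := h1.eventually (p := fun v => (core.localTriv i (S x)).2 = v)
      (by rw [nhds_discrete]; exact Filter.eventually_pure.2 rfl)
    exact h2.mono fun _ h => h.symm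

namespace UniformlyCN

open UniversalCover

variable {Y : Type*} [PseudoEMetricSpace Y] {ρ : ℝ≥0} {y₀ : Y}

/-- Lifts of maps that do not increase small distances do not increase them either. -/
theorem edist_lift_le (H : UniformlyCN Y ρ) {E : Type*} [NormedAddCommGroup E] [NormedSpace ℝ E]
    {f : E → UniversalCover Y y₀} (hf : Continuous f)
    (h : ∀ x x', edist (f x).pt (f x').pt ≤ ENNReal.ofReal ‖x - x'‖) {x x' : E}
    (hx : ENNReal.ofReal ‖x - x'‖ < ρ) : edist (f x) (f x') ≤ ENNReal.ofReal ‖x - x'‖ := by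
  let g : unitInterval → UniversalCover Y y₀ := fun t => f (x + (t : ℝ) • (x' - x))
  have hg : Continuous g := hf.comp (by fun_prop)
  have hle : ∀ t, edist (f x) (g t) < ρ → edist (f x) (g t) ≤ ENNReal.ofReal ‖x - x'‖ := by
    intro t ht
    rw [H.edist_eq (a := f x) (by rw [edist_self]; exact H.coe_pos) ht]
    refine (h _ _).trans (ENNReal.ofReal_le_ofReal ?_)
    rw [sub_add_cancel_left, norm_neg, norm_smul, Real.norm_of_nonneg t.2.1, norm_sub_rev x x']
    exact mul_le_of_le_one_left (norm_nonneg _) t.2.2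
  -- The strict bound by `ρ` improves itself to a bound that is smaller than `ρ`; so the set is both
  -- open and closed.
  have hset : {t | edist (f x) (g t) < ρ} = {t | edist (f x) (g t) ≤ ENNReal.ofReal ‖x - x'‖} :=
    Set.ext fun t => ⟨hle t, fun ht => lt_of_le_of_lt ht hx⟩
  have hclopen : IsClopen {t | edist (f x) (g t) < ρ} := by
    refine ⟨?_, isOpen_lt (continuous_const.edist hg) continuous_const⟩
    rw [hset]
    exact isClosed_le (continuous_const.edist hg) continuous_const
  have huniv := hclopen.eq_univ ⟨0, by
    change edist (f x) (f (x + ((0 : unitInterval) : ℝ) • (x' - x))) < ρ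
    simpa using H.coe_pos⟩
  have h1 := hle 1 (huniv.ge (Set.mem_univ 1))
  have e : g 1 = f x' := by simp [g]
  rwa [e] at h1

end UniformlyCN

namespace TorusComplex

open LiftPt

variable {ε : ℝ≥0} {y₀ : YSpace ε}

local notation "Γ" => FundamentalGroup (YSpace ε) y₀

local notation "X" => UniversalCover (YSpace ε) y₀

/-- A choice of lifts of the pieces to the universal cover that induces the local system `D` on the
fundamental group. -/
structure Development (D : LocalSystem Γ) where
  torus : TorusIndex → Cov 3 → X
  cylinder : CylinderIndex → Cov 2 → X
  continuous_torus : ∀ e, Continuous (torus e)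
  continuous_cylinder : ∀ c, Continuous (cylinder c)
  pt_torus : ∀ e x, (torus e x).pt = torusMap ε e x
  pt_cylinder : ∀ c a, (cylinder c a).pt = cylinderMap ε c a
  torus_shift : ∀ e m x, torus e (Cov.shift (torusPer e) m x) =
    D.torusHom e (.ofAdd m) • torus e x
  cylinder_shift : ∀ c m a, cylinder c (Cov.shift (cylinderPer c) m a) =
    D.cylinderHom c (.ofAdd m) • cylinder c a
  cylinder_end : ∀ c b a, a.snd = endU b →
    cylinder c a = D.tr c b • torus (endTorus c b) (endPt ε c b a)

theorem smul_left_cancel_lift {g g' : Γ} {x : X} (h : g • x = g' • x) : g = g' := by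
  have : (g'⁻¹ * g) • x = x := by rw [mul_smul, h, inv_smul_smul]
  have := UniversalCover.eq_one_of_smul_eq this
  rwa [inv_mul_eq_one, eq_comm] at this

/-- Two lifts of a map of a connected space differ by a deck transformation. -/
theorem exists_smul_lift_eq {A : Type*} [TopologicalSpace A] [PreconnectedSpace A] [Nonempty A]
    {f g : A → X} (hf : Continuous f) (hg : Continuous g) (h : ∀ a, (f a).pt = (g a).pt) :
    ∃ γ : Γ, ∀ a, g a = γ • f a := by
  obtain ⟨ρ, H⟩ := uniformlyCN ε
  obtain ⟨a₀⟩ := ‹Nonempty A›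
  obtain ⟨γ, hγ⟩ := UniversalCover.exists_smul_eq (h a₀)
  have := UniformlyCN.continuousConstSMul (Y := YSpace ε) (y₀ := y₀)
  have key : g = fun a => γ • f a := ?_
  · exact ⟨γ, fun a => congrFun key a⟩
  refine (H.isQuotientCoveringMap_pt (y₀ := y₀)).isCoveringMap.eq_of_comp_eq hg
    (hf.const_smul γ) ?_ a₀ hγ.symm
  funext a
  exact (h a).symm

theorem exists_lift {A : Type*} [TopologicalSpace A] [SimplyConnectedSpace A]
    [LocallyPathConnectedSpace A] {f : A → YSpace ε} (hf : Continuous f) :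
    ∃ F : A → X, Continuous F ∧ ∀ a, (F a).pt = f a := by
  obtain ⟨ρ, H⟩ := uniformlyCN ε
  obtain ⟨a₀⟩ : Nonempty A := inferInstance
  obtain ⟨x₀, hx₀⟩ := UniformlyCN.pt_surjective (y₀ := y₀) (f a₀)
  obtain ⟨F, ⟨-, hF⟩, -⟩ :=
    (H.isQuotientCoveringMap_pt (y₀ := y₀)).isCoveringMap.existsUnique_continuousMap_lifts
      ⟨f, hf⟩ a₀ x₀ hx₀
  exact ⟨F, F.continuous, fun a => congrFun hF a⟩

/-- The homomorphism of the lattice that the lift of a periodic map induces. -/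
theorem exists_latticeHom {n : ℕ} {p : Fin n → ℝ} {f : Cov n → X} (hf : Continuous f)
    (h : ∀ m x, (f (Cov.shift p m x)).pt = (f x).pt) :
    ∃ ψ : Multiplicative (Fin n → ℤ) →* Γ, ∀ m x,
      f (Cov.shift p m x) = ψ (.ofAdd m) • f x := by
  have h1 : ∀ m : Fin n → ℤ, ∃ γ : Γ, ∀ x, f (Cov.shift p m x) = γ • f x := fun m =>
    exists_smul_lift_eq hf (hf.comp (Cov.continuous_shift m)) fun x => (h m x).symm
  choose ψ hψ using h1
  refine ⟨MonoidHom.mk' (fun m => ψ m.toAdd) fun m m' => ?_, fun m x => hψ m x⟩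
  refine smul_left_cancel_lift (x := f 0) ?_
  rw [mul_smul, ← hψ, ← hψ, ← hψ, ← Cov.shift_add, toAdd_mul]

theorem continuous_endPt (c : CylinderIndex) (b : Bool) : Continuous (endPt ε c b) := by
  refine (LipschitzWith.of_dist_le_mul (K := 1) fun a a' => ?_).continuous
  rw [NNReal.coe_one, one_mul, dist_eq_norm, dist_eq_norm]
  exact norm_endPt_sub_le c b a a'

/-- The point with the same coordinates at an end of the cylinder. -/
def toEnd (b : Bool) (a : Cov 2) : Cov 2 := Cov.mk (fun j => a.fst j) (endU b)

theorem norm_toEnd_sub_toEnd_le (b : Bool) (a a' : Cov 2) :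
    ‖toEnd b a - toEnd b a'‖ ≤ ‖a - a'‖ := by
  rw [← sq_le_sq₀ (norm_nonneg _) (norm_nonneg _), Cov.norm_sq, Cov.norm_sq]
  refine add_le_add le_rfl ?_
  have : (toEnd b a - toEnd b a').snd = 0 := sub_self _
  rw [this]
  simpa using sq_nonneg _

theorem norm_sub_toEnd (b : Bool) (a : Cov 2) : ‖a - toEnd b a‖ = |a.snd - endU b| := by
  rw [← sq_eq_sq₀ (norm_nonneg _) (abs_nonneg _), Cov.norm_sq, sq_abs]
  have : ∑ j, (a - toEnd b a).fst j ^ 2 = 0 := Finset.sum_eq_zero fun j _ => by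
    change (a.fst j - a.fst j) ^ 2 = 0
    rw [sub_self, zero_pow two_ne_zero]
  rw [this, zero_add]
  rfl

theorem continuous_toEnd (b : Bool) : Continuous (toEnd b) := by
  refine (LipschitzWith.of_dist_le_mul (K := 1) fun a a' => ?_).continuous
  rw [NNReal.coe_one, one_mul, dist_eq_norm, dist_eq_norm]
  exact norm_toEnd_sub_toEnd_le b a a'

/-- Lifts of the simply connected coverings of the pieces exist, and any two lifts of the same map
differ by a deck transformation. This yields the homomorphisms of the lattices and the transports.
-/
theorem exists_development : ∃ D : LocalSystem Γ, Nonempty (Development D) := by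
  have h1 : ∀ e, ∃ F : Cov 3 → X, Continuous F ∧ ∀ x, (F x).pt = torusMap ε e x := fun e =>
    exists_lift (continuous_torusMap ε e)
  have h2 : ∀ c, ∃ F : Cov 2 → X, Continuous F ∧ ∀ x, (F x).pt = cylinderMap ε c x := fun c =>
    exists_lift (continuous_cylinderMap ε c)
  choose T hT hTp using h1
  choose C hC hCp using h2
  have h3 : ∀ e, ∃ ψ : Multiplicative (Fin 3 → ℤ) →* Γ, ∀ m x,
      T e (Cov.shift (torusPer e) m x) = ψ (.ofAdd m) • T e x := fun e =>
    exists_latticeHom (hT e) fun m x => by rw [hTp, hTp, torusMap_shift]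
  have h4 : ∀ c, ∃ ψ : Multiplicative (Fin 2 → ℤ) →* Γ, ∀ m x,
      C c (Cov.shift (cylinderPer c) m x) = ψ (.ofAdd m) • C c x := fun c =>
    exists_latticeHom (hC c) fun m x => by rw [hCp, hCp, cylinderMap_shift]
  have h5 : ∀ c b, ∃ γ : Γ, ∀ a, C c (toEnd b a) = γ • T (endTorus c b) (endPt ε c b a) :=
    fun c b => exists_smul_lift_eq ((hT _).comp (continuous_endPt c b))
      ((hC c).comp (continuous_toEnd b)) fun a => by
        rw [hTp, hCp]
        exact (cylinderMap_eq_torusMap (a := toEnd b a) rfl).symm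
  choose ψ hψ using h3
  choose φ hφ using h4
  choose g hg using h5
  have hg' : ∀ c b a, a.snd = endU b → C c a = g c b • T (endTorus c b) (endPt ε c b a) := by
    intro c b a ha
    have e : toEnd b a = a := by rw [toEnd, ← ha, Cov.mk_eta]
    rw [← hg, e]
  refine ⟨⟨ψ, φ, g, fun c b m => ?_⟩, ⟨⟨T, C, hT, hC, hTp, hCp, hψ, hφ, hg'⟩⟩⟩
  -- The relation of a local system expresses that a lattice translate of an end point may be
  -- computed in the cylinder or in the torus. Deck transformations act freely.
  have e1 := hg' c b (Cov.shift (cylinderPer c) m (toEnd b 0)) rfl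
  rw [hφ, endPt_shift, hψ, hg' c b (toEnd b 0) rfl, ← mul_smul, ← mul_smul] at e1
  have e2 := smul_left_cancel_lift e1
  rw [← e2, mul_inv_cancel_right]

/-- Another choice of the lifts. -/
def LocalSystem.gauge {Q : Type*} [Group Q] (D : LocalSystem Q) (h : TorusIndex → Q)
    (k : CylinderIndex → Q) : LocalSystem Q where
  torusHom e := (MulAut.conj (h e)).toMonoidHom.comp (D.torusHom e)
  cylinderHom c := (MulAut.conj (k c)).toMonoidHom.comp (D.cylinderHom c)
  tr c b := k c * D.tr c b * (h (endTorus c b))⁻¹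
  rel c b m := by
    simp only [MonoidHom.comp_apply, MulEquiv.coe_toMonoidHom, MulAut.conj_apply, D.rel c b]
    group

/-- The development for another choice of the lifts. -/
def Development.gauge {D : LocalSystem Γ} (V : Development D) (h : TorusIndex → Γ)
    (k : CylinderIndex → Γ) : Development (D.gauge h k) where
  torus e x := h e • V.torus e x
  cylinder c a := k c • V.cylinder c a
  continuous_torus e := by
    obtain ⟨ρ, H⟩ := uniformlyCN ε
    have := UniformlyCN.continuousConstSMul (Y := YSpace ε) (y₀ := y₀)
    exact (continuous_const_smul (h e)).comp (V.continuous_torus e)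
  continuous_cylinder c := by
    obtain ⟨ρ, H⟩ := uniformlyCN ε
    have := UniformlyCN.continuousConstSMul (Y := YSpace ε) (y₀ := y₀)
    exact (continuous_const_smul (k c)).comp (V.continuous_cylinder c)
  pt_torus e x := V.pt_torus e x
  pt_cylinder c a := V.pt_cylinder c a
  torus_shift e m x := by
    simp only [LocalSystem.gauge, MonoidHom.comp_apply, MulEquiv.coe_toMonoidHom,
      MulAut.conj_apply, V.torus_shift, ← mul_smul, inv_mul_cancel_right]
  cylinder_shift c m x := by
    simp only [LocalSystem.gauge, MonoidHom.comp_apply, MulEquiv.coe_toMonoidHom,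
      MulAut.conj_apply, V.cylinder_shift, ← mul_smul, inv_mul_cancel_right]
  cylinder_end c b a ha := by
    simp only [LocalSystem.gauge, V.cylinder_end c b a ha, ← mul_smul, inv_mul_cancel_right]

/-- The lift of a point of a piece. -/
def Development.lift {D : LocalSystem Γ} (V : Development D) : LiftPt → X
  | .inl ex => V.torus ex.1 ex.2
  | .inr ca => V.cylinder ca.1 ca.2

theorem Development.pt_lift {D : LocalSystem Γ} (V : Development D) (l : LiftPt) :
    (V.lift l).pt = l.toY ε := by
  rcases l with ⟨e, x⟩ | ⟨c, a⟩
  · exact V.pt_torus e x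
  · exact V.pt_cylinder c a

theorem exists_valid_lift (y : YSpace ε) : ∃ l : LiftPt, l.Valid ε ∧ l.toY ε = y := by
  rcases exists_eq_map ε y with ⟨e, x, hx, rfl⟩ | ⟨c, a, ha, rfl⟩
  · exact ⟨.inl (e, x), hx, rfl⟩
  · exact ⟨.inr (c, a), ⟨ha.1.le, ha.2.le⟩, rfl⟩

theorem Cov.continuous_clamp {n : ℕ} {w : ℝ} (hw : 0 ≤ w) :
    Continuous (Cov.clamp hw : Cov n → Cov n) := by
  refine (LipschitzWith.of_dist_le_mul (K := 1) fun a a' => ?_).continuous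
  rw [NNReal.coe_one, one_mul, dist_eq_norm, dist_eq_norm,
    ← sq_le_sq₀ (norm_nonneg _) (norm_nonneg _), Cov.norm_sq, Cov.norm_sq]
  exact add_le_add le_rfl (sq_le_sq.2 (Set.abs_projIcc_sub_projIcc hw))

theorem Cov.clamp_of_mem {n : ℕ} {w : ℝ} (hw : 0 ≤ w) {x : Cov n} (hx : x.snd ∈ Set.Icc 0 w) :
    Cov.clamp hw x = x := by
  rw [Cov.clamp, Set.projIcc_of_mem hw hx, Cov.mk_eta]

/-- A local system with values in `Q` induces a homomorphism of the fundamental group to `Q`. -/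
theorem Development.exists_monodromy {D : LocalSystem Γ} (V : Development D) {Q : Type*} [Group Q]
    (D' : LocalSystem Q) : ∃ (Φ : Γ →* Q) (h : TorusIndex → Q) (k : CylinderIndex → Q),
      (∀ e m, Φ (D.torusHom e m) = h e * D'.torusHom e m * (h e)⁻¹) ∧
      ∀ c b, Φ (D.tr c b) = k c * D'.tr c b * (h (endTorus c b))⁻¹ := by
  obtain ⟨ρ, H⟩ := uniformlyCN ε
  have := H.simplyConnectedSpace (y₀ := y₀)
  have := H.locallyPathConnectedSpace (y₀ := y₀)
  have := UniformlyCN.continuousConstSMul (Y := YSpace ε) (y₀ := y₀)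
  have hδ : (0 : ℝ≥0∞) < ENNReal.ofReal (1 / 24) := ENNReal.ofReal_pos.2 (by norm_num)
  have hlt : ∀ {x y : YSpace ε}, edist x y < ENNReal.ofReal (1 / 24) → rdist x y < 1 / 24 := by
    intro x y h
    rwa [edist_eq_ofReal_rdist (edist_ne_top _ _), ENNReal.ofReal_lt_ofReal_iff (by norm_num)] at h
  obtain ⟨σ, hσ, hloc⟩ := exists_parallel_section (ι := {l : LiftPt // l.Valid ε})
    (UniversalCover.pt : X → YSpace ε) UniversalCover.continuous_pt (fun l => l.1.toY ε)
    (fun y => by obtain ⟨l, hl, h⟩ := exists_valid_lift y; exact ⟨⟨l, hl⟩, h⟩)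
    (fun l l' => D'.transport ε l l') _ hδ (fun l => D'.transport_self l)
    (fun l l' l'' h1 h2 h3 => D'.transport_mul l.2 l'.2 l''.2 (hlt h1) (hlt h2) (hlt h3))
  have hpos := ENNReal.half_pos hδ.ne'
  -- the section is constant along the lifts of the pieces
  have hconst : ∀ {n : ℕ} (f : Cov n → X) (l : Cov n → {l : LiftPt // l.Valid ε})
      (_ : Continuous f) (_ : ∀ x, (f x).pt = (l x).1.toY ε)
      (_ : ∀ x, ∀ᶠ x' in nhds x, D'.transport ε (l x').1 (l x).1 = 1), ∀ x x',
      σ (l x) (f x) = σ (l x') (f x') := by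
    intro n f l hf hl ht
    have : IsLocallyConstant fun x => σ (l x) (f x) := by
      refine (IsLocallyConstant.iff_eventually_eq _).2 fun x => ?_
      have h1 := hf.continuousAt.eventually (hloc (l x) (f x) (by rw [hl, edist_self]; exact hpos))
      have h2 : ∀ᶠ x' in nhds x, edist ((l x).1.toY ε) (f x').pt <
          ENNReal.ofReal (1 / 24) / 2 := by
        have hc : Continuous fun x' => edist ((l x).1.toY ε) (f x').pt :=
          continuous_const.edist (UniversalCover.continuous_pt.comp hf)
        refine hc.continuousAt.eventually_lt continuousAt_const ?_
        rw [hl, edist_self]; exact hpos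
      filter_upwards [h1, h2, ht x] with x' h1 h2 h3
      rw [hσ (l x') (l x) (f x') (by rw [hl, edist_self]; exact hpos) h2, h3, one_mul, h1]
    exact fun x x' => this.apply_eq_of_preconnectedSpace x x'
  have hw : ∀ e, (0 : ℝ) ≤ thickness ε e := fun e => NNReal.coe_nonneg _
  -- Charts are indexed by valid points only, so the coordinate `u` is clamped to make the lifts of
  -- the pieces total maps on connected spaces.
  let lT : ∀ e, Cov 3 → {l : LiftPt // l.Valid ε} := fun e x =>
    ⟨.inl (e, Cov.clamp (hw e) x), Cov.clamp_mem (hw e) x⟩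
  let lC : ∀ c, Cov 2 → {l : LiftPt // l.Valid ε} := fun c x =>
    ⟨.inr (c, Cov.clamp zero_le_one x), Cov.clamp_mem zero_le_one x⟩
  have hclose : ∀ {n : ℕ} {w : ℝ} (hw : 0 ≤ w) (p : Fin n → ℝ) (x : Cov n), ∀ᶠ x' in nhds x,
      ‖Cov.clamp hw x' - Cov.shift p 0 (Cov.clamp hw x)‖ < 1 / 4 := by
    intro n w hw p x
    have hc : Continuous fun x' => ‖Cov.clamp hw x' - Cov.shift p 0 (Cov.clamp hw x)‖ :=
      ((Cov.continuous_clamp hw).sub continuous_const).norm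
    refine hc.continuousAt.eventually_lt continuousAt_const ?_
    rw [Cov.shift_zero, sub_self, norm_zero]; norm_num
  have hT : ∀ e x x', σ (lT e x) (V.torus e (Cov.clamp (hw e) x)) =
      σ (lT e x') (V.torus e (Cov.clamp (hw e) x')) := fun e =>
    hconst _ (lT e) ((V.continuous_torus e).comp (Cov.continuous_clamp _))
      (fun x => V.pt_torus e _) fun x => by
        filter_upwards [hclose (hw e) (torusPer e) x] with x' hx'
        rw [D'.transport_torus hx', ofAdd_zero, map_one]
  have hC : ∀ c x x', σ (lC c x) (V.cylinder c (Cov.clamp zero_le_one x)) =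
      σ (lC c x') (V.cylinder c (Cov.clamp zero_le_one x')) := fun c =>
    hconst _ (lC c) ((V.continuous_cylinder c).comp (Cov.continuous_clamp _))
      (fun x => V.pt_cylinder c _) fun x => by
        filter_upwards [hclose zero_le_one (cylinderPer c) x] with x' hx'
        rw [D'.transport_cylinder hx', ofAdd_zero, map_one]
  let fT : TorusIndex → Q := fun e => σ (lT e 0) (V.torus e (Cov.clamp (hw e) 0))
  let fC : CylinderIndex → Q := fun c => σ (lC c 0) (V.cylinder c (Cov.clamp zero_le_one 0))
  have hT' : ∀ e x (hx : x.snd ∈ Set.Icc 0 (thickness ε e : ℝ)),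
      σ ⟨.inl (e, x), hx⟩ (V.torus e x) = fT e := by
    intro e x hx
    have := hT e x 0
    simp only [lT, Cov.clamp_of_mem (hw e) hx] at this
    exact this
  have hC' : ∀ c x (hx : x.snd ∈ Set.Icc (0 : ℝ) 1),
      σ ⟨.inr (c, x), hx⟩ (V.cylinder c x) = fC c := by
    intro c x hx
    have := hC c x 0
    simp only [lC, Cov.clamp_of_mem zero_le_one hx] at this
    exact this
  -- the monodromy
  let s : YSpace ε → {l : LiftPt // l.Valid ε} := fun y =>
    ⟨(exists_valid_lift y).choose, (exists_valid_lift y).choose_spec.1⟩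
  have hs : ∀ y, (s y).1.toY ε = y := fun y => (exists_valid_lift y).choose_spec.2
  -- The monodromy compares the section at `g • x` and at `x` in one chart. A change of the chart
  -- multiplies both values from the left by the same element and cancels, so `u g` is locally
  -- constant and hence constant.
  let u : Γ → X → Q := fun g x => (σ (s x.pt) (g • x))⁻¹ * σ (s x.pt) x
  have hu : ∀ (g : Γ) (x : X) i, edist (i.1.toY ε) x.pt < ENNReal.ofReal (1 / 24) / 2 →
      u g x = (σ i (g • x))⁻¹ * σ i x := by
    intro g x i hi
    have h0 : edist ((s x.pt).1.toY ε) x.pt < ENNReal.ofReal (1 / 24) / 2 := by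
      rw [hs, edist_self]; exact hpos
    simp only [u]
    rw [hσ (s x.pt) i x h0 hi, hσ (s x.pt) i (g • x) h0 hi]
    group
  have hu_const : ∀ (g : Γ) x x', u g x = u g x' := by
    intro g
    have hlc : IsLocallyConstant (u g) := by
      refine (IsLocallyConstant.iff_eventually_eq _).2 fun x => ?_
      have h0 : edist ((s x.pt).1.toY ε) x.pt < ENNReal.ofReal (1 / 24) / 2 := by
        rw [hs, edist_self]; exact hpos
      have h1 := hloc (s x.pt) x h0
      have h2 := (continuous_const_smul g).continuousAt.eventually (hloc (s x.pt) (g • x) h0)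
      have h3 : ∀ᶠ x' in nhds x, edist ((s x.pt).1.toY ε) x'.pt < ENNReal.ofReal (1 / 24) / 2 :=
        (continuous_const.edist UniversalCover.continuous_pt).continuousAt.eventually_lt
          continuousAt_const h0
      filter_upwards [h1, h2, h3] with x' h1 h2 h3
      rw [hu g x' _ h3, hu g x _ h0, h1, h2]
    exact fun x x' => hlc.apply_eq_of_preconnectedSpace x x'
  obtain ⟨x₀⟩ : Nonempty X := (H.pathConnectedSpace (y₀ := y₀)).nonempty
  have hmul : ∀ g g' : Γ, u (g * g') x₀ = u g x₀ * u g' x₀ := by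
    intro g g'
    -- Moving the base point to `g' • x₀` makes the middle factors cancel.
    rw [hu_const g x₀ (g' • x₀)]
    have h0 : edist ((s x₀.pt).1.toY ε) x₀.pt < ENNReal.ofReal (1 / 24) / 2 := by
      rw [hs, edist_self]; exact hpos
    rw [hu g (g' • x₀) (s x₀.pt) h0, hu g' x₀ (s x₀.pt) h0, hu (g * g') x₀ (s x₀.pt) h0, mul_smul]
    group
  refine ⟨MonoidHom.mk' (fun g => u g x₀) hmul, fun e => (fT e)⁻¹, fun c => (fC c)⁻¹, ?_, ?_⟩
  · intro e m
    change u (D.torusHom e m) x₀ = _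
    have hv : (0 : Cov 3).snd ∈ Set.Icc 0 (thickness ε e : ℝ) := ⟨le_rfl, hw e⟩
    have hp : ∀ x, edist (torusMap ε e 0) (V.torus e (Cov.shift (torusPer e) x 0)).pt <
        ENNReal.ofReal (1 / 24) / 2 := fun x => by
      rw [V.pt_torus, torusMap_shift, edist_self]; exact hpos
    have hp0 : edist (torusMap ε e 0) (V.torus e 0).pt < ENNReal.ofReal (1 / 24) / 2 := by
      rw [V.pt_torus, edist_self]; exact hpos
    have hp1 : edist (torusMap ε e (Cov.shift (torusPer e) m.toAdd 0))
        (V.torus e (Cov.shift (torusPer e) m.toAdd 0)).pt < ENNReal.ofReal (1 / 24) / 2 := by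
      rw [V.pt_torus, edist_self]; exact hpos
    rw [hu_const _ x₀ (V.torus e 0), hu _ _ ⟨.inl (e, 0), hv⟩ hp0, hT']
    have e1 : D.torusHom e m • V.torus e 0 = V.torus e (Cov.shift (torusPer e) m.toAdd 0) :=
      (V.torus_shift e m.toAdd 0).symm
    have hv' : (Cov.shift (torusPer e) m.toAdd 0).snd ∈ Set.Icc 0 (thickness ε e : ℝ) := hv
    -- The translate by `m` is brought back to `0` by `-m`; the inverse in the definition of `u`
    -- restores the sign.
    rw [e1, hσ ⟨.inl (e, 0), hv⟩ ⟨.inl (e, Cov.shift (torusPer e) m.toAdd 0), hv'⟩ _ (hp _) hp1,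
      hT', D'.transport_torus (m := -m.toAdd) (by
        rw [← Cov.shift_add, neg_add_cancel, Cov.shift_zero, sub_self, norm_zero]; norm_num)]
    rw [ofAdd_neg, map_inv, ofAdd_toAdd]
    group
  · intro c b
    change u (D.tr c b) x₀ = _
    have ha : (toEnd b (0 : Cov 2)).snd ∈ Set.Icc (0 : ℝ) 1 := endU_mem b
    have hv : (endPt ε c b (toEnd b (0 : Cov 2))).snd ∈
      Set.Icc 0 (thickness ε (endTorus c b) : ℝ) := endCov_snd_mem _ _ _ _
    have e1 := V.cylinder_end c b (toEnd b 0) rfl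
    have e2 : (V.torus (endTorus c b) (endPt ε c b (toEnd b 0))).pt =
        cylinderMap ε c (toEnd b 0) := by
      rw [V.pt_torus, cylinderMap_eq_torusMap (b := b) rfl]
    have hp0 : edist (cylinderMap ε c (toEnd b 0))
        (V.torus (endTorus c b) (endPt ε c b (toEnd b 0))).pt < ENNReal.ofReal (1 / 24) / 2 := by
      rw [e2, edist_self]; exact hpos
    have hp1 : edist (torusMap ε (endTorus c b) (endPt ε c b (toEnd b 0)))
        (V.torus (endTorus c b) (endPt ε c b (toEnd b 0))).pt < ENNReal.ofReal (1 / 24) / 2 := by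
      rw [V.pt_torus, edist_self]; exact hpos
    rw [hu_const _ x₀ (V.torus (endTorus c b) (endPt ε c b (toEnd b 0))),
      hu _ _ ⟨.inr (c, toEnd b 0), ha⟩ hp0, ← e1, hC',
      hσ ⟨.inr (c, toEnd b 0), ha⟩ ⟨.inl (endTorus c b, endPt ε c b (toEnd b 0)), hv⟩ _ hp0 hp1,
      hT', D'.transport_end rfl]
    group

end TorusComplex
end

/-! ### The lifts of the pieces generate the fundamental group -/

noncomputable section

namespace TorusComplex

open LiftPt

variable {ε : ℝ≥0} {y₀ : YSpace ε}

local notation "Γ" => FundamentalGroup (YSpace ε) y₀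

local notation "X" => UniversalCover (YSpace ε) y₀

theorem Development.edist_torus_le {D : LocalSystem Γ} (V : Development D) {ρ : ℝ≥0}
    (H : UniformlyCN (YSpace ε) ρ) {e : TorusIndex} {x x' : Cov 3} {t : ℝ} (ht : ‖x - x'‖ ≤ t)
    (hρ : ENNReal.ofReal t < ρ) : edist (V.torus e x) (V.torus e x') ≤ ENNReal.ofReal t := by
  refine (H.edist_lift_le (V.continuous_torus e) (fun x x' => ?_)
    ((ENNReal.ofReal_le_ofReal ht).trans_lt hρ)).trans (ENNReal.ofReal_le_ofReal ht)
  rw [V.pt_torus, V.pt_torus, edist_eq_ofReal_rdist (edist_ne_top _ _)]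
  exact ENNReal.ofReal_le_ofReal (rdist_torusMap_le ε e x x')

theorem Development.edist_cylinder_le {D : LocalSystem Γ} (V : Development D) {ρ : ℝ≥0}
    (H : UniformlyCN (YSpace ε) ρ) {c : CylinderIndex} {x x' : Cov 2} {t : ℝ} (ht : ‖x - x'‖ ≤ t)
    (hρ : ENNReal.ofReal t < ρ) :
    edist (V.cylinder c x) (V.cylinder c x') ≤ ENNReal.ofReal t := by
  refine (H.edist_lift_le (V.continuous_cylinder c) (fun x x' => ?_)
    ((ENNReal.ofReal_le_ofReal ht).trans_lt hρ)).trans (ENNReal.ofReal_le_ofReal ht)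
  rw [V.pt_cylinder, V.pt_cylinder, edist_eq_ofReal_rdist (edist_ne_top _ _)]
  exact ENNReal.ofReal_le_ofReal (rdist_cylinderMap_le ε c x x')

/-- The subgroup contains the local system. -/
def LocalSystem.Within {Q : Type*} [Group Q] (D : LocalSystem Q) (K : Subgroup Q) : Prop :=
  (∀ e m, D.torusHom e m ∈ K) ∧ ∀ c b, D.tr c b ∈ K

theorem LocalSystem.Within.cylinderHom_mem {Q : Type*} [Group Q] {D : LocalSystem Q}
    {K : Subgroup Q} (h : D.Within K) (c : CylinderIndex) (m : Fin 2 → ℤ) :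
    D.cylinderHom c (.ofAdd m) ∈ K := by
  rw [D.rel c false]
  exact K.mul_mem (K.mul_mem (h.2 _ _) (h.1 _ _)) (K.inv_mem (h.2 _ _))

theorem Development.exists_anchor {D : LocalSystem Γ} (V : Development D) {ρ : ℝ≥0}
    (H : UniformlyCN (YSpace ε) ρ) {K : Subgroup Γ} (hK : D.Within K) {l l' : LiftPt}
    (hl : l.Valid ε) (h : ¬ SameCylinder l l') {δ : ℝ} (hδ : δ ≤ 1 / 2)
    (hρ : ENNReal.ofReal δ < ρ) (hd : rdist (l.toY ε) (l'.toY ε) < δ) :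
    ∃ κ ∈ K, edist (V.lift l) (κ • V.torus (anchorTorus l) (anchorCov ε l)) ≤ ENNReal.ofReal δ := by
  rcases l with ⟨e, x⟩ | ⟨c, a⟩
  · refine ⟨1, K.one_mem, ?_⟩
    rw [one_smul]
    exact (edist_self _).le.trans zero_le
  · refine ⟨D.tr c (closeEnd a), hK.2 _ _, ?_⟩
    have e1 := V.cylinder_end c (closeEnd a) (toEnd (closeEnd a) a) rfl
    refine le_trans (le_of_eq (congrArg _ e1.symm)) ?_
    refine V.edist_cylinder_le H ?_ hρ
    rw [norm_sub_toEnd]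
    refine (rdist_anchor_lt_of_exit hl ?_ hδ hd).1.le
    rcases l' with ⟨e, x⟩ | ⟨c', a'⟩
    · exact exitDist_le_torusMap ε _ _ _ _
    · exact exitDist_le_of_ne ε _ _ h _ _

/-- Lifts of close points are close up to an element of the group that the local system
generates. -/
theorem Development.exists_close {D : LocalSystem Γ} (V : Development D) {ρ : ℝ≥0}
    (H : UniformlyCN (YSpace ε) ρ) {K : Subgroup Γ} (hK : D.Within K) {l l' : LiftPt}
    (hl : l.Valid ε) (hl' : l'.Valid ε) {δ : ℝ} (hδ : δ ≤ 1 / 24)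
    (hρ : ENNReal.ofReal (3 * δ) < ρ) (hd : rdist (l.toY ε) (l'.toY ε) < δ) :
    ∃ κ ∈ K, edist (V.lift l) (κ • V.lift l') ≤ ENNReal.ofReal (5 * δ) := by
  have hδ0 : 0 < δ := (rdist_nonneg _ _).trans_lt hd
  have hρ' : ENNReal.ofReal δ < ρ :=
    (ENNReal.ofReal_le_ofReal (by linarith)).trans_lt hρ
  by_cases h : SameCylinder l l'
  · rcases l with ⟨e, x⟩ | ⟨c, a⟩
    · exact h.elim
    rcases l' with ⟨e, x⟩ | ⟨c', a'⟩
    · exact h.elim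
    have hc : c = c' := h
    subst hc
    obtain ⟨m, hm⟩ := exists_shift_of_sameCylinder hl hl' (by linarith) hd
    refine ⟨D.cylinderHom c (.ofAdd m), hK.cylinderHom_mem c m, ?_⟩
    change edist (V.cylinder c a) (_ • V.cylinder c a') ≤ _
    rw [← V.cylinder_shift]
    exact (V.edist_cylinder_le H hm.le hρ').trans (ENNReal.ofReal_le_ofReal (by linarith))
  · obtain ⟨κ, hκ, h1⟩ := V.exists_anchor H hK hl h (by linarith) hρ' hd
    obtain ⟨κ', hκ', h2⟩ := V.exists_anchor H hK hl' (fun h' => h h'.symm) (by linarith) hρ'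
      (by rwa [rdist_comm] at hd)
    obtain ⟨he, m, hm⟩ := exists_shift_anchorCov hl hl' h hδ hd
    have h3 := V.edist_torus_le H (e := anchorTorus l) hm.le hρ
    rw [V.torus_shift] at h3
    rw [← he] at h2
    refine ⟨κ * D.torusHom (anchorTorus l) (.ofAdd m) * κ'⁻¹,
      K.mul_mem (K.mul_mem hκ (hK.1 _ _)) (K.inv_mem hκ'), ?_⟩
    refine (edist_triangle4 _ (κ • V.torus (anchorTorus l) (anchorCov ε l))
      (κ • D.torusHom (anchorTorus l) (.ofAdd m) •
      V.torus (anchorTorus l) (anchorCov ε l')) _).trans ?_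
    have e5 : ENNReal.ofReal (5 * δ) = ENNReal.ofReal δ + ENNReal.ofReal (3 * δ) +
        ENNReal.ofReal δ := by
      rw [← ENNReal.ofReal_add hδ0.le (by linarith), ← ENNReal.ofReal_add (by linarith) hδ0.le]
      congr 1; ring
    rw [e5]
    refine add_le_add (add_le_add h1 ?_) ?_
    · rw [UniversalCover.edist_smul]; exact h3
    · rw [mul_smul, mul_smul, UniversalCover.edist_smul, UniversalCover.edist_smul,
        ← UniversalCover.edist_smul κ', smul_inv_smul, edist_comm]
      exact h2

/-- The local system of a development generates the fundamental group. -/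
theorem Development.eq_top {D : LocalSystem Γ} (V : Development D) {K : Subgroup Γ}
    (hK : D.Within K) : K = ⊤ := by
  obtain ⟨ρ, H⟩ := uniformlyCN ε
  -- The bound `6 δ < ρ` allows for `δ` between the two points and `5 δ` from `exists_close`. Below
  -- `ρ` two points of one fibre coincide.
  obtain ⟨δ, hδ0, hδ, hδ'⟩ : ∃ δ : ℝ, 0 < δ ∧ δ ≤ 1 / 24 ∧ 6 * δ < ρ := by
    have hρ : (0 : ℝ) < ρ := H.pos
    refine ⟨min (1 / 24) (ρ / 12), lt_min (by norm_num) (by positivity), min_le_left _ _, ?_⟩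
    have := min_le_right (1 / 24) ((ρ : ℝ) / 12)
    linarith
  have hlt : ∀ t : ℝ, t ≤ 6 * δ → ENNReal.ofReal t < ρ := fun t ht => by
    rw [← ENNReal.ofReal_coe_nnreal]
    have hp : (0 : ℝ) < ρ := H.pos
    exact (ENNReal.ofReal_lt_ofReal_iff hp).2 (ht.trans_lt hδ')
  have key : ∀ {κ : Γ} {l l' : LiftPt} (x' : X), l.Valid ε → l'.Valid ε → x'.pt = l'.toY ε →
      edist (κ • V.lift l) x' < ENNReal.ofReal δ → ∃ κ' ∈ K, x' = (κ * κ') • V.lift l' := by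
    intro κ l l' x' hl hl' hx' hd
    have h1 : rdist (l.toY ε) (l'.toY ε) < δ := by
      have := (UniversalCover.edist_pt_le _ _).trans_lt hd
      have e1 : (κ • V.lift l).pt = l.toY ε := V.pt_lift l
      rwa [e1, hx', edist_eq_ofReal_rdist (edist_ne_top _ _),
        ENNReal.ofReal_lt_ofReal_iff hδ0] at this
    obtain ⟨κ', hκ', h2⟩ := V.exists_close H hK hl hl' hδ (hlt _ (by linarith)) h1
    refine ⟨κ', hκ', H.eq_of_pt_eq ?_ (hx'.trans (V.pt_lift l').symm)⟩
    calc edist x' ((κ * κ') • V.lift l')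
        ≤ edist x' (κ • V.lift l) + edist (κ • V.lift l) ((κ * κ') • V.lift l') :=
          edist_triangle _ _ _
      _ ≤ ENNReal.ofReal δ + ENNReal.ofReal (5 * δ) := by
          rw [edist_comm x', mul_smul, UniversalCover.edist_smul]
          exact add_le_add hd.le h2
      _ = ENNReal.ofReal (6 * δ) := by
          rw [← ENNReal.ofReal_add hδ0.le (by linarith)]; congr 1; ring
      _ < ρ := hlt _ le_rfl
  -- The `K`-translates of the lifted pieces form a set that contains the `δ`-ball around each of
  -- its points. It is therefore open and closed, and it is the whole cover. As the action is free,
  -- every deck transformation then lies in `K`.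
  let O : Set X := {x | ∃ κ ∈ K, ∃ l : LiftPt, l.Valid ε ∧ x = κ • V.lift l}
  have hnear : ∀ x ∈ O, ∀ x', edist x x' < ENNReal.ofReal δ → x' ∈ O := by
    rintro _ ⟨κ, hκ, l, hl, rfl⟩ x' hd
    obtain ⟨l', hl', h⟩ := exists_valid_lift x'.pt
    obtain ⟨κ', hκ', e⟩ := key x' hl hl' h.symm hd
    exact ⟨κ * κ', K.mul_mem hκ hκ', l', hl', e⟩
  have hopen : IsOpen O := by
    refine EMetric.isOpen_iff.2 fun x hx => ⟨_, ENNReal.ofReal_pos.2 hδ0, fun x' hx' => ?_⟩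
    exact hnear x hx x' (Metric.mem_eball'.1 hx')
  have hclosed : IsClosed O := by
    refine ⟨EMetric.isOpen_iff.2 fun x hx => ⟨_, ENNReal.ofReal_pos.2 hδ0, fun x' hx' hO => ?_⟩⟩
    exact hx (hnear x' hO x (Metric.mem_eball.1 hx'))
  have := H.pathConnectedSpace (y₀ := y₀)
  have hl : LiftPt.Valid ε (.inl (.x, 0)) := ⟨le_rfl, NNReal.coe_nonneg _⟩
  have huniv : O = Set.univ := IsClopen.eq_univ ⟨hclosed, hopen⟩
    ⟨_, 1, K.one_mem, _, hl, (one_smul _ _).symm⟩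
  refine (Subgroup.eq_top_iff' K).2 fun g => ?_
  obtain ⟨κ, hκ, l, hl', e⟩ : g • V.lift (.inl (.x, 0)) ∈ O := huniv ▸ Set.mem_univ _
  obtain ⟨κ', hκ', e'⟩ := key (κ := κ) (l := l) (g • V.lift (.inl (.x, 0))) hl' hl
    (V.pt_lift _) (by rw [e, edist_self]; exact ENNReal.ofReal_pos.2 hδ0)
  rw [smul_left_cancel_lift e']
  exact K.mul_mem hκ hκ'

end TorusComplex
end

noncomputable section

/-! ### Free groups -/

namespace FreeGroup

variable {α : Type*}

section CommonPrefix

variable {β : Type*} [DecidableEq β]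

/-- The length of the longest common prefix of two lists. -/
def commonPrefix : List β → List β → ℕ
  | a :: l, b :: l' => if a = b then commonPrefix l l' + 1 else 0
  | _, _ => 0

theorem min_commonPrefix_le (l m n : List β) :
    min (commonPrefix l m) (commonPrefix m n) ≤ commonPrefix l n := by
  induction l generalizing m n with
  | nil => simp [commonPrefix]
  | cons a l ih =>
    rcases m with _ | ⟨b, m⟩
    · simp [commonPrefix]
    rcases n with _ | ⟨c, n⟩
    · simp [commonPrefix]
    have := ih m n
    simp only [commonPrefix]
    by_cases h1 : a = b
    · by_cases h2 : b = c
      · subst h1 h2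
        simp only [if_true]
        omega
      · simp [h2]
    · simp [h1]

theorem commonPrefix_comm (l m : List β) : commonPrefix l m = commonPrefix m l := by
  induction l generalizing m with
  | nil => cases m <;> simp [commonPrefix]
  | cons a l ih =>
    cases m with
    | nil => simp [commonPrefix]
    | cons b m => simp only [commonPrefix, ih m, eq_comm]

end CommonPrefix

variable [DecidableEq α]

theorem norm_mk_of_isReduced {L : List (α × Bool)} (h : IsReduced L) : norm (mk L) = L.length := by
  rw [norm, toWord_mk, h.reduce_eq]

theorem isReduced_invRev {L : List (α × Bool)} (h : IsReduced L) : IsReduced (invRev L) := by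
  rw [isReduced_iff_reduce_eq, reduce_invRev, h.reduce_eq]

/-- In the tree of reduced words the length of the common prefix is the Gromov product: the prefix
cancels, and nothing else does. -/
theorem norm_inv_mul_mk {L M : List (α × Bool)} (hL : IsReduced L) (hM : IsReduced M) :
    norm ((mk L)⁻¹ * mk M) + 2 * commonPrefix L M = L.length + M.length := by
  induction L generalizing M with
  | nil =>
    rw [show (mk ([] : List (α × Bool))) = 1 from rfl, inv_one, one_mul, norm_mk_of_isReduced hM]
    simp [commonPrefix]
  | cons a L ih =>
    cases M with
    | nil =>
      rw [show (mk ([] : List (α × Bool))) = 1 from rfl, mul_one, norm_inv_eq,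
        norm_mk_of_isReduced hL]
      simp [commonPrefix]
    | cons b M =>
      simp only [commonPrefix]
      by_cases h : a = b
      · subst h
        have e : ∀ K : List (α × Bool), mk (a :: K) = mk [a] * mk K := fun K => by
          rw [mul_mk]; rfl
        have := ih (M := M) (hL.infix ⟨[a], [], by simp⟩) (hM.infix ⟨[a], [], by simp⟩)
        rw [e L, e M, mul_inv_rev, mul_assoc, inv_mul_cancel_left, if_pos rfl]
        simp only [List.length_cons]
        omega
      · rw [if_neg h, inv_mk, mul_mk, norm_mk_of_isReduced]
        · simp
        · rw [IsReduced, List.isChain_append]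
          refine ⟨isReduced_invRev hL, hM, fun x hx y hy hxy => ?_⟩
          simp only [invRev, List.map_cons, List.reverse_cons, List.getLast?_concat,
            Option.mem_def, Option.some.injEq, List.head?_cons] at hx hy
          subst hx hy
          by_contra h'
          refine h (Prod.ext hxy ?_)
          cases h1 : a.2 <;> cases h2 : b.2 <;> simp_all

theorem norm_inv_mul (x y : FreeGroup α) :
    norm (x⁻¹ * y) + 2 * commonPrefix x.toWord y.toWord = norm x + norm y := by
  have := norm_inv_mul_mk (isReduced_toWord (x := x)) (isReduced_toWord (x := y))
  rwa [mk_toWord, mk_toWord] at this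

theorem wordLength_range_of (g : FreeGroup α) : wordLength (Set.range of) g = norm g := by
  have h : ∀ L : List (α × Bool), ∃ l : List (FreeGroup α), l.length = L.length ∧
      (∀ x ∈ l, x ∈ Set.range of ∨ x⁻¹ ∈ Set.range of) ∧ l.prod = mk L := by
    intro L
    refine ⟨L.map fun a => mk [a], by simp, ?_, ?_⟩
    · simp only [List.mem_map]
      rintro _ ⟨⟨a, b⟩, -, rfl⟩
      cases b
      · exact Or.inr ⟨a, rfl⟩
      · exact Or.inl ⟨a, rfl⟩
    · induction L with
      | nil => rfl
      | cons a L ih => rw [List.map_cons, List.prod_cons, ih, mul_mk]; rfl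
  obtain ⟨l, h1, h2, h3⟩ := h g.toWord
  rw [mk_toWord] at h3
  refine le_antisymm (Nat.sInf_le ⟨l, h1, h2, h3⟩) ?_
  obtain ⟨l', h1', h2', h3'⟩ := Nat.sInf_mem (s := {n | ∃ l : List (FreeGroup α), l.length = n ∧
    (∀ x ∈ l, x ∈ Set.range of ∨ x⁻¹ ∈ Set.range of) ∧ l.prod = g}) ⟨_, l, rfl, h2, h3⟩
  rw [wordLength, ← h1', ← h3']
  clear h1' h3'
  induction l' with
  | nil => simp
  | cons x l' ih =>
    rw [List.prod_cons, List.length_cons, add_comm]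
    refine (norm_mul_le _ _).trans (add_le_add ?_ (ih fun y hy => h2' y
        (List.mem_cons_of_mem _ hy)))
    rcases h2' x List.mem_cons_self with ⟨a, rfl⟩ | ⟨a, h⟩
    · simp
    · rw [← norm_inv_eq, ← h, norm_of]

/-- After translation of `w` to the identity, the four point condition with `δ = 0` is the
ultrametric inequality for common prefixes. -/
theorem isHyperbolicGroup [Finite α] : IsHyperbolicGroup (FreeGroup α) := by
  refine ⟨Set.range of, Set.finite_range _, closure_range_of α, 0, fun w x y z => ?_⟩
  simp only [wordDist, wordLength_range_of]
  have e : ∀ a b : FreeGroup α, a⁻¹ * b = (w⁻¹ * a)⁻¹ * (w⁻¹ * b) := fun a b => by group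
  rw [e y z, e x z, e x y]
  have h1 := norm_inv_mul (w⁻¹ * y) (w⁻¹ * z)
  have h2 := norm_inv_mul (w⁻¹ * x) (w⁻¹ * z)
  have h3 := norm_inv_mul (w⁻¹ * x) (w⁻¹ * y)
  have h4 := min_commonPrefix_le (w⁻¹ * y).toWord (w⁻¹ * x).toWord (w⁻¹ * z).toWord
  rw [commonPrefix_comm (w⁻¹ * y).toWord] at h4
  omega

/-- Induction on the length of `g`. A first letter `a` or its inverse is split off. If `g` begins
with another letter, nothing cancels in `aⁿ g`, hence nothing cancels in `g aⁿ` either, and equal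
reduced words would begin with different letters. -/
theorem mem_zpowers_of_commute_pow {a : α} {n : ℕ} (hn : n ≠ 0) {g : FreeGroup α}
    (h : Commute (of a ^ n) g) : g ∈ Subgroup.zpowers (of a) := by
  induction hN : norm g using Nat.strong_induction_on generalizing g with
  | _ N ih =>
  rcases hw : g.toWord with _ | ⟨⟨b, s⟩, L⟩
  · rw [toWord_eq_nil_iff.1 hw]; exact one_mem _
  have hred : IsReduced ((b, s) :: L) := hw ▸ isReduced_toWord
  have hg : g = mk [(b, s)] * mk L := by rw [← mk_toWord (x := g), hw, mul_mk]; rfl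
  by_cases hb : b = a
  · subst hb
    have hs : mk [(b, s)] ∈ Subgroup.zpowers (of b) := by
      cases s
      · exact inv_mem (Subgroup.mem_zpowers (of b))
      · exact Subgroup.mem_zpowers (of b)
    rw [hg]
    refine mul_mem hs (ih _ ?_ ?_ rfl)
    · rw [norm_mk_of_isReduced (hred.infix ⟨[(b, s)], [], by simp⟩), ← hN, norm, hw]
      simp
    · have : mk L = (mk [(b, s)])⁻¹ * g := by rw [hg, inv_mul_cancel_left]
      rw [this]
      refine Commute.mul_right (Commute.inv_right ?_) h
      obtain ⟨k, hk⟩ := hs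
      rw [← hk]
      exact ((Commute.refl (of b)).pow_left n).zpow_right k
  · exfalso
    have hrep : (of a ^ n).toWord = List.replicate n (a, true) := toWord_of_pow a n
    have h1 : IsReduced (List.replicate n (a, true) ++ g.toWord) := by
      rw [IsReduced, List.isChain_append]
      refine ⟨hrep ▸ isReduced_toWord, isReduced_toWord, fun x hx y hy hxy => ?_⟩
      rw [hw] at hy
      simp only [List.head?_cons, Option.mem_def, Option.some.injEq] at hy
      have := List.eq_of_mem_replicate (List.mem_of_mem_getLast? hx)
      subst this hy
      exact (hb hxy.symm).elim
    have h2 : reduce (g.toWord ++ List.replicate n (a, true)) =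
        List.replicate n (a, true) ++ g.toWord := by
      rw [← hrep, ← toWord_mul, ← h.eq, toWord_mul, hrep, h1.reduce_eq]
    -- Reduction yields a sublist; one of full length is the whole list.
    have h3 : reduce (g.toWord ++ List.replicate n (a, true)) =
        g.toWord ++ List.replicate n (a, true) := by
      refine (reduce.red.sublist).eq_of_length ?_
      rw [h2, List.length_append, List.length_append, add_comm]
    rw [h3, hw] at h2
    obtain ⟨n, rfl⟩ := Nat.exists_eq_succ_of_ne_zero hn
    rw [List.replicate_succ] at h2
    simp only [List.cons_append, List.cons.injEq, Prod.mk.injEq] at h2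
    exact hb h2.1.1

/-- The exponent sum of a generator. -/
def exponentSum (a : α) : FreeGroup α →* Multiplicative ℤ :=
  lift fun b => .ofAdd (if b = a then 1 else 0)

theorem exponentSum_of_zpow (a b : α) (n : ℤ) :
    exponentSum a (of b ^ n) = .ofAdd (if b = a then n else 0) := by
  rw [map_zpow, exponentSum, lift_apply_of, ← ofAdd_zsmul]
  split_ifs <;> simp

/-- The exponent sum of `a` is invariant under conjugation, which gives `b = a` and `k = n`; then
`g` commutes with a power of `a`. -/
theorem eq_and_mem_zpowers_of_conj_eq {a b : α} {n : ℕ} (hn : n ≠ 0) {k : ℤ} {g : FreeGroup α}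
    (h : g * of b ^ k * g⁻¹ = of a ^ n) : b = a ∧ g ∈ Subgroup.zpowers (of a) := by
  have h1 := congrArg (exponentSum a) h
  rw [_root_.map_mul, _root_.map_mul, _root_.map_inv, mul_comm, inv_mul_cancel_left,
      exponentSum_of_zpow,
    ← zpow_natCast, exponentSum_of_zpow, if_pos rfl] at h1
  have h2 : (if b = a then k else 0) = (n : ℤ) := h1
  by_cases hb : b = a
  · subst hb
    rw [if_pos rfl] at h2
    subst h2
    rw [zpow_natCast] at h
    exact ⟨rfl, mem_zpowers_of_commute_pow hn (eq_mul_inv_iff_mul_eq.1 h.symm)⟩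
  · rw [if_neg hb] at h2
    omega

/-- A cyclic subgroup of finite index would contain powers of two different generators, and these do
not commute. -/
theorem not_isElementaryGroup [Nontrivial α] : ¬ IsElementaryGroup (FreeGroup α) := by
  rintro ⟨H, hH, hH'⟩
  obtain ⟨a, b, hab⟩ := exists_pair_ne α
  obtain ⟨n, hn, -, hn'⟩ := Subgroup.exists_pow_mem_of_index_ne_zero hH'.index_ne_zero (of a)
  obtain ⟨m, hm, -, hm'⟩ := Subgroup.exists_pow_mem_of_index_ne_zero hH'.index_ne_zero (of b)
  have hc : Commute (of a ^ n) (of b ^ m) := by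
    have := IsCyclic.isMulCommutative (α := H)
    exact congrArg Subtype.val (mul_comm' (⟨_, hn'⟩ : H) ⟨_, hm'⟩)
  obtain ⟨k, hk⟩ := mem_zpowers_of_commute_pow hn.ne' hc
  have h1 := congrArg (exponentSum b) (show of a ^ k = of b ^ m from hk)
  rw [exponentSum_of_zpow, ← zpow_natCast, exponentSum_of_zpow, if_pos rfl, if_neg hab] at h1
  have h2 : (0 : ℤ) = m := h1
  omega

end FreeGroup

/-! ### Invariance under isomorphisms -/

theorem wordLength_map {G H : Type*} [Group G] [Group H] (f : G ≃* H) (S : Set G) (g : G) :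
    wordLength (f '' S) (f g) = wordLength S g := by
  unfold wordLength
  congr 1
  ext n
  constructor
  · rintro ⟨l, rfl, h, e⟩
    refine ⟨l.map f.symm, by simp, ?_, ?_⟩
    · simp only [List.mem_map]
      rintro _ ⟨x, hx, rfl⟩
      refine (h x hx).imp ?_ ?_
      · rintro ⟨y, hy, rfl⟩; simpa using hy
      · rintro ⟨y, hy, e⟩; rw [← map_inv, ← e]; simpa using hy
    · rw [← map_list_prod, e, f.symm_apply_apply]
  · rintro ⟨l, rfl, h, rfl⟩
    refine ⟨l.map f, by simp, ?_, (map_list_prod f l).symm⟩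
    simp only [List.mem_map]
    rintro _ ⟨x, hx, rfl⟩
    refine (h x hx).imp (fun h => ⟨x, h, rfl⟩) (fun h => ⟨x⁻¹, h, map_inv f x⟩)

theorem IsHyperbolicGroup.of_equiv {G H : Type*} [Group G] [Group H] (f : G ≃* H)
    (h : IsHyperbolicGroup G) : IsHyperbolicGroup H := by
  obtain ⟨S, hS, hS', δ, hδ⟩ := h
  refine ⟨f '' S, hS.image f, ?_, δ, fun w x y z => ?_⟩
  · rw [← MulEquiv.coe_toMonoidHom, ← MonoidHom.map_closure, hS', ← MonoidHom.range_eq_map,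
      MonoidHom.range_eq_top]
    exact f.surjective
  · have e : ∀ a b : H, wordDist (f '' S) a b = wordDist S (f.symm a) (f.symm b) := fun a b => by
      rw [wordDist, wordDist, ← wordLength_map f]
      simp
    simp only [e]
    exact hδ _ _ _ _

theorem IsElementaryGroup.of_equiv {G H : Type*} [Group G] [Group H] (f : G ≃* H)
    (h : IsElementaryGroup G) : IsElementaryGroup H := by
  obtain ⟨K, hK, hK'⟩ := h
  refine ⟨K.map f.toMonoidHom, ?_, ?_⟩
  · exact isCyclic_of_surjective (f.subgroupMap K) (f.subgroupMap K).surjective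
  · constructor
    exact (Subgroup.index_map_equiv K f).trans_ne hK'.index_ne_zero

end

noncomputable section

namespace TorusComplex

/-! ### The graph of groups of the torus complex -/

instance : DecidableEq TorusIndex
  | .x, .x => isTrue rfl
  | .x, .e _ _ => isFalse nofun
  | .e _ _, .x => isFalse nofun
  | .e g i, .e g' i' => decidable_of_iff (g = g' ∧ i = i') (by simp)

instance : Fintype TorusIndex :=
  Fintype.ofList (.x :: (List.finRange 4).map (.e false) ++ (List.finRange 4).map (.e true)) (by
    rintro (_ | ⟨g, i⟩)
    · simp
    · cases g <;> simp)

/-- The edges of the graph at a vertex; the two ends of a loop are counted separately. -/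
abbrev EdgeEnds (v : Bool × Fin 4) : Type := {p : Bool × TorusIndex // torusGraph.bd p.1 p.2 = v}

theorem card_edgeEnds (v : Bool × Fin 4) :
    Fintype.card (EdgeEnds v) = if v.2 = 0 then 3 else 2 := by
  revert v; decide

instance (v : Bool × Fin 4) : Nontrivial (EdgeEnds v) := by
  rw [← Fintype.one_lt_card_iff_nontrivial, card_edgeEnds]
  split_ifs <;> norm_num

/-- The splitting of `ℤ³` with the subgroup of all `(m₀, a m₀, m₁)`. -/
def shearSplit (a : ℤ) : (Fin 3 → ℤ) ≃+ ℤ × (Fin 2 → ℤ) where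
  toFun n := (n 1 - a * n 0, ![n 0, n 2])
  invFun p := ![p.2 0, p.1 + a * p.2 0, p.2 1]
  left_inv n := by ext j; fin_cases j <;> simp
  right_inv p := by
    refine Prod.ext (by simp) ?_
    ext j; fin_cases j <;> simp
  map_add' n n' := by
    refine Prod.ext ?_ ?_
    · simp; ring
    · ext j; fin_cases j <;> simp

/-- The splitting of `ℤ³` with the subgroup of all `(0, m₀, m₁)`. -/
def consSplit : (Fin 3 → ℤ) ≃+ ℤ × (Fin 2 → ℤ) where
  toFun n := (n 0, ![n 1, n 2])
  invFun p := ![p.1, p.2 0, p.2 1]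
  left_inv n := by ext j; fin_cases j <;> simp
  right_inv p := by
    refine Prod.ext (by simp) ?_
    ext j; fin_cases j <;> simp
  map_add' n n' := by
    refine Prod.ext (by simp) ?_
    ext j; fin_cases j <;> simp

/-- The splitting of `ℤ³` with the subgroup of all `(-m₀, m₁, 0)`. -/
def snocSplit : (Fin 3 → ℤ) ≃+ ℤ × (Fin 2 → ℤ) where
  toFun n := (n 2, ![-n 0, n 1])
  invFun p := ![-p.2 0, p.2 1, p.1]
  left_inv n := by ext j; fin_cases j <;> simp
  right_inv p := by
    refine Prod.ext (by simp) ?_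
    ext j; fin_cases j <;> simp
  map_add' n n' := by
    refine Prod.ext (by simp) ?_
    ext j; fin_cases j <;> simp [add_comm]

/-- The splitting of the group of an edge at its end `s`. -/
def edgeSplit : Bool → TorusIndex → (Fin 3 → ℤ) ≃+ ℤ × (Fin 2 → ℤ)
  | true, .e _ 0 => shearSplit (-1)
  | false, .e _ 0 => shearSplit 0
  | true, .e _ 1 => shearSplit 0
  | false, .e _ 1 => shearSplit (-1)
  | true, .e _ 2 => consSplit
  | false, .e _ 2 => shearSplit 1
  | true, .e _ 3 => shearSplit 1
  | false, .e _ 3 => consSplit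
  | true, .x => snocSplit
  | false, .x => shearSplit 0

/-- The generator of the group of `torusGraph.bd s e` that belongs to the end `s` of `e`. -/
abbrev edgeGen (s : Bool) (e : TorusIndex) : FreeGroup (EdgeEnds (torusGraph.bd s e)) :=
  FreeGroup.of ⟨(s, e), rfl⟩

/-- The monomorphism of an edge group to a vertex group. -/
def edgeIncl (s : Bool) (e : TorusIndex) : Multiplicative (Fin 3 → ℤ) →*
    FreeGroup (EdgeEnds (torusGraph.bd s e)) × Multiplicative (Fin 2 → ℤ) :=
  ((zpowersHom _ (edgeGen s e)).comp
      ((AddMonoidHom.fst _ _).comp (edgeSplit s e).toAddMonoidHom).toMultiplicative).prod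
    ((AddMonoidHom.snd _ _).comp (edgeSplit s e).toAddMonoidHom).toMultiplicative

theorem edgeIncl_apply (s : Bool) (e : TorusIndex) (n : Fin 3 → ℤ) : edgeIncl s e (.ofAdd n) =
    (edgeGen s e ^ (edgeSplit s e n).1, .ofAdd (edgeSplit s e n).2) := rfl

theorem of_zpow_eq_one {α : Type*} {a : α} {k : ℤ} (h : FreeGroup.of a ^ k = 1) : k = 0 := by
  classical
  have h1 := FreeGroup.exponentSum_of_zpow a a k
  rw [h, _root_.map_one, if_pos rfl] at h1
  exact (Multiplicative.ofAdd.injective h1).symm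

/-- The image of an edge group is the full product of the cyclic group of its generator with `ℤ²`;
this reduces commensurability to the free factor. -/
theorem mem_range_edgeIncl {s : Bool} {e : TorusIndex}
    {x : FreeGroup (EdgeEnds (torusGraph.bd s e)) × Multiplicative (Fin 2 → ℤ)} :
    x ∈ (edgeIncl s e).range ↔ x.1 ∈ Subgroup.zpowers (edgeGen s e) := by
  constructor
  · rintro ⟨n, rfl⟩
    exact ⟨_, rfl⟩
  · rintro ⟨k, hk⟩
    refine ⟨.ofAdd ((edgeSplit s e).symm (k, x.2.toAdd)), ?_⟩
    rw [edgeIncl_apply, AddEquiv.apply_symm_apply]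
    exact Prod.ext hk rfl

theorem connectedBy_torusGraph {T : Set TorusIndex} (h : ∀ e, (∀ g, e ≠ .e g 0) → e ∈ T) :
    torusGraph.ConnectedBy T := by
  let R := fun a b : Bool × Fin 4 => ∃ e ∈ T, torusGraph.bd false e = a ∧ torusGraph.bd true e = b
  have h1 : ∀ g (i : Fin 4), i ≠ 3 → Relation.EqvGen R (g, i) (g, i + 1) := fun g i hi =>
    .rel _ _ ⟨.e g (i + 1), h _ (fun g' hg => by injection hg with _ h; revert i; decide),
      by simp [torusGraph], rfl⟩
  have h2 : ∀ g (i : Fin 4), Relation.EqvGen R (g, 0) (g, i) := by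
    intro g i
    fin_cases i
    · exact .refl _
    · exact h1 g 0 (by decide)
    · exact (h1 g 0 (by decide)).trans _ _ _ (h1 g 1 (by decide))
    · exact ((h1 g 0 (by decide)).trans _ _ _ (h1 g 1 (by decide))).trans _ _ _
        (h1 g 2 (by decide))
  have h3 : ∀ g, Relation.EqvGen R (false, 0) (g, 0) := by
    rintro (_ | _)
    · exact .refl _
    · exact .rel _ _ ⟨.x, h _ nofun, rfl, rfl⟩
  have h4 : ∀ v, Relation.EqvGen R (false, 0) v := fun v => (h3 v.1).trans _ _ _ (h2 v.1 v.2)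
  exact ⟨⟨(false, 0)⟩, fun v w => (h4 v).symm.trans _ _ _ (h4 w)⟩

/-- The graph of groups. -/
def torusGroups : GraphOfGroups torusGraph where
  connected := connectedBy_torusGraph fun _ _ => Set.mem_univ _
  vertexGroup v := FreeGroup (EdgeEnds v) × Multiplicative (Fin 2 → ℤ)
  edgeGroup _ := Multiplicative (Fin 3 → ℤ)
  ι := edgeIncl
  ι_injective s e := by
    refine (injective_iff_map_eq_one _).2 fun n hn => ?_
    have h1 : (edgeIncl s e n).1 = 1 := congrArg Prod.fst hn
    have h2 : (edgeIncl s e n).2 = 1 := congrArg Prod.snd hn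
    have h3 : (edgeSplit s e n.toAdd).1 = 0 := of_zpow_eq_one h1
    have h4 : (edgeSplit s e n.toAdd).2 = 0 := h2
    have h5 : edgeSplit s e n.toAdd = 0 := Prod.ext h3 h4
    exact (AddEquiv.map_eq_zero_iff _).1 h5

/-- The edges of a maximal subtree. -/
def torusTree : Set TorusIndex := {e | ∀ g, e ≠ .e g 0}

/-- A function that is constant along the edges of `T` is constant on the components. With
`treeSide` it shows that no edge of the tree can be omitted. -/
theorem not_connectedBy_of_invariant {𝒢 : OrientedGraph} {T : Set 𝒢.E} (f : 𝒢.V → Bool)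
    (h : ∀ e ∈ T, f (𝒢.bd false e) = f (𝒢.bd true e)) {v w : 𝒢.V} (hvw : f v ≠ f w) :
    ¬ 𝒢.ConnectedBy T := fun hc => hvw (by
  induction hc.2 v w with
  | rel _ _ h' => obtain ⟨e, he, rfl, rfl⟩ := h'; exact h e he
  | refl _ => rfl
  | symm _ _ _ ih => exact (ih fun h' => hvw h'.symm).symm
  | trans _ y _ _ _ ih1 ih2 =>
    by_contra h'
    by_cases h1 : f v = f y
    all_goals simp_all)

/-- The vertices that an edge of the maximal subtree separates from the rest of the tree. -/
def treeSide : TorusIndex → Bool × Fin 4 → Bool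
  | .x => fun v => v.1
  | .e g i => fun v => decide (v.1 = g ∧ i ≤ v.2)

theorem treeSide_eq {e e' : TorusIndex} (he : ∀ g, e ≠ .e g 0) (he' : ∀ g, e' ≠ .e g 0)
    (h : e' ≠ e) :
    treeSide e (torusGraph.bd false e') = treeSide e (torusGraph.bd true e') := by
  revert e e'; decide

theorem treeSide_ne {e : TorusIndex} (he : ∀ g, e ≠ .e g 0) :
    treeSide e (torusGraph.bd false e) ≠ treeSide e (torusGraph.bd true e) := by
  revert e; decide

theorem isMaximalSubtree_torusTree : torusGraph.IsMaximalSubtree torusTree := by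
  refine ⟨connectedBy_torusGraph fun _ h => h, fun S hS hST e he => ?_⟩
  by_contra heS
  exact not_connectedBy_of_invariant (𝒢 := torusGraph) (treeSide e)
    (fun e' he' => treeSide_eq he (hST he') (ne_of_mem_of_not_mem he' heS)) (treeSide_ne he) hS

/-- Such a `u` lies in the fibre group of the terminal vertex and completes that of the initial
vertex to `ℤ³`; here the directions of the cylinders at the two ends of an edge matter. -/
theorem exists_edgeSplit (e : TorusIndex) :
    ∃ u, (edgeSplit true e u).1 = 0 ∧ (edgeSplit false e u).1 = 1 := by
  rcases e with _ | ⟨g, i⟩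
  · exact ⟨![0, 1, 0], by simp [edgeSplit, snocSplit, shearSplit]⟩
  · fin_cases i
    · exact ⟨![-1, 1, 0], by simp [edgeSplit, shearSplit]⟩
    · exact ⟨![1, 0, 0], by simp [edgeSplit, shearSplit]⟩
    · exact ⟨![0, 1, 0], by simp [edgeSplit, shearSplit, consSplit]⟩
    · exact ⟨![1, 1, 0], by simp [edgeSplit, shearSplit, consSplit]⟩

/-- By commensurability a positive power of `a` is conjugate, by the free part of `γ`, to a power of
`b`. One statement serves both for conjugates of one edge group and for different edges. -/
theorem eq_and_mem_of_commensurable {α A : Type*} [CommGroup A] {a b : α}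
    {H K : Subgroup (FreeGroup α × A)} (hH : ∀ x, x.1 ∈ Subgroup.zpowers (.of a) → x ∈ H)
    (hK : ∀ x ∈ K, x.1 ∈ Subgroup.zpowers (.of b)) {γ : FreeGroup α × A}
    (h : Subgroup.Commensurable H (GraphOfGroups.conjSubgroup γ K)) :
    b = a ∧ γ.1 ∈ Subgroup.zpowers (.of a) := by
  classical
  obtain ⟨n, hn, -, hx⟩ := Subgroup.exists_pow_mem_of_relIndex_ne_zero h.2
    (hH (.of a, 1) (Subgroup.mem_zpowers _))
  obtain ⟨y, hy, e⟩ := (Subgroup.mem_inf.1 hx).1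
  obtain ⟨k, hk⟩ := hK y hy
  refine FreeGroup.eq_and_mem_zpowers_of_conj_eq hn.ne' (k := k) ?_
  have := congrArg Prod.fst e
  change FreeGroup.of b ^ k = y.1 at hk
  rw [hk]
  simpa using this

/-- The central free abelian factor of a vertex group. -/
def fiberGroup (v : torusGraph.V) : Subgroup (torusGroups.vertexGroup v) :=
  (MonoidHom.fst (FreeGroup (EdgeEnds v)) (Multiplicative (Fin 2 → ℤ))).ker

instance (v : torusGraph.V) : (fiberGroup v).Normal := MonoidHom.normal_ker _

/-- The quotient of a vertex group by its free abelian factor. -/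
def quotientFiberGroupEquiv (v : torusGraph.V) :
    torusGroups.vertexGroup v ⧸ fiberGroup v ≃* FreeGroup (EdgeEnds v) :=
  QuotientGroup.quotientKerEquivOfSurjective
    (MonoidHom.fst (FreeGroup (EdgeEnds v)) (Multiplicative (Fin 2 → ℤ))) Prod.fst_surjective

theorem isFreeAbelianOfRank_fiberGroup (v : torusGraph.V) :
    IsFreeAbelianOfRank (fiberGroup v) 2 :=
  ⟨{  toFun x := x.1.2
      invFun m := ⟨(1, m), rfl⟩
      left_inv := fun x => Subtype.ext (Prod.ext (show (1 : FreeGroup (EdgeEnds v)) = x.1.1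
        from (show x.1.1 = 1 from x.2).symm) rfl)
      right_inv := fun _ => rfl
      map_mul' := fun _ _ => rfl }⟩

theorem isAdmissible_torusGroups : torusGroups.IsAdmissible 3 where
  one_le_rank := by norm_num
  finite_V := inferInstanceAs (Finite (Bool × Fin 4))
  finite_E := inferInstanceAs (Finite TorusIndex)
  nonempty_E := ⟨TorusIndex.x⟩
  vertex := by
    refine ⟨fiberGroup, fun v => inferInstance, fun v => ⟨isFreeAbelianOfRank_fiberGroup v, ?_, ?_⟩,
      fun e => ?_⟩
    · classical exact FreeGroup.isHyperbolicGroup.of_equiv (quotientFiberGroupEquiv v).symm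
    · classical exact fun h => FreeGroup.not_isElementaryGroup (h.of_equiv
        (quotientFiberGroupEquiv v))
    · obtain ⟨u, h0, h1⟩ := exists_edgeSplit e
      suffices h : (fiberGroup (torusGraph.bd false e)).comap (torusGroups.ι false e) ⊔
          (fiberGroup (torusGraph.bd true e)).comap (torusGroups.ι true e) = ⊤ by
        rw [h]; infer_instance
      refine (Subgroup.eq_top_iff' _).2 fun (n : Multiplicative (Fin 3 → ℤ)) => ?_
      have hker : ∀ (s : Bool) (n : Fin 3 → ℤ), (edgeSplit s e n).1 = 0 →
          (edgeIncl s e (.ofAdd n)).1 = 1 := fun s n h => by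
        rw [edgeIncl_apply, h, zpow_zero]
      let k := (edgeSplit false e n.toAdd).1
      -- Subtracting the multiple `k • u` kills the free coordinate at the initial vertex, while `k
      -- • u` has none at the terminal vertex.
      have hn : n = .ofAdd (n.toAdd - k • u) * .ofAdd (k • u) := by
        rw [← ofAdd_add, sub_add_cancel]; rfl
      rw [hn]
      refine Subgroup.mul_mem_sup (hker false _ ?_) (hker true _ ?_)
      · rw [map_sub, map_zsmul, Prod.fst_sub, Prod.smul_fst, h1]
        simp [k]
      · rw [map_zsmul, Prod.smul_fst, h0, smul_zero]
  edge e := ⟨⊤, inferInstance, ⟨Subgroup.topEquiv⟩⟩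
  incommensurable_conj s e γ hγ h := by
    refine hγ (mem_range_edgeIncl.2 (eq_and_mem_of_commensurable (K := (edgeIncl s e).range)
      (fun x hx => mem_range_edgeIncl.2 hx) (fun x hx => mem_range_edgeIncl.1 hx) h).2)
  not_conj_commensurable v s s' e e' h h' hne γ hc := by
    have key : ∀ (s : Bool) (e : TorusIndex) (h : torusGraph.bd s e = v)
        (x : FreeGroup (EdgeEnds v) × Multiplicative (Fin 2 → ℤ)),
        x ∈ torusGroups.edgeImage s e h ↔
          x.1 ∈ Subgroup.zpowers (FreeGroup.of (⟨(s, e), h⟩ : EdgeEnds v)) := by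
      rintro s e rfl x
      exact mem_range_edgeIncl
    have := (eq_and_mem_of_commensurable (fun x hx => (key s e h x).2 hx)
      (fun x hx => (key s' e' h' x).1 hx) hc).1
    exact hne (congrArg Subtype.val this).symm

theorem nonempty_vertexGroup_equiv (v : torusGraph.V) : Nonempty (torusGroups.vertexGroup v ≃*
    FreeGroup (Fin (if v.2 = 0 then 3 else 2)) × Multiplicative (Fin 2 → ℤ)) :=
  ⟨(FreeGroup.freeGroupCongr (Fintype.equivFinOfCardEq (card_edgeEnds v))).prodCongr
    (MulEquiv.refl _)⟩

end TorusComplex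
end

noncomputable section

namespace TorusComplex

/-! ### The fundamental group of the graph of groups as a universal local system -/

/-- The vertex to which a cylinder belongs. -/
def cylinderVertex : CylinderIndex → Bool × Fin 4
  | .cx g => (g, 0)
  | .c g i => (g, i)

/-- The end of the edge `endTorus c b` at the vertex of the cylinder. -/
def endSide : CylinderIndex → Bool → Bool
  | .cx true, _ => true
  | _, b => !b

/-- The identification of the group of a cylinder with the fibre group of its vertex. -/
def twist : CylinderIndex → (Fin 2 → ℤ) → Fin 2 → ℤ
  | .cx true, m => ![-m 0, m 1]
  | _, m => m

theorem twist_add (c : CylinderIndex) (m m' : Fin 2 → ℤ) :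
    twist c (m + m') = twist c m + twist c m' := by
  rcases c with (_ | _) | _ <;> try rfl
  ext j; fin_cases j <;> simp [twist, add_comm]

theorem twist_twist (c : CylinderIndex) (m : Fin 2 → ℤ) : twist c (twist c m) = m := by
  rcases c with (_ | _) | _ <;> try rfl
  ext j; fin_cases j <;> simp [twist]

theorem bd_endSide (c : CylinderIndex) (b : Bool) :
    torusGraph.bd (endSide c b) (endTorus c b) = cylinderVertex c := by
  rcases c with g | ⟨g, i⟩
  · cases g <;> cases b <;> rfl
  · fin_cases i <;> cases b <;> rfl

theorem exists_endSide_eq (s : Bool) (e : TorusIndex) :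
    ∃ c b, endSide c b = s ∧ endTorus c b = e := by
  rcases e with _ | ⟨g, i⟩
  · cases s
    exacts [⟨.cx false, true, rfl, rfl⟩, ⟨.cx true, false, rfl, rfl⟩]
  · fin_cases i <;> cases s
    exacts [⟨.c g 3, true, rfl, rfl⟩, ⟨.c g 0, false, rfl, rfl⟩, ⟨.c g 0, true, rfl, rfl⟩,
      ⟨.c g 1, false, rfl, rfl⟩, ⟨.c g 1, true, rfl, rfl⟩, ⟨.c g 2, false, rfl, rfl⟩,
      ⟨.c g 2, true, rfl, rfl⟩, ⟨.c g 3, false, rfl, rfl⟩]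

/-- The link between geometry and algebra: the lattice of an end of a cylinder is the fibre group of
its vertex inside the edge group of the torus. -/
theorem endLat_eq (c : CylinderIndex) (b : Bool) (m : Fin 2 → ℤ) :
    endLat c b m = (edgeSplit (endSide c b) (endTorus c b)).symm (0, twist c m) := by
  rcases c with g | ⟨g, i⟩
  · cases g <;> cases b <;> ext j <;> fin_cases j <;>
      simp [endLat, edgeSplit, endSide, endTorus, twist, shearSplit, snocSplit, AddEquiv.symm]
  · fin_cases i <;> cases b <;> ext j <;> fin_cases j <;>
      simp [endLat, edgeSplit, endSide, endTorus, twist, shearSplit, consSplit, AddEquiv.symm]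

/-- A local system is normalized if the transports are trivial on a maximal tree. -/
def LocalSystem.Normalized {Q : Type*} [Group Q] (D : LocalSystem Q) : Prop :=
  ∀ c b, (∀ g, (c, b) ≠ (.c g 3, true)) → D.tr c b = 1

/-- On the maximal tree, a gauge transformation between normalized systems is constant. -/
theorem exists_eq_of_tree {A : Type*} {h : TorusIndex → A} {k : CylinderIndex → A}
    (H : ∀ c b, (∀ g, (c, b) ≠ (.c g 3, true)) → k c = h (endTorus c b)) :
    ∃ q, (∀ e, h e = q) ∧ ∀ c, k c = q := by
  -- The exceptional ends are excluded by a Boolean condition, which is decided by computation in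
  -- each case below.
  have H' : ∀ c b, (c.casesOn (fun _ => true) fun _ i => decide (i ≠ 3) || !b) = true →
      k c = h (endTorus c b) := by
    intro c b hc
    refine H c b ?_
    rintro g ⟨⟩
    simp at hc
  have hx : ∀ g, k (.cx g) = h .x := by
    rintro (_ | _)
    exacts [H' (.cx false) true rfl, H' (.cx true) false rfl]
  have h0 : ∀ g, h (.e g 0) = h .x := by
    rintro (_ | _)
    exacts [(H' (.cx false) false rfl).symm.trans (hx _), (H' (.cx true) true rfl).symm.trans
        (hx _)]
  have k0 : ∀ g, k (.c g 0) = h .x := fun g => (H' (.c g 0) false rfl).trans (h0 g)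
  have h1 : ∀ g, h (.e g 1) = h .x := fun g => (H' (.c g 0) true rfl).symm.trans (k0 g)
  have k1 : ∀ g, k (.c g 1) = h .x := fun g => (H' (.c g 1) false rfl).trans (h1 g)
  have h2 : ∀ g, h (.e g 2) = h .x := fun g => (H' (.c g 1) true rfl).symm.trans (k1 g)
  have k2 : ∀ g, k (.c g 2) = h .x := fun g => (H' (.c g 2) false rfl).trans (h2 g)
  have h3 : ∀ g, h (.e g 3) = h .x := fun g => (H' (.c g 2) true rfl).symm.trans (k2 g)
  have k3 : ∀ g, k (.c g 3) = h .x := fun g => (H' (.c g 3) false rfl).trans (h3 g)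
  refine ⟨h .x, ?_, ?_⟩
  · rintro (_ | ⟨g, i⟩)
    · rfl
    · fin_cases i
      exacts [h0 g, h1 g, h2 g, h3 g]
  · rintro (g | ⟨g, i⟩)
    · exact hx g
    · fin_cases i
      exacts [k0 g, k1 g, k2 g, k3 g]

namespace LocalSystem

variable {Q : Type*} [Group Q]

/-- The values of `h` and `k` are found by walking away from the torus `E_x` along the tree. Only
the far ends of the cylinders `C_3^±` close up loops, and their transports remain. -/
theorem exists_normalized_gauge (D : LocalSystem Q) : ∃ h k, (D.gauge h k).Normalized := by
  let kx : Bool → Q := fun g => (D.tr (.cx g) (!g))⁻¹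
  let h0 : Bool → Q := fun g => kx g * D.tr (.cx g) g
  let k0 : Bool → Q := fun g => h0 g * (D.tr (.c g 0) false)⁻¹
  let h1 : Bool → Q := fun g => k0 g * D.tr (.c g 0) true
  let k1 : Bool → Q := fun g => h1 g * (D.tr (.c g 1) false)⁻¹
  let h2 : Bool → Q := fun g => k1 g * D.tr (.c g 1) true
  let k2 : Bool → Q := fun g => h2 g * (D.tr (.c g 2) false)⁻¹
  let h3 : Bool → Q := fun g => k2 g * D.tr (.c g 2) true
  let k3 : Bool → Q := fun g => h3 g * (D.tr (.c g 3) false)⁻¹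
  let h : TorusIndex → Q
    | .x => 1
    | .e g 0 => h0 g
    | .e g 1 => h1 g
    | .e g 2 => h2 g
    | .e g 3 => h3 g
  let k : CylinderIndex → Q
    | .cx g => kx g
    | .c g 0 => k0 g
    | .c g 1 => k1 g
    | .c g 2 => k2 g
    | .c g 3 => k3 g
  refine ⟨h, k, fun c b hcb => mul_inv_eq_one.2 ?_⟩
  rcases c with g | ⟨g, i⟩
  · cases g <;> cases b
    · rfl
    · exact inv_mul_cancel _
    · exact inv_mul_cancel _
    · rfl
  · fin_cases i <;> cases b
    · exact inv_mul_cancel_right _ _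
    · rfl
    · exact inv_mul_cancel_right _ _
    · rfl
    · exact inv_mul_cancel_right _ _
    · rfl
    · exact inv_mul_cancel_right _ _
    · exact (hcb g rfl).elim

variable (D : LocalSystem Q)

/-- The element of `Q` that corresponds to the stable letter of an edge. -/
def stable : TorusIndex → Q
  | .e g 0 => (D.tr (.c g 3) true)⁻¹
  | _ => 1

theorem stable_of_mem_torusTree {e : TorusIndex} (he : e ∈ torusTree) : D.stable e = 1 := by
  rcases e with _ | ⟨g, i⟩
  · rfl
  · fin_cases i
    · exact (he g rfl).elim
    all_goals rfl

/-- The transport to the end `s` of an edge. -/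
def sideTr (s : Bool) (e : TorusIndex) : Q := if s then 1 else (D.stable e)⁻¹

/-- The homomorphism of an edge group, transported to the end `s` of the edge. -/
def sideHom (s : Bool) (e : TorusIndex) : Multiplicative (Fin 3 → ℤ) →* Q :=
  (MulAut.conj (D.sideTr s e)).toMonoidHom.comp (D.torusHom e)

theorem sideHom_apply (s : Bool) (e : TorusIndex) (n : Multiplicative (Fin 3 → ℤ)) :
    D.sideHom s e n = D.sideTr s e * D.torusHom e n * (D.sideTr s e)⁻¹ := rfl

theorem sideHom_true (e : TorusIndex) (n : Multiplicative (Fin 3 → ℤ)) :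
    D.sideHom true e n = D.torusHom e n := by
  rw [sideHom_apply, show D.sideTr true e = 1 from rfl, one_mul, inv_one, mul_one]

theorem sideHom_false (e : TorusIndex) (n : Multiplicative (Fin 3 → ℤ)) :
    D.sideHom false e n = (D.stable e)⁻¹ * D.torusHom e n * D.stable e := by
  rw [sideHom_apply, show D.sideTr false e = (D.stable e)⁻¹ from rfl, inv_inv]

/-- The generator of a vertex group. -/
def gen {v : Bool × Fin 4} (p : EdgeEnds v) : Q :=
  D.sideHom p.1.1 p.1.2 (.ofAdd ((edgeSplit p.1.1 p.1.2).symm (1, 0)))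

/-- The homomorphism of the fibre group of a vertex. -/
def fiberHom (v : Bool × Fin 4) : Multiplicative (Fin 2 → ℤ) →* Q := D.cylinderHom (.c v.1 v.2)

variable {D}

/-- The remaining transport, at the far end of `C_3^±`, is the inverse of the stable letter of
`E_0^±`, because this cylinder belongs to the initial vertex of that edge. -/
theorem Normalized.tr_eq (hD : D.Normalized) (c : CylinderIndex) (b : Bool) :
    D.tr c b = D.sideTr (endSide c b) (endTorus c b) := by
  by_cases h : ∃ g, (c, b) = (.c g 3, true)
  · obtain ⟨g, h⟩ := h
    obtain ⟨rfl, rfl⟩ := Prod.mk.inj h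
    exact (inv_inv _).symm
  · rw [hD c b fun g hg => h ⟨g, hg⟩, sideTr]
    split_ifs with hs
    · rfl
    · rw [stable_of_mem_torusTree, inv_one]
      rintro g he
      apply h
      refine ⟨g, ?_⟩
      rcases c with g | ⟨g, i⟩
      · cases g <;> cases b <;> simp_all [endSide, endTorus]
      · fin_cases i <;> cases b <;> simp_all [endSide, endTorus]

theorem Normalized.cylinderHom_eq (hD : D.Normalized) (c : CylinderIndex) (b : Bool)
    (m : Fin 2 → ℤ) :
    D.cylinderHom c (.ofAdd m) = D.sideHom (endSide c b) (endTorus c b)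
      (.ofAdd ((edgeSplit (endSide c b) (endTorus c b)).symm (0, twist c m))) := by
  rw [D.rel c b, hD.tr_eq, endLat_eq, sideHom_apply]

/-- At the vertex `V_0^±` there are two cylinders. They end on `E_0^±` along parallel subtori, so
their homomorphisms agree up to the sign in `twist`. -/
theorem Normalized.cylinderHom_eq_fiberHom (hD : D.Normalized) (c : CylinderIndex) (m : Fin 2 → ℤ) :
    D.cylinderHom c (.ofAdd m) = D.fiberHom (cylinderVertex c) (.ofAdd (twist c m)) := by
  rcases c with g | ⟨g, i⟩
  · exact (by cases g; exacts [hD.cylinderHom_eq (.cx false) false m,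
      hD.cylinderHom_eq (.cx true) true m] : _ = D.sideHom true (.e g 0)
        (.ofAdd ((edgeSplit true (.e g 0)).symm (0, twist (.cx g) m)))).trans
      (hD.cylinderHom_eq (.c g 0) false (twist (.cx g) m)).symm
  · rfl

theorem Normalized.sideHom_fiber (hD : D.Normalized) (s : Bool) (e : TorusIndex) (m : Fin 2 → ℤ) :
    D.sideHom s e (.ofAdd ((edgeSplit s e).symm (0, m))) =
      D.fiberHom (torusGraph.bd s e) (.ofAdd m) := by
  obtain ⟨c, b, rfl, rfl⟩ := exists_endSide_eq s e
  have h1 := hD.cylinderHom_eq c b (twist c m)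
  rw [hD.cylinderHom_eq_fiberHom, twist_twist] at h1
  rw [← h1, bd_endSide]

/-- Each generator and the fibre group come from one and the same abelian edge group. -/
theorem Normalized.commute (hD : D.Normalized) (v : Bool × Fin 4) (x : FreeGroup (EdgeEnds v))
    (m : Multiplicative (Fin 2 → ℤ)) : Commute (FreeGroup.lift D.gen x) (D.fiberHom v m) := by
  induction x using FreeGroup.induction_on with
  | C1 => rw [_root_.map_one]; exact Commute.one_left _
  | of p =>
    obtain ⟨⟨s, e⟩, rfl⟩ := p
    rw [FreeGroup.lift_apply_of]
    have := hD.sideHom_fiber s e m.toAdd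
    rw [ofAdd_toAdd] at this
    rw [← this]
    exact (Commute.all _ _).map (D.sideHom s e)
  | inv_of p h => rw [_root_.map_inv]; exact h.inv_left
  | mul x y hx hy => rw [_root_.map_mul]; exact hx.mul_left hy

/-- The homomorphism of a vertex group. -/
def Normalized.vertexHom (hD : D.Normalized) (v : Bool × Fin 4) :
    FreeGroup (EdgeEnds v) × Multiplicative (Fin 2 → ℤ) →* Q :=
  (FreeGroup.lift D.gen).noncommCoprod (D.fiberHom v) (hD.commute v)

theorem edgeSplit_symm_eq (s : Bool) (e : TorusIndex) (n : Fin 3 → ℤ) :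
    n = (edgeSplit s e n).1 • (edgeSplit s e).symm (1, 0) +
      (edgeSplit s e).symm (0, (edgeSplit s e n).2) := by
  rw [← map_zsmul, ← map_add, eq_comm, AddEquiv.symm_apply_eq]
  ext <;> simp

theorem Normalized.vertexHom_edgeIncl (hD : D.Normalized) (s : Bool) (e : TorusIndex)
    (n : Multiplicative (Fin 3 → ℤ)) : hD.vertexHom _ (edgeIncl s e n) = D.sideHom s e n := by
  obtain ⟨n, rfl⟩ := Multiplicative.ofAdd.surjective n
  rw [edgeIncl_apply, vertexHom, MonoidHom.noncommCoprod_apply, map_zpow, FreeGroup.lift_apply_of,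
    ← hD.sideHom_fiber, gen, ← map_zpow, ← ofAdd_zsmul, ← _root_.map_mul, ← ofAdd_add,
    ← edgeSplit_symm_eq]

/-- The homomorphism of the fundamental group of the graph of groups to `Q`. -/
def Normalized.fundHom (hD : D.Normalized) : torusGroups.FundGroup torusTree →* Q :=
  QuotientGroup.lift _ (Monoid.Coprod.lift (Monoid.CoprodI.lift hD.vertexHom)
    (FreeGroup.lift D.stable)) <| by
  -- It suffices to kill the relators. Those of an edge hold since `vertexHom` restricts on both
  -- sides to the homomorphism of the torus, conjugated by the stable letter on the initial side.
  refine fun x hx => Subgroup.normalClosure_le_normal (N := MonoidHom.ker _) ?_ hx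
  rintro _ (⟨e, n, rfl⟩ | ⟨e, he, rfl⟩)
  · have h1 := (hD.vertexHom_edgeIncl true e n).trans (D.sideHom_true e n)
    have h2 := (hD.vertexHom_edgeIncl false e n).trans (D.sideHom_false e n)
    simp only [SetLike.mem_coe, MonoidHom.mem_ker, _root_.map_mul, _root_.map_inv,
      GraphOfGroups.stableLetter, GraphOfGroups.ofVertex, MonoidHom.comp_apply,
      Monoid.Coprod.lift_apply_inl, Monoid.Coprod.lift_apply_inr, FreeGroup.lift_apply_of]
    erw [Monoid.CoprodI.lift_of, Monoid.CoprodI.lift_of, h1, h2]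
    group
  · simp only [SetLike.mem_coe, MonoidHom.mem_ker, GraphOfGroups.stableLetter,
      Monoid.Coprod.lift_apply_inr, FreeGroup.lift_apply_of]
    exact stable_of_mem_torusTree D he

end LocalSystem

end TorusComplex
end

/-! ### The universal local system and the isomorphism with the fundamental group -/

noncomputable section

namespace TorusComplex

/-- The fundamental group of the graph of groups. -/
abbrev TorusGroup : Type := torusGroups.FundGroup torusTree

/-- The homomorphism of a vertex group to the fundamental group of the graph of groups. -/
def vertexIncl (v : Bool × Fin 4) :
    FreeGroup (EdgeEnds v) × Multiplicative (Fin 2 → ℤ) →* TorusGroup :=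
  (QuotientGroup.mk' _).comp (torusGroups.ofVertex v)

/-- The stable letter of an edge in the fundamental group of the graph of groups. -/
def letter (e : TorusIndex) : TorusGroup := QuotientGroup.mk' _ (torusGroups.stableLetter e)

theorem letter_of_mem_torusTree {e : TorusIndex} (he : e ∈ torusTree) : letter e = 1 :=
  (QuotientGroup.eq_one_iff _).2 (Subgroup.subset_normalClosure (Or.inr ⟨e, he, rfl⟩))

theorem letter_conj (e : TorusIndex) (n : Multiplicative (Fin 3 → ℤ)) :
    letter e * vertexIncl _ (edgeIncl false e n) * (letter e)⁻¹ =
      vertexIncl _ (edgeIncl true e n) :=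
  mul_inv_eq_one.1 ((QuotientGroup.eq_one_iff _).2
    (Subgroup.subset_normalClosure (Or.inl ⟨e, n, rfl⟩)))

/-- The fibre groups of the vertices in the fundamental group of the graph of groups. -/
def fiberIncl (v : Bool × Fin 4) : Multiplicative (Fin 2 → ℤ) →* TorusGroup :=
  (vertexIncl v).comp (MonoidHom.inr _ _)

/-- The end of an edge of the graph of groups, conjugated to the other end by the stable letter. -/
def endLetter (s : Bool) (e : TorusIndex) : TorusGroup := if s then 1 else (letter e)⁻¹

theorem endLetter_conj (s : Bool) (e : TorusIndex) (n : Multiplicative (Fin 3 → ℤ)) :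
    endLetter s e * vertexIncl _ (edgeIncl true e n) * (endLetter s e)⁻¹ =
      vertexIncl _ (edgeIncl s e n) := by
  cases s
  · rw [← letter_conj]
    simp only [endLetter, Bool.false_eq_true, if_false]
    group
  · simp [endLetter]

theorem edgeIncl_symm (s : Bool) (e : TorusIndex) (m : Fin 2 → ℤ) :
    edgeIncl s e (.ofAdd ((edgeSplit s e).symm (0, m))) = (1, .ofAdd m) := by
  rw [edgeIncl_apply, AddEquiv.apply_symm_apply, zpow_zero]

theorem edgeIncl_symm_one (s : Bool) (e : TorusIndex) :
    edgeIncl s e (.ofAdd ((edgeSplit s e).symm (1, 0))) = (edgeGen s e, 1) := by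
  rw [edgeIncl_apply, AddEquiv.apply_symm_apply, zpow_one, ofAdd_zero]

/-- The local system of the graph of groups. -/
def universalSystem : LocalSystem TorusGroup where
  torusHom e := (vertexIncl _).comp (edgeIncl true e)
  cylinderHom c := (fiberIncl (cylinderVertex c)).comp
    (AddMonoidHom.mk' (twist c) (twist_add c)).toMultiplicative
  tr c b := endLetter (endSide c b) (endTorus c b)
  rel c b m := by
    rw [MonoidHom.comp_apply, MonoidHom.comp_apply, endLetter_conj, endLat_eq, edgeIncl_symm,
      ← bd_endSide c b]
    rfl

theorem universalSystem_normalized : universalSystem.Normalized := by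
  intro c b hcb
  change endLetter _ _ = 1
  rw [endLetter]
  split_ifs with hs
  · rfl
  · rw [letter_of_mem_torusTree, inv_one]
    rintro g he
    apply hcb g
    rcases c with g | ⟨g, i⟩
    · cases g <;> cases b <;> simp_all [endSide, endTorus]
    · fin_cases i <;> cases b <;> simp_all [endSide, endTorus]

theorem universalSystem_tr (g : Bool) :
    universalSystem.tr (.c g 3) true = (letter (.e g 0))⁻¹ := rfl

section

variable {Q : Type*} [Group Q]

/-- The universal system generates: its transports give the stable letters outside the tree, and
with these its torus groups give both images of every edge group, which contain all generators and
fibres of the vertex groups. -/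
theorem TorusGroup.hom_ext {f f' : TorusGroup →* Q}
    (h1 : ∀ e n, f (universalSystem.torusHom e n) = f' (universalSystem.torusHom e n))
    (h2 : ∀ c b, f (universalSystem.tr c b) = f' (universalSystem.tr c b)) : f = f' := by
  have hl : ∀ e, f (letter e) = f' (letter e) := by
    intro e
    by_cases he : e ∈ torusTree
    · rw [letter_of_mem_torusTree he, _root_.map_one, _root_.map_one]
    · obtain ⟨g, rfl⟩ : ∃ g, e = .e g 0 := by
        by_contra h
        exact he fun g hg => h ⟨g, hg⟩
      have := h2 (.c g 3) true
      rwa [universalSystem_tr, _root_.map_inv, _root_.map_inv, inv_inj] at this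
  have he : ∀ s e, f (endLetter s e) = f' (endLetter s e) := by
    rintro (_ | _) e
    · simp only [endLetter, Bool.false_eq_true, if_false, _root_.map_inv, hl e]
    · simp [endLetter]
  have hv : ∀ s e n, f (vertexIncl _ (edgeIncl s e n)) = f' (vertexIncl _ (edgeIncl s e n)) := by
    intro s e n
    rw [← endLetter_conj, _root_.map_mul, _root_.map_mul, _root_.map_inv, he, _root_.map_mul f',
      _root_.map_mul f', _root_.map_inv f']
    congr 2
    exact h1 e n
  have hV : ∀ v, f.comp (vertexIncl v) = f'.comp (vertexIncl v) := by
    intro v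
    have e1 : (f.comp (vertexIncl v)).comp (MonoidHom.inl _ _) =
        (f'.comp (vertexIncl v)).comp (MonoidHom.inl _ _) := by
      refine FreeGroup.ext_hom _ _ ?_
      rintro ⟨⟨s, e⟩, rfl⟩
      have := hv s e (.ofAdd ((edgeSplit s e).symm (1, 0)))
      rwa [edgeIncl_symm_one] at this
    have e2 : (f.comp (vertexIncl v)).comp (MonoidHom.inr _ _) =
        (f'.comp (vertexIncl v)).comp (MonoidHom.inr _ _) := by
      refine MonoidHom.ext fun m => ?_
      have := hv true (.e v.1 v.2) (.ofAdd ((edgeSplit true (.e v.1 v.2)).symm (0, m.toAdd)))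
      rwa [edgeIncl_symm] at this
    ext x
    rw [← Prod.fst_mul_snd x, _root_.map_mul, _root_.map_mul]
    exact congrArg₂ (· * ·) (DFunLike.congr_fun e1 x.1) (DFunLike.congr_fun e2 x.2)
  refine QuotientGroup.monoidHom_ext _ (Monoid.Coprod.hom_ext (Monoid.CoprodI.ext_hom _ _ hV)
    (FreeGroup.ext_hom _ _ hl))

namespace LocalSystem.Normalized

variable {D : LocalSystem Q}

theorem fundHom_vertexIncl (hD : D.Normalized) (v : Bool × Fin 4)
    (x : FreeGroup (EdgeEnds v) × Multiplicative (Fin 2 → ℤ)) :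
    hD.fundHom (vertexIncl v x) = hD.vertexHom v x := by
  refine (QuotientGroup.lift_mk' _ _ _).trans ?_
  refine (Monoid.Coprod.lift_apply_inl _ _ _).trans ?_
  exact Monoid.CoprodI.lift_of (M := torusGroups.vertexGroup) hD.vertexHom x

theorem fundHom_letter (hD : D.Normalized) (e : TorusIndex) :
    hD.fundHom (letter e) = D.stable e := by
  refine (QuotientGroup.lift_mk' _ _ _).trans ?_
  rw [GraphOfGroups.stableLetter, Monoid.Coprod.lift_apply_inr, FreeGroup.lift_apply_of]

theorem fundHom_torusHom (hD : D.Normalized) (e : TorusIndex) (n : Multiplicative (Fin 3 → ℤ)) :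
    hD.fundHom (universalSystem.torusHom e n) = D.torusHom e n :=
  (hD.fundHom_vertexIncl _ _).trans ((hD.vertexHom_edgeIncl true e n).trans (D.sideHom_true e n))

theorem fundHom_tr (hD : D.Normalized) (c : CylinderIndex) (b : Bool) :
    hD.fundHom (universalSystem.tr c b) = D.tr c b := by
  rw [hD.tr_eq]
  change hD.fundHom (endLetter _ _) = _
  rw [endLetter, sideTr]
  split_ifs
  · exact _root_.map_one _
  · rw [_root_.map_inv, hD.fundHom_letter]

end LocalSystem.Normalized

end

variable {ε : ℝ≥0} {y₀ : YSpace ε}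

local notation "Γ" => FundamentalGroup (YSpace ε) y₀

/-- Surjectivity is `Development.eq_top`. For injectivity, the monodromy `Φ` of the universal system
undoes `fundHom` up to an inner automorphism. -/
theorem Development.fundHom_bijective {D : LocalSystem Γ} (V : Development D)
    (hD : D.Normalized) : Function.Bijective hD.fundHom := by
  constructor
  · obtain ⟨Φ, h, k, h1, h2⟩ := V.exists_monodromy universalSystem
    -- Both systems are trivial along the tree, so the comparison elements `h` and `k` are all equal
    -- to a single `q`.
    obtain ⟨q, hq, kq⟩ := exists_eq_of_tree (h := h) (k := k) fun c b hcb => by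
      have := h2 c b
      rw [hD c b hcb, universalSystem_normalized c b hcb, _root_.map_one, mul_one] at this
      exact (mul_inv_eq_one.1 this.symm)
    have e : Φ.comp hD.fundHom = (MulAut.conj q).toMonoidHom := by
      refine TorusGroup.hom_ext (fun e n => ?_) fun c b => ?_
      · rw [MonoidHom.comp_apply, hD.fundHom_torusHom, h1, hq]; rfl
      · rw [MonoidHom.comp_apply, hD.fundHom_tr, h2, hq, kq]; rfl
    refine Function.Injective.of_comp (f := Φ) ?_
    rw [← MonoidHom.coe_comp, e]
    exact (MulAut.conj q).injective
  · rw [← MonoidHom.range_eq_top]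
    exact V.eq_top ⟨fun e m => ⟨_, hD.fundHom_torusHom e m⟩, fun c b => ⟨_, hD.fundHom_tr c b⟩⟩

theorem hasFundGroup_torusGroups : torusGroups.HasFundGroup Γ := by
  -- The lifts are changed by deck transformations until the transports along the tree are trivial.
  obtain ⟨D, ⟨V⟩⟩ := exists_development (ε := ε) (y₀ := y₀)
  obtain ⟨h, k, hD⟩ := D.exists_normalized_gauge
  exact ⟨torusTree, isMaximalSubtree_torusTree,
    ⟨(MulEquiv.ofBijective _ ((V.gauge h k).fundHom_bijective hD)).symm⟩⟩

end TorusComplex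
end

open TorusComplex in
theorem proposition7 (ε : ℝ≥0) (y₀ : YSpace ε) :
    IsAdmissibleAction 3 (FundamentalGroup (YSpace ε) y₀) (UniversalCover (YSpace ε) y₀) ∧
    ∃ G : GraphOfGroups torusGraph,
      G.IsAdmissible 3 ∧ G.HasFundGroup (FundamentalGroup (YSpace ε) y₀) ∧
      (∀ v : torusGraph.V, Nonempty (G.vertexGroup v ≃*
        FreeGroup (Fin (if v.2 = 0 then 3 else 2)) × Multiplicative (Fin 2 → ℤ))) ∧
      ∀ e : torusGraph.E, Nonempty (G.edgeGroup e ≃* Multiplicative (Fin 3 → ℤ)) := by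
  obtain ⟨ρ, H⟩ := uniformlyCN ε
  exact ⟨⟨H.isHadamardSpace, H.locallyCompactSpace, H.isGeometricAction,
      torusGraph, torusGroups, isAdmissible_torusGroups, hasFundGroup_torusGroups⟩,
    torusGroups, isAdmissible_torusGroups, hasFundGroup_torusGroups, nonempty_vertexGroup_equiv,
    fun _ => ⟨MulEquiv.refl _⟩⟩
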